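/- **Setting.** Let $V:\mathbb R^n\to\mathbb R$, $c:\mathbb R^n\to\mathbb R^n$, and let $a$ be a map from $\mathbb R^n$ to the symmetric $n\times n$ matrices, such that: - $V\in C^2$, $V\ge 0$, $\lim_{|x|\to\infty}\nabla V(x)\cdot x/|x|=+\infty$, and for some $\epsilon_0>0$, $\lim_{|x|\to\infty}\big[\nabla V(x)\cdot a(x)\nabla V(x)-\epsilon_0\,\mathrm{tr}(a(x)D^2V(x))\big]=+\infty$; - $c\in C^1$ is bounded with bounded first derivatives; - $a\in C^2$ is bounded with bounded derivatives up to order two and uniformly elliptic: there is $C>0$ with $v\cdot a(x)v\ge C^{-1}|v|^2$ for all $x,v\in\mathbb R^n$. Put $b=-a\nabla V+c$. For $T>0$ and a path $X$ define $$I_{[0,T]}(X)=\frac14\int_0^T[\dot X_t-b(X_t)]\cdot a^{-1}(X_t)[\dot X_t-b(X_t)]\,dt$$ if the restriction of $X$ to $[0,T]$ is absolutely continuous with $\int_0^T|\dot X_t|^2dt<\infty$, and $I_{[0,T]}(X)=+\infty$ otherwise. Let $D(\mathbb R;\mathbb R^n)$ be the space of càdlàg paths with the Skorokhod topology on bounded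 intervals and its Borel $\sigma$-algebra: $X^k\to X$ if and only if there are increasing homeomorphisms $\tau_k$ of $\mathbb R$ such that $\tau_k(t)-t\to0$ and $X^k_{\tau_k(t)}-X_t\to0$ uniformly for $t$ in bounded intervals. Let $(\theta_tX)_s=X_{s-t}$, and let $\mathscr P_\theta$ be the set of Borel probabilities $P$ on $D(\mathbb R;\mathbb R^n)$ with $P\circ\theta_t^{-1}=P$ for all $t\in\mathbb R$, with the topology of weak convergence. For $T>0$ and $X\in C([0,T];\mathbb R^n)$ let $X^T_t=X_{t-\lfloor t/T\rfloor T}$, $t\in\mathbb R$, be its $T$-periodization, and let $R_T(X)=\frac1T\int_0^T\delta_{\theta_tX^T}\,dt\in\mathscr P_\theta$ be the empirical process. For $P\in\mathscr P_\theta$ and $x\in\mathbb R^n$ set $$\mathscr I(P)=\int I_{[0,1]}(X)\,dP(X),\qquad \mathscr I^x_{[0,T]}(P)=\inf\{I_{[0,T]}(X):\ X\in C([0,T];\mathbb R^n),\ X_0=x,\ R_T(X)=P\},$$ with $\inf\emptyset=+\infty$. **Theorem 2.2.** Let $K\subset\mathbb R^n$ be compact. Below, $\{P_T\}$ and $\{x_T\}$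 are families indexed by $T\to\infty$. (i) If $\{P_T\}\subset\mathscr P_\theta$ satisfies $\liminf_{T\to\infty}\frac1T\mathscr I^{x_T}_{[0,T]}(P_T)<+\infty$ for some $\{x_T\}\subset K$, then $\{P_T\}$ has a pre-compact subsequence: there are $T_k\to\infty$ such that $\{P_{T_k}\}_{k}$ has compact closure in $\mathscr P_\theta$. (ii) For any $P\in\mathscr P_\theta$, any $\{x_T\}\subset K$ and any $P_T\to P$ in $\mathscr P_\theta$, $$\liminf_{T\to\infty}\frac1T\mathscr I^{x_T}_{[0,T]}(P_T)\ge\mathscr I(P).$$ (iii) For any $P\in\mathscr P_\theta$ and any $\{x_T\}\subset K$ there exist $P_T\in\mathscr P_\theta$ with $P_T\to P$ such that $$\limsup_{T\to\infty}\frac1T\mathscr I^{x_T}_{[0,T]}(P_T)\le\mathscr I(P).$$ -/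

import Mathlib

open Set Filter Topology MeasureTheory
open scoped ENNReal

noncomputable section

namespace EmpiricalProcess

/-! ### Càdlàg paths on the whole line and the Skorokhod topology -/

/-- The space `D(ℝ; E)` of càdlàg paths. -/
structure CadlagPath (E : Type*) [MetricSpace E] where
  toFun : ℝ → E
  right_continuous : ∀ t, ContinuousWithinAt toFun (Ici t) t
  left_limit : ∀ t, ∃ l, Tendsto toFun (𝓝[<] t) (𝓝 l)

namespace CadlagPath

variable {E : Type*} [MetricSpace E]

instance : FunLike (CadlagPath E) ℝ E where
  coe := toFun
  coe_injective := by
    rintro ⟨f, _, _⟩ ⟨g, _, _⟩ h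
    congr

/-- The pairs `(X, Y)` of paths for which there is a time change `τ` (an increasing homeomorphism
of `ℝ`) such that on the window `|t| ≤ 1/r` both `|τ t - t| < r` and `|X t - Y (τ t)| < r`. -/
def skorokhodEntourage (E : Type*) [MetricSpace E] (r : ℝ) : Set (CadlagPath E × CadlagPath E) :=
  {p | ∃ τ : ℝ ≃o ℝ, ∀ t : ℝ, |t| ≤ r⁻¹ → |τ t - t| < r ∧ dist (p.1 t) (p.2 (τ t)) < r}

theorem skorokhodEntourage_mono {r s : ℝ} (hr : 0 < r) (hrs : r ≤ s) :
    skorokhodEntourage E r ⊆ skorokhodEntourage E s := by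
  rintro p ⟨τ, hτ⟩
  refine ⟨τ, fun t ht => ?_⟩
  obtain ⟨h1, h2⟩ := hτ t (ht.trans (inv_anti₀ hr hrs))
  exact ⟨h1.trans_le hrs, h2.trans_le hrs⟩

theorem half_window {r : ℝ} (hr : 0 < r) :
    0 < min r 1 / 2 ∧ min r 1 / 2 ≤ r / 2 ∧ r⁻¹ + min r 1 / 2 ≤ (min r 1 / 2)⁻¹ := by
  have hm : 0 < min r 1 := lt_min hr one_pos
  have h1 : r⁻¹ ≤ (min r 1)⁻¹ := inv_anti₀ hm (min_le_left _ _)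
  have h2 : 1 ≤ (min r 1)⁻¹ := (one_le_inv₀ hm).2 (min_le_right _ _)
  have h3 : (min r 1 / 2)⁻¹ = 2 * (min r 1)⁻¹ := by rw [inv_div]; ring
  have h4 := min_le_left r 1
  have h5 := min_le_right r 1
  refine ⟨by positivity, by linarith, by linarith⟩

/-- The sets `skorokhodEntourage E r`, `r > 0`, as a filter basis. -/
def skorokhodBasis (E : Type*) [MetricSpace E] : FilterBasis (CadlagPath E × CadlagPath E) where
  sets := {U | ∃ r : ℝ, 0 < r ∧ skorokhodEntourage E r = U}
  nonempty := ⟨_, 1, one_pos, rfl⟩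
  inter_sets := by
    rintro _ _ ⟨r, hr, rfl⟩ ⟨s, hs, rfl⟩
    exact ⟨_, ⟨min r s, lt_min hr hs, rfl⟩,
      subset_inter (skorokhodEntourage_mono (lt_min hr hs) (min_le_left _ _))
        (skorokhodEntourage_mono (lt_min hr hs) (min_le_right _ _))⟩

/-- The Skorokhod (`J₁`) topology on bounded intervals of `D(ℝ; E)`, as the topology of the uniform
structure with basis `skorokhodEntourage E r`, `r > 0`. Thus `X_k → X` if and only if there are
increasing homeomorphisms `τ_k` of `ℝ` such that `τ_k t - t → 0` and `X_k (τ_k t) - X t → 0`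
uniformly for `t` in bounded intervals. -/
instance : UniformSpace (CadlagPath E) :=
  UniformSpace.ofCore <| UniformSpace.Core.mkOfBasis (skorokhodBasis E)
    (by
      rintro _ ⟨r, hr, rfl⟩ X
      exact ⟨OrderIso.refl ℝ, fun t _ => by simpa using hr⟩)
    (by
      rintro _ ⟨r, hr, rfl⟩
      obtain ⟨h0, h1, h2⟩ := half_window hr
      refine ⟨_, ⟨_, h0, rfl⟩, ?_⟩
      rintro ⟨X, Y⟩ ⟨τ, hτ⟩
      refine ⟨τ.symm, fun t ht => ?_⟩
      have hw : |τ.symm t| ≤ (min r 1 / 2)⁻¹ := by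
        have hp : |(min r 1 / 2)⁻¹| ≤ (min r 1 / 2)⁻¹ := (abs_of_pos (by positivity)).le
        have hn : |-(min r 1 / 2)⁻¹| ≤ (min r 1 / 2)⁻¹ := by rwa [abs_neg]
        have e1 := abs_lt.1 (hτ _ hp).1
        have e2 := abs_lt.1 (hτ _ hn).1
        have e3 := abs_le.1 ht
        refine abs_le.2 ⟨?_, ?_⟩
        · rw [τ.le_symm_apply]; linarith
        · rw [τ.symm_apply_le]; linarith
      obtain ⟨e1, e2⟩ := hτ _ hw
      rw [τ.apply_symm_apply] at e1 e2
      refine ⟨?_, ?_⟩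
      · rw [abs_sub_comm]; linarith
      · rw [dist_comm]; exact e2.trans_le (by linarith))
    (by
      rintro _ ⟨r, hr, rfl⟩
      obtain ⟨h0, h1, h2⟩ := half_window hr
      refine ⟨_, ⟨_, h0, rfl⟩, ?_⟩
      rintro ⟨X, Z⟩ ⟨Y, ⟨τ, hτ⟩, ⟨σ, hσ⟩⟩
      refine ⟨τ.trans σ, fun t ht => ?_⟩
      obtain ⟨e1, e2⟩ := hτ t (by linarith)
      have hw : |τ t| ≤ (min r 1 / 2)⁻¹ := by
        have := abs_add_le (τ t - t) t
        rw [sub_add_cancel] at this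
        linarith
      obtain ⟨e3, e4⟩ := hσ _ hw
      simp only [OrderIso.trans_apply]
      refine ⟨?_, ?_⟩
      · have := abs_add_le (σ (τ t) - τ t) (τ t - t)
        rw [sub_add_sub_cancel] at this
        linarith
      · have := dist_triangle (X t) (Y (τ t)) (Z (σ (τ t)))
        linarith)

instance : MeasurableSpace (CadlagPath E) := borel _

instance : BorelSpace (CadlagPath E) := ⟨rfl⟩

/-- The translation `(θ_t X)_s = X_{s - t}`. -/
def shift (t : ℝ) (X : CadlagPath E) : CadlagPath E where
  toFun s := X (s - t)
  right_continuous s := by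
    have h : Tendsto (fun u : ℝ => u - t) (𝓝[≥] s) (𝓝[≥] (s - t)) :=
      tendsto_nhdsWithin_iff.2
        ⟨((continuous_id.sub continuous_const).tendsto s).mono_left nhdsWithin_le_nhds,
          eventually_mem_nhdsWithin.mono fun u hu => by
            simp only [mem_Ici] at hu ⊢; linarith⟩
    exact (X.right_continuous (s - t)).tendsto.comp h
  left_limit s := by
    obtain ⟨l, hl⟩ := X.left_limit (s - t)
    have h : Tendsto (fun u : ℝ => u - t) (𝓝[<] s) (𝓝[<] (s - t)) :=
      tendsto_nhdsWithin_iff.2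
        ⟨((continuous_id.sub continuous_const).tendsto s).mono_left nhdsWithin_le_nhds,
          eventually_mem_nhdsWithin.mono fun u hu => by
            simp only [mem_Iio] at hu ⊢; linarith⟩
    exact ⟨l, hl.comp h⟩

theorem shift_apply (t : ℝ) (X : CadlagPath E) (s : ℝ) : shift t X s = X (s - t) := rfl

theorem shift_shift (s t : ℝ) (X : CadlagPath E) : shift s (shift t X) = shift (t + s) X := by
  refine DFunLike.ext _ _ fun u => ?_
  simp only [shift_apply]
  congr 1
  ring

theorem hasBasis_uniformity :
    (uniformity (CadlagPath E)).HasBasis (fun r : ℝ => 0 < r) (skorokhodEntourage E) := by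
  refine ⟨fun U => ?_⟩
  refine (skorokhodBasis E).hasBasis.mem_iff.trans ?_
  constructor
  · rintro ⟨_, ⟨r, hr, rfl⟩, h⟩
    exact ⟨r, hr, h⟩
  · rintro ⟨r, hr, h⟩
    exact ⟨_, ⟨r, hr, rfl⟩, h⟩

theorem continuous_shift_left (X : CadlagPath E) : Continuous fun t => shift t X := by
  refine continuous_iff_continuousAt.2 fun t => ?_
  refine (nhds_basis_uniformity' hasBasis_uniformity).tendsto_right_iff.2 fun r hr => ?_
  filter_upwards [Metric.ball_mem_nhds t hr] with t' ht'
  refine ⟨OrderIso.addRight (t' - t), fun s _ => ?_⟩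
  have h1 : s + (t' - t) - t' = s - t := by ring
  simp only [OrderIso.addRight_apply, shift_apply, h1, dist_self, add_sub_cancel_left]
  exact ⟨by simpa [Real.dist_eq] using ht', hr⟩

theorem continuous_shift (t : ℝ) : Continuous (shift t : CadlagPath E → CadlagPath E) := by
  refine continuous_iff_continuousAt.2 fun X => ?_
  refine (nhds_basis_uniformity' hasBasis_uniformity).tendsto_right_iff.2 fun r hr => ?_
  have hR : 0 < (r⁻¹ + |t|)⁻¹ := by positivity
  have hm : 0 < min r (r⁻¹ + |t|)⁻¹ := lt_min hr hR
  filter_upwards [(nhds_basis_uniformity' hasBasis_uniformity).mem_of_mem hm] with Y hY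
  obtain ⟨τ, hτ⟩ := hY
  refine ⟨(OrderIso.addRight (-t)).trans (τ.trans (OrderIso.addRight t)), fun s hs => ?_⟩
  have hw : |s - t| ≤ (min r (r⁻¹ + |t|)⁻¹)⁻¹ := by
    have h1 := inv_anti₀ hm (min_le_right r (r⁻¹ + |t|)⁻¹)
    rw [inv_inv] at h1
    have := abs_sub s t
    linarith
  obtain ⟨e1, e2⟩ := hτ _ hw
  have hr' := min_le_left r (r⁻¹ + |t|)⁻¹
  simp only [OrderIso.trans_apply, OrderIso.addRight_apply, shift_apply, ← sub_eq_add_neg,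
    add_sub_cancel_right]
  refine ⟨?_, e2.trans_le hr'⟩
  rw [show τ (s - t) + t - s = τ (s - t) - (s - t) by ring]
  exact e1.trans_le hr'

/-- The `T`-periodization `(X^T)_t = X_{t - ⌊t/T⌋ T}` of a continuous path on `[0, T]`.
(The argument lies in `[0, T)`, so that the way `X` is extended off `[0, T]` plays no role.) -/
def periodization {T : ℝ} (hT : 0 < T) (X : C(Icc (0 : ℝ) T, E)) : CadlagPath E where
  toFun t := IccExtend hT.le X (t - ⌊t / T⌋ * T)
  right_continuous t := by
    have hg : Continuous (IccExtend hT.le X) := X.continuous.Icc_extend'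
    have hd : Tendsto (fun s : ℝ => s / T) (𝓝[≥] t) (𝓝[≥] (t / T)) :=
      tendsto_nhdsWithin_iff.2
        ⟨((continuous_id.div_const T).tendsto t).mono_left nhdsWithin_le_nhds,
          eventually_mem_nhdsWithin.mono fun u hu => by
            simp only [mem_Ici] at hu ⊢; gcongr⟩
    have hf : ∀ᶠ s in 𝓝[≥] t, ⌊s / T⌋ = ⌊t / T⌋ :=
      tendsto_pure.1 ((tendsto_floor_right_pure_floor (t / T)).comp hd)
    have hc : ContinuousWithinAt (fun s => IccExtend hT.le X (s - ⌊t / T⌋ * T)) (Ici t) t :=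
      (hg.comp (continuous_id.sub continuous_const)).continuousWithinAt
    exact hc.congr_of_eventuallyEq (hf.mono fun s hs => by simp only [hs]) rfl
  left_limit t := by
    have hg : Continuous (IccExtend hT.le X) := X.continuous.Icc_extend'
    have hd : Tendsto (fun s : ℝ => s / T) (𝓝[<] t) (𝓝[<] (t / T)) :=
      tendsto_nhdsWithin_iff.2
        ⟨((continuous_id.div_const T).tendsto t).mono_left nhdsWithin_le_nhds,
          eventually_mem_nhdsWithin.mono fun u hu => by
            simp only [mem_Iio] at hu ⊢; gcongr⟩
    have hf : ∀ᶠ s in 𝓝[<] t, ⌊s / T⌋ = ⌈t / T⌉ - 1 :=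
      tendsto_pure.1 ((tendsto_floor_left_pure_ceil_sub_one (t / T)).comp hd)
    refine ⟨IccExtend hT.le X (t - ((⌈t / T⌉ - 1 : ℤ) : ℝ) * T), ?_⟩
    have hc : Tendsto (fun s => IccExtend hT.le X (s - ((⌈t / T⌉ - 1 : ℤ) : ℝ) * T)) (𝓝[<] t)
        (𝓝 (IccExtend hT.le X (t - ((⌈t / T⌉ - 1 : ℤ) : ℝ) * T))) :=
      ((hg.comp (continuous_id.sub continuous_const)).tendsto t).mono_left nhdsWithin_le_nhds
    exact hc.congr' (hf.mono fun s hs => by simp only [hs])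

theorem periodization_apply {T : ℝ} (hT : 0 < T) (X : C(Icc (0 : ℝ) T, E)) (t : ℝ) :
    periodization hT X t = IccExtend hT.le X (t - ⌊t / T⌋ * T) := rfl

theorem shift_periodization_add {T : ℝ} (hT : 0 < T) (X : C(Icc (0 : ℝ) T, E)) (k : ℤ) (t : ℝ) :
    shift (k * T + t) (periodization hT X) = shift t (periodization hT X) := by
  refine DFunLike.ext _ _ fun s => ?_
  simp only [shift_apply, periodization_apply]
  have h : (s - (k * T + t)) / T = (s - t) / T - k := by field_simp; ring
  rw [h, Int.floor_sub_intCast]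
  congr 1
  push_cast
  ring

end CadlagPath

open CadlagPath

/-! ### Translation invariant probabilities and the empirical process -/

/-- `𝒫_θ`: the translation invariant Borel probabilities on `D(ℝ; E)`, with the topology of weak
convergence. -/
abbrev InvariantProb (E : Type*) [MetricSpace E] : Type _ :=
  {P : ProbabilityMeasure (CadlagPath E) //
    ∀ t : ℝ, MeasurePreserving (shift t) (P : Measure (CadlagPath E)) (P : Measure (CadlagPath E))}

/-- `T⁻¹ ∫₀ᵀ δ_{θ_t X^T} dt`, written as the image under `t ↦ θ_t X^T` of the normalized Lebesgue
measure on `(0, T]`. -/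
def empiricalMeasure {E : Type*} [MetricSpace E] {T : ℝ} (hT : 0 < T) (X : C(Icc (0 : ℝ) T, E)) :
    Measure (CadlagPath E) :=
  (ENNReal.ofReal T)⁻¹ •
    (volume.restrict (Ioc (0 : ℝ) T)).map (fun t => shift t (periodization hT X))

theorem isProbabilityMeasure_empiricalMeasure {E : Type*} [MetricSpace E] {T : ℝ} (hT : 0 < T)
    (X : C(Icc (0 : ℝ) T, E)) : IsProbabilityMeasure (empiricalMeasure hT X) := by
  constructor
  rw [empiricalMeasure, Measure.smul_apply,
    Measure.map_apply (continuous_shift_left _).measurable MeasurableSet.univ]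
  simp only [preimage_univ, Measure.restrict_apply_univ, Real.volume_Ioc, sub_zero, smul_eq_mul]
  exact ENNReal.inv_mul_cancel (by simpa using hT) ENNReal.ofReal_ne_top

theorem measurePreserving_shift_empiricalMeasure {E : Type*} [MetricSpace E] {T : ℝ} (hT : 0 < T)
    (X : C(Icc (0 : ℝ) T, E)) (s : ℝ) :
    MeasurePreserving (shift s) (empiricalMeasure hT X) (empiricalMeasure hT X) := by
  have hF := (continuous_shift_left (periodization hT X)).measurable
  have hs : Measurable (shift s : CadlagPath E → CadlagPath E) := (continuous_shift s).measurable
  refine ⟨hs, ?_⟩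
  rw [empiricalMeasure, Measure.map_smul, Measure.map_map hs hF]
  congr 1
  refine Measure.ext fun A hA => ?_
  rw [Measure.map_apply (hs.comp hF) hA, Measure.map_apply hF hA]
  set B : Set ℝ := (fun t => shift t (periodization hT X)) ⁻¹' A with hB
  have hBm : MeasurableSet B := hF hA
  have h1 : (shift s ∘ fun t => shift t (periodization hT X)) ⁻¹' A = (fun t => t + s) ⁻¹' B := by
    ext t
    simp [hB, shift_shift]
  have h2 : (fun t : ℝ => t + s) ⁻¹' B ∩ Ioc 0 T = (fun t => t + s) ⁻¹' (B ∩ Ioc s (s + T)) := by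
    ext t
    simp only [mem_inter_iff, mem_preimage, mem_Ioc]
    constructor
    · rintro ⟨h, h', h''⟩; exact ⟨h, by linarith, by linarith⟩
    · rintro ⟨h, h', h''⟩; exact ⟨h, by linarith, by linarith⟩
  rw [h1, Measure.restrict_apply (measurable_add_const s hBm), Measure.restrict_apply hBm, h2,
    measure_preimage_add_right]
  have h3 := (isAddFundamentalDomain_Ioc hT s).measure_set_eq (isAddFundamentalDomain_Ioc hT 0)
    (A := B) hBm (by
      rintro ⟨g, hg⟩
      obtain ⟨k, rfl⟩ := AddSubgroup.mem_zmultiples_iff.1 hg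
      ext t
      simp only [mem_preimage, hB, AddSubgroup.vadd_def, vadd_eq_add, zsmul_eq_mul,
        shift_periodization_add])
  rwa [zero_add] at h3

/-- The empirical process `R_T : C([0, T]; E) → 𝒫_θ`. -/
def empiricalProcess {E : Type*} [MetricSpace E] {T : ℝ} (hT : 0 < T) (X : C(Icc (0 : ℝ) T, E)) :
    InvariantProb E :=
  ⟨⟨empiricalMeasure hT X, isProbabilityMeasure_empiricalMeasure hT X⟩,
    measurePreserving_shift_empiricalMeasure hT X⟩

/-! ### The diffusion coefficients and the Freidlin–Wentzell functional -/

section Diffusion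

variable {n : ℕ}

/-- The Hessian matrix `D² V`. -/
def hessian (V : EuclideanSpace ℝ (Fin n) → ℝ) (x : EuclideanSpace ℝ (Fin n)) :
    Matrix (Fin n) (Fin n) ℝ :=
  Matrix.of fun i j =>
    fderiv ℝ (fderiv ℝ V) x (EuclideanSpace.single i 1) (EuclideanSpace.single j 1)

/-- The standing conditions on the potential `V`, the vector field `c` and the diffusion
matrix `a`. -/
structure Admissible (V : EuclideanSpace ℝ (Fin n) → ℝ)
    (c : EuclideanSpace ℝ (Fin n) → EuclideanSpace ℝ (Fin n))
    (a : EuclideanSpace ℝ (Fin n) → Matrix (Fin n) (Fin n) ℝ) : Prop where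
  V_contDiff : ContDiff ℝ 2 V
  V_nonneg : ∀ x, 0 ≤ V x
  V_coercive :
    Tendsto (fun x => inner ℝ (gradient V x) (‖x‖⁻¹ • x)) (Bornology.cobounded _) atTop
  V_growth : ∃ ε₀ : ℝ, 0 < ε₀ ∧
    Tendsto (fun x => inner ℝ (gradient V x) (Matrix.toEuclideanLin (a x) (gradient V x))
      - ε₀ * Matrix.trace (a x * hessian V x)) (Bornology.cobounded _) atTop
  c_contDiff : ContDiff ℝ 1 c
  c_bounded : ∃ M : ℝ, ∀ k ≤ 1, ∀ x, ‖iteratedFDeriv ℝ k c x‖ ≤ M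
  a_symm : ∀ x, (a x).IsSymm
  a_contDiff : ∀ i j, ContDiff ℝ 2 (fun x => a x i j)
  a_bounded : ∃ M : ℝ, ∀ i j, ∀ k ≤ 2, ∀ x, ‖iteratedFDeriv ℝ k (fun y => a y i j) x‖ ≤ M
  a_elliptic : ∃ C : ℝ, 0 < C ∧ ∀ x v, C⁻¹ * ‖v‖ ^ 2 ≤ inner ℝ v (Matrix.toEuclideanLin (a x) v)

/-- The drift `b = -a ∇V + c`. -/
def drift (V : EuclideanSpace ℝ (Fin n) → ℝ)
    (c : EuclideanSpace ℝ (Fin n) → EuclideanSpace ℝ (Fin n))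
    (a : EuclideanSpace ℝ (Fin n) → Matrix (Fin n) (Fin n) ℝ) (x : EuclideanSpace ℝ (Fin n)) :
    EuclideanSpace ℝ (Fin n) :=
  -Matrix.toEuclideanLin (a x) (gradient V x) + c x

/-- The restriction of `X` to `[0, T]` belongs to `H₁([0, T])`: it is absolutely continuous with
square integrable derivative. -/
def MemH1 (T : ℝ) (X : ℝ → EuclideanSpace ℝ (Fin n)) : Prop :=
  AbsolutelyContinuousOnInterval X 0 T ∧ ∫⁻ t in Ioo 0 T, ‖deriv X t‖ₑ ^ 2 < ⊤

open scoped Classical in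
/-- The Freidlin–Wentzell functional `I_{[0,T]}`. It depends only on the restriction of `X` to
`[0, T]`, and is infinite when this restriction is not in `H₁`, in particular when it is not
continuous. -/
def fwAction (V : EuclideanSpace ℝ (Fin n) → ℝ)
    (c : EuclideanSpace ℝ (Fin n) → EuclideanSpace ℝ (Fin n))
    (a : EuclideanSpace ℝ (Fin n) → Matrix (Fin n) (Fin n) ℝ)
    (T : ℝ) (X : ℝ → EuclideanSpace ℝ (Fin n)) : ℝ≥0∞ :=
  if MemH1 T X then
    4⁻¹ * ∫⁻ t in Ioo 0 T, ENNReal.ofReal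
      (inner ℝ (deriv X t - drift V c a (X t))
        (Matrix.toEuclideanLin (a (X t))⁻¹ (deriv X t - drift V c a (X t))))
  else ⊤

/-- `ℐ(P) = ∫ I_{[0,1]} dP`. -/
def rate (V : EuclideanSpace ℝ (Fin n) → ℝ)
    (c : EuclideanSpace ℝ (Fin n) → EuclideanSpace ℝ (Fin n))
    (a : EuclideanSpace ℝ (Fin n) → Matrix (Fin n) (Fin n) ℝ)
    (P : InvariantProb (EuclideanSpace ℝ (Fin n))) : ℝ≥0∞ :=
  ∫⁻ X, fwAction V c a 1 X ∂(P.1 : Measure (CadlagPath (EuclideanSpace ℝ (Fin n))))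

open scoped Classical in
/-- The functional `I^x_{[0,T]}` on `C([0, T]; ℝⁿ)`: the Freidlin–Wentzell functional for paths
that start at `x`, and infinite for the others. -/
def fwActionFrom (V : EuclideanSpace ℝ (Fin n) → ℝ)
    (c : EuclideanSpace ℝ (Fin n) → EuclideanSpace ℝ (Fin n))
    (a : EuclideanSpace ℝ (Fin n) → Matrix (Fin n) (Fin n) ℝ) (x : EuclideanSpace ℝ (Fin n))
    {T : ℝ} (hT : 0 < T) (X : C(Icc (0 : ℝ) T, EuclideanSpace ℝ (Fin n))) : ℝ≥0∞ :=
  if X ⟨0, left_mem_Icc.2 hT.le⟩ = x then fwAction V c a T (IccExtend hT.le X) else ⊤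

/-- The contracted functional `ℐ^x_{[0,T]}(P) = inf {I^x_{[0,T]}(X) : R_T(X) = P}` for `T > 0`
(the infimum over the empty set is `⊤`; this is also the value given to `T ≤ 0`). -/
def contractedRate (V : EuclideanSpace ℝ (Fin n) → ℝ)
    (c : EuclideanSpace ℝ (Fin n) → EuclideanSpace ℝ (Fin n))
    (a : EuclideanSpace ℝ (Fin n) → Matrix (Fin n) (Fin n) ℝ) (x : EuclideanSpace ℝ (Fin n))
    (T : ℝ) (P : InvariantProb (EuclideanSpace ℝ (Fin n))) : ℝ≥0∞ :=
  ⨅ (hT : 0 < T) (X : C(Icc (0 : ℝ) T, EuclideanSpace ℝ (Fin n)))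
    (_ : empiricalProcess hT X = P), fwActionFrom V c a x hT X

end Diffusion

end EmpiricalProcess

end

open EmpiricalProcess

open Set Filter Topology MeasureTheory
open scoped ENNReal

noncomputable section

namespace EmpiricalProcess

/-! ### The Skorokhod space and its continuous paths -/

namespace CadlagPath

section Basic

variable {E : Type*} [MetricSpace E]

/-! All analysis takes place on `C(ℝ, ℝⁿ)`, which is Polish. The Skorokhod space is only the target
of the continuous injection `ofContinuous`. A path on `[0, T]`, extended by constants and seen from
a uniform random time, has a law `windowLaw` on `C(ℝ, ℝⁿ)`. On a fixed window it differs from the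
empirical process only for times near the seam, a negligible fraction, so both have the same limits
(`tendsto_empiricalProcess`).

Compactness. Since `b = -a∇V + c`, expanding the square in the action produces the cross term `2 ∇V
· Ẋ`, whose time integral is `2 (V(X_T) - V(X_0)) ≥ -2 V(X_0)`. The action therefore bounds both the
kinetic energy and the time integral of `|∇V|²` by a multiple of `T` (`exists_energy_le`). As `|∇V|
→ ∞` at infinity, most positions lie in a ball; by Cauchy–Schwarz, most windows are Hölder
continuous with a controlled constant. Arzelà–Ascoli and Prokhorov conclude.

Lower bound. By Fubini, the mean of the unit-time action over the windows of a path is at most its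
action divided by `T`, up to an end effect. The unit-time action is lower semicontinuous on
continuous paths: a quadratic form is a supremum of affine ones, and each affine bound survives weak
`L²` convergence of the derivatives (`fwAction_le_of_tendsto`). Lower semicontinuity passes to
integrals under weak convergence of laws.

Recovery. If the rate of `P` is finite, `P` is carried by continuous paths. Independent samples from
`P`, conditioned to lie in a large ball at times `0` and `N`, are each followed for time `N` and
linked by segments of unit duration. The law of large numbers gives the empirical averages and the
mean cost; the links cost a bounded amount per cell of length `N + 1` (`exists_block_approx`).
Because the samples are independent, no ergodicity of `P` is needed. A diagonal choice of the
parameters finishes the proof. -/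

instance isCountablyGenerated_uniformity : IsCountablyGenerated (uniformity (CadlagPath E)) := by
  have h : (uniformity (CadlagPath E)).HasBasis (fun _ : ℕ => True)
      (fun k => skorokhodEntourage E (1 / ((k : ℝ) + 1))) := by
    refine hasBasis_uniformity.to_hasBasis (fun r hr => ?_) (fun k _ => ?_)
    · obtain ⟨k, hk⟩ := exists_nat_one_div_lt hr
      exact ⟨k, trivial, skorokhodEntourage_mono (by positivity) hk.le⟩
    · exact ⟨_, by positivity, subset_rfl⟩
  exact h.isCountablyGenerated

theorem exists_close_of_forall_entourage {X Y : CadlagPath E}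
    (h : ∀ r : ℝ, 0 < r → (X, Y) ∈ skorokhodEntourage E r) (t : ℝ) {ε : ℝ} (hε : 0 < ε) :
    ∃ s, |s - t| < ε ∧ dist (X t) (Y s) < ε := by
  have hp : 0 < min ε (|t| + 1)⁻¹ := lt_min hε (by positivity)
  obtain ⟨τ, hτ⟩ := h _ hp
  obtain ⟨h1, h2⟩ := hτ t (by
    have := inv_anti₀ hp (min_le_right ε (|t| + 1)⁻¹)
    rw [inv_inv] at this
    linarith)
  exact ⟨τ t, h1.trans_le (min_le_left _ _), h2.trans_le (min_le_left _ _)⟩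

/-- With countable generation of the uniformity, this makes the topology metrizable. A time change
may move `t` to its left, where a path can jump, so the comparison is made slightly to the right of
`t` and brought back by right continuity. -/
instance t0Space : T0Space (CadlagPath E) := by
  refine t0Space_iff_uniformity.2 fun X Y h => DFunLike.ext _ _ fun t => ?_
  have h' : ∀ r : ℝ, 0 < r → (X, Y) ∈ skorokhodEntourage E r := fun r hr =>
    h _ (hasBasis_uniformity.mem_of_mem hr)
  refine eq_of_forall_dist_le fun ε hε => ?_
  have hX := Metric.continuousWithinAt_iff.1 (X.right_continuous t) (ε / 3) (by positivity)
  have hY := Metric.continuousWithinAt_iff.1 (Y.right_continuous t) (ε / 3) (by positivity)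
  obtain ⟨δ, hδ, hX⟩ := hX
  obtain ⟨δ', hδ', hY⟩ := hY
  set d := min δ δ' with hd
  have hdp : 0 < d := lt_min hδ hδ'
  obtain ⟨s, hs1, hs2⟩ := exists_close_of_forall_entourage h' (t + d / 2)
    (ε := min (ε / 3) (d / 2)) (lt_min (by positivity) (by positivity))
  have hs1' := abs_lt.1 (hs1.trans_le (min_le_right _ _))
  have e1 : dist (X (t + d / 2)) (X t) < ε / 3 := hX (by simp; positivity) (by
    rw [Real.dist_eq, add_sub_cancel_left, abs_of_pos (by positivity)]
    have := min_le_left δ δ'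
    linarith)
  have e2 : dist (Y s) (Y t) < ε / 3 := hY (by simp only [mem_Ici]; linarith [hs1'.1]) (by
    rw [Real.dist_eq, abs_lt]
    have := min_le_right δ δ'
    constructor <;> linarith [hs1'.1, hs1'.2])
  have e3 := hs2.trans_le (min_le_left _ _)
  have e4 := dist_triangle4 (X t) (X (t + d / 2)) (Y s) (Y t)
  rw [dist_comm (X t) (X (t + d / 2))] at e4
  linarith

/-- Paths that agree on a large window are close in the Skorokhod topology. -/
theorem exists_window_mem {U : Set (CadlagPath E × CadlagPath E)}
    (hU : U ∈ uniformity (CadlagPath E)) :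
    ∃ m : ℕ, ∀ X Y : CadlagPath E, (∀ t ∈ Icc (-(m : ℝ)) m, X t = Y t) → (X, Y) ∈ U := by
  obtain ⟨r, hr, h⟩ := hasBasis_uniformity.mem_iff.1 hU
  obtain ⟨m, hm⟩ := exists_nat_ge r⁻¹
  refine ⟨m, fun X Y hXY => h ⟨OrderIso.refl ℝ, fun t ht => ?_⟩⟩
  have := hXY t (abs_le.1 (ht.trans hm))
  simp only [OrderIso.refl_apply, sub_self, abs_zero, this, dist_self]
  exact ⟨hr, hr⟩

/-- A continuous path as a càdlàg path. -/
def ofContinuous (w : C(ℝ, E)) : CadlagPath E where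
  toFun := w
  right_continuous _ := w.continuous.continuousWithinAt
  left_limit t := ⟨w t, (w.continuous.tendsto t).mono_left nhdsWithin_le_nhds⟩

@[simp] theorem ofContinuous_apply (w : C(ℝ, E)) (t : ℝ) : ofContinuous w t = w t := rfl

theorem ofContinuous_coe (w : C(ℝ, E)) : (ofContinuous w : ℝ → E) = w := rfl

theorem ofContinuous_injective : Function.Injective (ofContinuous : C(ℝ, E) → CadlagPath E) :=
  fun _ _ h => ContinuousMap.ext fun t => DFunLike.congr_fun h t

theorem continuous_ofContinuous : Continuous (ofContinuous : C(ℝ, E) → CadlagPath E) := by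
  refine continuous_iff_continuousAt.2 fun w => ?_
  refine (nhds_basis_uniformity' hasBasis_uniformity).tendsto_right_iff.2 fun r hr => ?_
  have h := ContinuousMap.tendsto_iff_forall_isCompact_tendstoUniformlyOn.1
    (tendsto_id (x := 𝓝 w)) (Icc (-r⁻¹) r⁻¹) isCompact_Icc
  filter_upwards [Metric.tendstoUniformlyOn_iff.1 h r hr] with w' hw'
  refine ⟨OrderIso.refl ℝ, fun t ht => ?_⟩
  simp only [OrderIso.refl_apply, sub_self, abs_zero]
  exact ⟨hr, hw' t (abs_le.1 ht)⟩

/-- The paths whose oscillation over the open interval `(s, t)` exceeds `ε`. -/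
def oscSet (E : Type*) [MetricSpace E] (s t ε : ℝ) : Set (CadlagPath E) :=
  {X | ∃ u ∈ Ioo s t, ∃ u' ∈ Ioo s t, ε < dist (X u) (X u')}

/-- The interval is open and the excess is strict, so a small time change keeps both witnesses
inside and a small change of the values keeps the excess. -/
theorem isOpen_oscSet (s t ε : ℝ) : IsOpen (oscSet E s t ε) := by
  refine isOpen_iff_mem_nhds.2 ?_
  rintro X ⟨u, hu, u', hu', h⟩
  set d := dist (X u) (X u') - ε with hd
  have hdp : 0 < d := by rw [hd]; linarith
  -- The radius `r` must serve twice: a displacement of `v` by less than `r` stays in the interval,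
  -- and `v` lies in the window `|v| ≤ 1/r` that the entourage controls.
  have hI : ∀ v ∈ Ioo s t, ∃ r : ℝ, 0 < r ∧ Ioo (v - r) (v + r) ⊆ Ioo s t ∧ |v| ≤ r⁻¹ := by
    intro v hv
    have h0 : 0 < min (min (v - s) (t - v)) (|v| + 1)⁻¹ :=
      lt_min (lt_min (by linarith [hv.1]) (by linarith [hv.2])) (by positivity)
    refine ⟨_, h0, fun x hx => ?_, ?_⟩
    · have a1 := (min_le_left (min (v - s) (t - v)) (|v| + 1)⁻¹).trans (min_le_left _ _)
      have a2 := (min_le_left (min (v - s) (t - v)) (|v| + 1)⁻¹).trans (min_le_right _ _)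
      constructor <;> linarith [hx.1, hx.2]
    · have := inv_anti₀ h0 (min_le_right (min (v - s) (t - v)) (|v| + 1)⁻¹)
      rw [inv_inv] at this
      linarith
  obtain ⟨r, hr, hr1, hr2⟩ := hI u hu
  obtain ⟨r', hr', hr1', hr2'⟩ := hI u' hu'
  have hρ : 0 < min (min r r') (d / 2) := lt_min (lt_min hr hr') (by positivity)
  filter_upwards [(nhds_basis_uniformity' hasBasis_uniformity).mem_of_mem hρ] with Y hY
  obtain ⟨τ, hτ⟩ := hY
  have l1 := (min_le_left (min r r') (d / 2)).trans (min_le_left _ _)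
  have l2 := (min_le_left (min r r') (d / 2)).trans (min_le_right _ _)
  have l3 := min_le_right (min r r') (d / 2)
  obtain ⟨a1, a2⟩ := hτ u (hr2.trans (inv_anti₀ hρ l1))
  obtain ⟨b1, b2⟩ := hτ u' (hr2'.trans (inv_anti₀ hρ l2))
  have a1' := abs_lt.1 a1
  have b1' := abs_lt.1 b1
  refine ⟨τ u, hr1 ⟨by linarith, by linarith⟩, τ u', hr1' ⟨by linarith, by linarith⟩, ?_⟩
  have := dist_triangle4 (X u) (Y (τ u)) (Y (τ u')) (X u')
  rw [dist_comm (Y (τ u')) (X u')] at this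
  simp only at a2 b2
  linarith

/-- The paths that are uniformly continuous on `(0, 1)`. -/
def ucSet (E : Type*) [MetricSpace E] : Set (CadlagPath E) :=
  ⋂ k : ℕ, ⋃ N : ℕ, ⋂ p : ℚ × ℚ, ⋂ _ : 0 ≤ p.1 ∧ p.2 ≤ 1 ∧ (p.2 : ℝ) - p.1 ≤ 1 / ((N : ℝ) + 1),
    (oscSet E p.1 p.2 (1 / ((k : ℝ) + 1)))ᶜ

/-- A Borel set that contains every path of finite action on `[0, 1]`. It allows the integral of the
action to be bounded below without the action being known to be Borel on càdlàg paths. -/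
theorem measurableSet_ucSet : MeasurableSet (ucSet E) :=
  .iInter fun _ => .iUnion fun _ => .iInter fun _ => .iInter fun _ =>
    (isOpen_oscSet _ _ _).measurableSet.compl

theorem mem_ucSet_of_continuousOn {X : CadlagPath E} (h : ContinuousOn X (Icc 0 1)) :
    X ∈ ucSet E := by
  have hu := Metric.uniformContinuousOn_iff_le.1 (isCompact_Icc.uniformContinuousOn_of_continuous h)
  simp only [ucSet, mem_iInter, mem_iUnion]
  intro k
  obtain ⟨δ, hδ, hd⟩ := hu (1 / ((k : ℝ) + 1)) (by positivity)
  obtain ⟨N, hN⟩ := exists_nat_one_div_lt hδ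
  refine ⟨N, fun p hp => ?_⟩
  rintro ⟨u, hu, u', hu', hlt⟩
  have h0 : (0 : ℝ) ≤ p.1 := by exact_mod_cast hp.1
  have h1 : (p.2 : ℝ) ≤ 1 := by exact_mod_cast hp.2.1
  refine absurd (hd u ⟨by linarith [hu.1], by linarith [hu.2]⟩ u'
    ⟨by linarith [hu'.1], by linarith [hu'.2]⟩ ?_) (not_le.2 hlt)
  rw [Real.dist_eq, abs_le]
  constructor <;> linarith [hu.1, hu.2, hu'.1, hu'.2, hp.2.2]

theorem continuousAt_of_mem_ucSet {X : CadlagPath E} (h : X ∈ ucSet E) {t : ℝ}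
    (ht : t ∈ Ioo (0 : ℝ) 1) : ContinuousAt X t := by
  refine Metric.continuousAt_iff'.2 fun ε hε => ?_
  obtain ⟨k, hk⟩ := exists_nat_one_div_lt hε
  simp only [ucSet, mem_iInter, mem_iUnion] at h
  obtain ⟨N, hN⟩ := h k
  have hp : (0 : ℝ) < 1 / (2 * ((N : ℝ) + 1)) := by positivity
  have e : (1 : ℝ) / (2 * ((N : ℝ) + 1)) + 1 / (2 * ((N : ℝ) + 1)) = 1 / ((N : ℝ) + 1) := by
    field_simp; norm_num
  obtain ⟨p, hp1, hp2⟩ := exists_rat_btwn (x := max 0 (t - 1 / (2 * ((N : ℝ) + 1)))) (y := t)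
    (max_lt ht.1 (by linarith))
  obtain ⟨q, hq1, hq2⟩ := exists_rat_btwn (x := t) (y := min 1 (t + 1 / (2 * ((N : ℝ) + 1))))
    (lt_min ht.2 (by linarith))
  have h1 : (0 : ℝ) ≤ p := (le_max_left _ _).trans hp1.le
  have h2 : (q : ℝ) ≤ 1 := hq2.le.trans (min_le_left _ _)
  have h3 := (le_max_right _ _).trans_lt hp1
  have h4 := hq2.trans_le (min_le_right _ _)
  have := hN (p, q) ⟨by exact_mod_cast h1, by exact_mod_cast h2, by
    simp only; linarith⟩
  filter_upwards [Ioo_mem_nhds hp2 hq1] with u hu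
  by_contra hc
  exact this ⟨u, hu, t, ⟨hp2, hq1⟩, hk.trans_le (not_lt.1 hc)⟩

/-- Unit windows placed at half-integers overlap, so each `t` is interior to one of them: `j = ⌈2t⌉
- 1` gives `j/2 < t ≤ (j + 1)/2`. -/
theorem continuous_of_forall_shift_mem_ucSet {X : CadlagPath E}
    (h : ∀ j : ℤ, shift (-((j : ℝ) / 2)) X ∈ ucSet E) : Continuous X := by
  refine continuous_iff_continuousAt.2 fun t => ?_
  have h0 : t - ((⌈2 * t⌉ - 1 : ℤ) : ℝ) / 2 ∈ Ioo (0 : ℝ) 1 := by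
    have a := Int.le_ceil (2 * t)
    have b := Int.ceil_lt_add_one (2 * t)
    push_cast
    constructor <;> linarith
  have h1 := continuousAt_of_mem_ucSet (h (⌈2 * t⌉ - 1)) h0
  have h2 : ContinuousAt (fun s : ℝ => s - ((⌈2 * t⌉ - 1 : ℤ) : ℝ) / 2) t := by fun_prop
  have h3 := ContinuousAt.comp (f := fun s : ℝ => s - ((⌈2 * t⌉ - 1 : ℤ) : ℝ) / 2) h1 h2
  refine h3.congr (Eventually.of_forall fun s => ?_)
  simp [shift_apply]

end Basic

end CadlagPath

/-! ### Borel structure on continuous paths -/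

instance instMeasurableSpacePath {E : Type*} [TopologicalSpace E] : MeasurableSpace C(ℝ, E) :=
  borel _

instance instBorelSpacePath {E : Type*} [TopologicalSpace E] : BorelSpace C(ℝ, E) := ⟨rfl⟩

open CadlagPath

/-- Lusin–Souslin: a continuous injection of a Polish space sends Borel sets to Borel sets. -/
theorem measurableEmbedding_ofContinuous {E : Type*} [MetricSpace E] [CompleteSpace E]
    [SecondCountableTopology E] :
    MeasurableEmbedding (ofContinuous : C(ℝ, E) → CadlagPath E) :=
  continuous_ofContinuous.measurableEmbedding ofContinuous_injective

/-! ### Translations of continuous paths. -/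

section Shift

variable {E : Type*} [TopologicalSpace E]

/-- The translate `s ↦ w (s + t)` of a continuous path. -/
def advance (t : ℝ) (w : C(ℝ, E)) : C(ℝ, E) := w.comp ⟨fun s => s + t, by fun_prop⟩

@[simp] theorem advance_apply (t : ℝ) (w : C(ℝ, E)) (s : ℝ) : advance t w s = w (s + t) := rfl

theorem continuous_advance_uncurry :
    Continuous fun p : ℝ × C(ℝ, E) => advance p.1 p.2 := by
  refine ContinuousMap.continuous_of_continuous_uncurry _ ?_
  have : Continuous fun q : (ℝ × C(ℝ, E)) × ℝ => q.1.2 (q.2 + q.1.1) := by fun_prop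
  exact this

theorem continuous_advance (t : ℝ) : Continuous (advance t : C(ℝ, E) → C(ℝ, E)) :=
  continuous_advance_uncurry.comp (by fun_prop : Continuous fun w : C(ℝ, E) => (t, w))

theorem continuous_advance_left (w : C(ℝ, E)) : Continuous fun t : ℝ => advance t w :=
  continuous_advance_uncurry.comp (by fun_prop : Continuous fun t : ℝ => (t, w))

end Shift

theorem ofContinuous_advance {E : Type*} [MetricSpace E] (t : ℝ) (w : C(ℝ, E)) :
    ofContinuous (advance t w) = shift (-t) (ofContinuous w) := by
  refine DFunLike.ext _ _ fun s => ?_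
  simp [shift_apply]

/-! ### Paths with square integrable derivative -/

theorem memLp_two_iff_lintegral {α F : Type*} [MeasurableSpace α] [NormedAddCommGroup F]
    {μ : Measure α} {v : α → F} :
    MemLp v 2 μ ↔ AEStronglyMeasurable v μ ∧ ∫⁻ t, ‖v t‖ₑ ^ 2 ∂μ < ⊤ := by
  refine and_congr_right fun _ => ?_
  rw [eLpNorm_lt_top_iff_lintegral_rpow_enorm_lt_top (by norm_num) (by norm_num)]
  norm_num

section H1

variable {n : ℕ}

local notation "𝔼" n => EuclideanSpace ℝ (Fin n)

/-- `X` has on `[0, T]` the square integrable derivative `v`. -/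
structure IsH1 (T : ℝ) (X v : ℝ → 𝔼 n) : Prop where
  memLp : MemLp v 2 (volume.restrict (Ioo 0 T))
  eq_integral : ∀ t ∈ Icc 0 T, X t = X 0 + ∫ s in (0 : ℝ)..t, v s

theorem absolutelyContinuousOnInterval_coord {X : ℝ → 𝔼 n} {T : ℝ}
    (h : AbsolutelyContinuousOnInterval X 0 T) (i : Fin n) :
    AbsolutelyContinuousOnInterval (fun t => X t i) 0 T := by
  refine squeeze_zero' (Eventually.of_forall fun _ => Finset.sum_nonneg fun _ _ => dist_nonneg)
    (Eventually.of_forall fun E => Finset.sum_le_sum fun j _ => ?_) h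
  rw [dist_eq_norm, dist_eq_norm]
  exact PiLp.norm_apply_le (X (E.2 j).1 - X (E.2 j).2) i

theorem ae_hasDerivAt_of_absolutelyContinuous {X : ℝ → 𝔼 n} {T : ℝ} (hT : 0 ≤ T)
    (h : AbsolutelyContinuousOnInterval X 0 T) :
    ∀ᵐ t, t ∈ Icc 0 T → HasDerivAt X (deriv X t) t ∧ ∀ i, deriv X t i = deriv (fun s => X s i) t := by
  have h1 : ∀ᵐ t, ∀ i, t ∈ uIcc 0 T → DifferentiableAt ℝ (fun s => X s i) t :=
    ae_all_iff.2 fun i => (absolutelyContinuousOnInterval_coord h i).ae_differentiableAt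
  rw [uIcc_of_le hT] at h1
  filter_upwards [h1] with t ht hmem
  have hd : DifferentiableAt ℝ X t := (differentiableAt_piLp 2).2 fun i => ht i hmem
  refine ⟨hd.hasDerivAt, fun i => ?_⟩
  have := (EuclideanSpace.proj i : (𝔼 n) →L[ℝ] ℝ).hasFDerivAt.comp_hasDerivAt t
    hd.hasDerivAt
  exact this.deriv.symm

/-- The scalar fundamental theorem of calculus for absolutely continuous functions, applied to each
coordinate. The integral representation is easier to cut, glue and pass to the limit in than
absolute continuity. -/
theorem MemH1.isH1 {X : ℝ → 𝔼 n} {T : ℝ} (hT : 0 ≤ T) (h : MemH1 T X) : IsH1 T X (deriv X) := by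
  have hm : MemLp (deriv X) 2 (volume.restrict (Ioo 0 T)) :=
    memLp_two_iff_lintegral.2 ⟨aestronglyMeasurable_deriv X _, h.2⟩
  refine ⟨hm, fun t ht => ?_⟩
  have hint : IntegrableOn (deriv X) (Ioc 0 T) := by
    rw [integrableOn_Ioc_iff_integrableOn_Ioo]
    exact hm.integrable (by norm_num)
  have hint' : IntegrableOn (deriv X) (Ioc 0 t) := hint.mono_set (Ioc_subset_Ioc_right ht.2)
  ext i
  have hac : AbsolutelyContinuousOnInterval (fun t => X t i) 0 t :=
    (absolutelyContinuousOnInterval_coord h.1 i).mono (by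
      rw [uIcc_of_le hT, uIcc_of_le ht.1]; exact Icc_subset_Icc_right ht.2)
  have h1 := hac.integral_deriv_eq_sub
  have h2 : (∫ s in (0 : ℝ)..t, deriv X s) i = ∫ s in (0 : ℝ)..t, deriv (fun s => X s i) s := by
    have h3 := (EuclideanSpace.proj i : (𝔼 n) →L[ℝ] ℝ).integral_comp_comm hint'
    rw [intervalIntegral.integral_of_le ht.1, intervalIntegral.integral_of_le ht.1]
    refine Eq.trans h3.symm ?_
    refine setIntegral_congr_ae measurableSet_Ioc ?_
    filter_upwards [ae_hasDerivAt_of_absolutelyContinuous hT h.1] with s hs hmem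
    exact (hs ⟨hmem.1.le, hmem.2.trans ht.2⟩).2 i
  rw [PiLp.add_apply, h2, h1]
  ring

theorem IsH1.integrableOn {T : ℝ} {X v : ℝ → 𝔼 n} (h : IsH1 T X v) :
    IntegrableOn v (Ioc 0 T) := by
  rw [integrableOn_Ioc_iff_integrableOn_Ioo]
  exact h.memLp.integrable (by norm_num)

theorem IsH1.intervalIntegrable {T : ℝ} {X v : ℝ → 𝔼 n} (h : IsH1 T X v) {s t : ℝ}
    (hs : s ∈ Icc 0 T) (ht : t ∈ Icc 0 T) : IntervalIntegrable v volume s t := by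
  refine intervalIntegrable_iff.2 (h.integrableOn.mono_set fun x hx => ?_)
  rw [uIoc, mem_Ioc] at hx
  exact ⟨(le_min hs.1 ht.1).trans_lt hx.1, hx.2.trans (max_le hs.2 ht.2)⟩

theorem IsH1.sub_eq {T : ℝ} {X v : ℝ → 𝔼 n} (h : IsH1 T X v) {s t : ℝ}
    (hs : s ∈ Icc 0 T) (ht : t ∈ Icc 0 T) : X t - X s = ∫ r in s..t, v r := by
  have hT : (0 : ℝ) ≤ T := hs.1.trans hs.2
  rw [h.eq_integral t ht, h.eq_integral s hs, add_sub_add_left_eq_sub,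
    intervalIntegral.integral_interval_sub_left
      (h.intervalIntegrable (left_mem_Icc.2 hT) ht) (h.intervalIntegrable (left_mem_Icc.2 hT) hs)]

theorem IsH1.ae_hasDerivAt {T : ℝ} (hT : 0 ≤ T) {X v : ℝ → 𝔼 n} (h : IsH1 T X v) :
    ∀ᵐ t, t ∈ Ioo 0 T → HasDerivAt X (v t) t := by
  have h1 := (h.intervalIntegrable (left_mem_Icc.2 hT) (right_mem_Icc.2 hT)).ae_hasDerivAt_integral
  filter_upwards [h1] with t ht hmem
  have h2 := ht (by rw [uIcc_of_le hT]; exact ⟨hmem.1.le, hmem.2.le⟩) 0 (by simp)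
  refine (h2.const_add (X 0)).congr_of_eventuallyEq ?_
  filter_upwards [Ioo_mem_nhds hmem.1 hmem.2] with s hs
  exact h.eq_integral s ⟨hs.1.le, hs.2.le⟩

/-- The increments of `X` are dominated by those of the primitive of `‖v‖`, a real absolutely
continuous function. -/
theorem IsH1.absolutelyContinuous {T : ℝ} (hT : 0 ≤ T) {X v : ℝ → 𝔼 n} (h : IsH1 T X v) :
    AbsolutelyContinuousOnInterval X 0 T := by
  have hi : IntervalIntegrable (fun t => ‖v t‖) volume 0 T :=
    (h.intervalIntegrable (left_mem_Icc.2 hT) (right_mem_Icc.2 hT)).norm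
  have hac := hi.absolutelyContinuousOnInterval_intervalIntegral (c := 0) (by simp)
  have hev : ∀ᶠ E in AbsolutelyContinuousOnInterval.totalLengthFilter ⊓
      𝓟 (AbsolutelyContinuousOnInterval.disjWithin 0 T),
      E ∈ AbsolutelyContinuousOnInterval.disjWithin 0 T := eventually_inf_principal.2 (by simp)
  refine squeeze_zero' (Eventually.of_forall fun _ => Finset.sum_nonneg fun _ _ => dist_nonneg)
    (hev.mono fun E hE => Finset.sum_le_sum fun j hj => ?_) hac
  have hj' := hE.1 j hj
  rw [uIcc_of_le hT] at hj'
  have z : (0 : ℝ) ∈ Icc 0 T := left_mem_Icc.2 hT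
  rw [dist_comm (X _), dist_eq_norm, h.sub_eq hj'.1 hj'.2, dist_comm, Real.dist_eq,
    intervalIntegral.integral_interval_sub_left (h.intervalIntegrable z hj'.2).norm
      (h.intervalIntegrable z hj'.1).norm]
  exact intervalIntegral.norm_integral_le_abs_integral_norm

theorem IsH1.deriv_ae_eq {T : ℝ} (hT : 0 ≤ T) {X v : ℝ → 𝔼 n} (h : IsH1 T X v) :
    deriv X =ᵐ[volume.restrict (Ioo 0 T)] v := by
  rw [EventuallyEq, ae_restrict_iff' measurableSet_Ioo]
  filter_upwards [h.ae_hasDerivAt hT] with t ht hmem using (ht hmem).deriv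

theorem IsH1.memH1 {T : ℝ} (hT : 0 ≤ T) {X v : ℝ → 𝔼 n} (h : IsH1 T X v) : MemH1 T X := by
  refine ⟨h.absolutelyContinuous hT, ?_⟩
  exact (memLp_two_iff_lintegral.1 (h.memLp.ae_eq (h.deriv_ae_eq hT).symm)).2

theorem IsH1.continuousOn {T : ℝ} (hT : 0 ≤ T) {X v : ℝ → 𝔼 n} (h : IsH1 T X v) :
    ContinuousOn X (Icc 0 T) := by
  simpa only [uIcc_of_le hT] using (h.absolutelyContinuous hT).continuousOn

theorem IsH1.congr {T : ℝ} (hT : 0 ≤ T) {X Y v : ℝ → 𝔼 n} (h : IsH1 T X v)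
    (hXY : EqOn X Y (Icc 0 T)) : IsH1 T Y v :=
  ⟨h.memLp, fun t ht => by
    rw [← hXY ht, ← hXY (left_mem_Icc.2 hT), h.eq_integral t ht]⟩

theorem IsH1.window {T T' s : ℝ} {X v : ℝ → 𝔼 n} (h : IsH1 T X v) (hs : 0 ≤ s)
    (hT' : 0 ≤ T') (hsT : T' + s ≤ T) :
    IsH1 T' (fun t => X (t + s)) (fun t => v (t + s)) := by
  refine ⟨?_, fun t ht => ?_⟩
  · have h1 : MemLp v 2 (volume.restrict (Ioo s (T' + s))) :=
      h.memLp.mono_measure (Measure.restrict_mono (Ioo_subset_Ioo hs hsT) le_rfl)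
    have h2 : MeasurePreserving (fun t : ℝ => t + s) (volume.restrict (Ioo 0 T'))
        (volume.restrict (Ioo s (T' + s))) := by
      have := (measurePreserving_add_right volume s).restrict_preimage
        (measurableSet_Ioo (a := s) (b := T' + s))
      simpa using this
    exact h1.comp_measurePreserving h2
  · have hm : t + s ∈ Icc 0 T := ⟨by linarith [ht.1], by linarith [ht.2]⟩
    have h1 := h.sub_eq (s := s) (t := t + s) ⟨hs, by linarith⟩ hm
    rw [intervalIntegral.integral_comp_add_right (fun t => v t), zero_add, ← h1]
    abel

theorem IsH1.mono {T T' : ℝ} {X v : ℝ → 𝔼 n} (h : IsH1 T X v) (hT' : 0 ≤ T') (hTT : T' ≤ T) :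
    IsH1 T' X v := by
  simpa using h.window le_rfl hT' (by simpa using hTT)

theorem IsH1.glue {S T : ℝ} (hS : 0 ≤ S) {X v u : ℝ → 𝔼 n} (h : IsH1 S X v)
    (h' : IsH1 T (fun t => X (t + S)) u) :
    IsH1 (T + S) X (fun t => if t ≤ S then v t else u (t - S)) := by
  set w : ℝ → 𝔼 n := fun t => if t ≤ S then v t else u (t - S) with hw
  have e1 : MemLp w 2 (volume.restrict (Ioc 0 S)) := by
    rw [← Measure.restrict_congr_set (Ioo_ae_eq_Ioc (μ := volume))]
    refine h.memLp.ae_eq ?_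
    filter_upwards [ae_restrict_mem measurableSet_Ioo] with t ht
    simp [hw, ht.2.le]
  have e2 : MemLp w 2 (volume.restrict (Ioo S (T + S))) := by
    have h2 : MeasurePreserving (fun t : ℝ => t - S) (volume.restrict (Ioo S (T + S)))
        (volume.restrict (Ioo 0 T)) := by
      have := (measurePreserving_sub_right volume S).restrict_preimage
        (measurableSet_Ioo (a := 0) (b := T))
      simpa using this
    refine (h'.memLp.comp_measurePreserving h2).ae_eq ?_
    filter_upwards [ae_restrict_mem measurableSet_Ioo] with t ht
    simp [hw, not_le.2 ht.1]
  have e3 : MemLp w 2 (volume.restrict (Ioo 0 (T + S))) := by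
    have hu : Ioo 0 (T + S) ⊆ Ioc 0 S ∪ Ioo S (T + S) := fun t ht => by
      by_cases hc : t ≤ S
      · exact Or.inl ⟨ht.1, hc⟩
      · exact Or.inr ⟨not_le.1 hc, ht.2⟩
    rw [memLp_two_iff_lintegral] at e1 e2
    refine MemLp.mono_measure (Measure.restrict_mono hu le_rfl) (memLp_two_iff_lintegral.2
      ⟨aestronglyMeasurable_union_iff.2 ⟨e1.1, e2.1⟩, ?_⟩)
    exact (lintegral_union_le _ _ _).trans_lt (ENNReal.add_lt_top.2 ⟨e1.2, e2.2⟩)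
  have hint : ∀ s t : ℝ, 0 ≤ s → s ≤ t → t ≤ T + S → IntervalIntegrable w volume s t := by
    intro s t h0 h1 h2
    rw [intervalIntegrable_iff_integrableOn_Ioo_of_le h1]
    exact IntegrableOn.mono_set (e3.integrable (by norm_num)) (Ioo_subset_Ioo h0 h2)
  have e4 : ∀ t ∈ Icc 0 S, ∫ s in (0 : ℝ)..t, w s = ∫ s in (0 : ℝ)..t, v s := by
    intro t ht
    refine intervalIntegral.integral_congr fun s hs => ?_
    rw [uIcc_of_le ht.1] at hs
    simp [hw, hs.2.trans ht.2]
  refine ⟨e3, fun t ht => ?_⟩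
  by_cases hc : t ≤ S
  · rw [e4 t ⟨ht.1, hc⟩]
    exact h.eq_integral t ⟨ht.1, hc⟩
  · have hc := (not_le.1 hc).le
    rw [← intervalIntegral.integral_add_adjacent_intervals (hint 0 S le_rfl hS (by linarith [ht.2]))
      (hint S t hS hc ht.2), e4 S ⟨hS, le_rfl⟩, ← add_assoc,
      ← h.eq_integral S ⟨hS, le_rfl⟩]
    have h5 := h'.eq_integral (t - S) ⟨by linarith, by linarith [ht.2]⟩
    simp only [sub_add_cancel, zero_add] at h5
    rw [h5]
    congr 1
    have h6 := intervalIntegral.integral_comp_sub_right (a := S) (b := t) u S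
    rw [sub_self] at h6
    rw [← h6]
    refine intervalIntegral.integral_congr_ae ?_
    refine Eventually.of_forall fun s hs => ?_
    rw [uIoc_of_le hc] at hs
    simp [hw, not_le.2 hs.1]

/-- Cauchy–Schwarz against the constant `1`. This Hölder estimate of exponent `1/2` is the source of
equicontinuity in the tightness proof. -/
theorem IsH1.norm_sub_sq_le {T : ℝ} {X v : ℝ → 𝔼 n} (h : IsH1 T X v) {s t : ℝ}
    (hs : 0 ≤ s) (hst : s ≤ t) (ht : t ≤ T) :
    ‖X t - X s‖ ^ 2 ≤ (t - s) * ∫ r in s..t, ‖v r‖ ^ 2 := by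
  have hsm : s ∈ Icc 0 T := ⟨hs, hst.trans ht⟩
  have htm : t ∈ Icc 0 T := ⟨hs.trans hst, ht⟩
  have hi := h.intervalIntegrable hsm htm
  have hl : MemLp v 2 (volume.restrict (Ioc s t)) := by
    rw [← Measure.restrict_congr_set (Ioo_ae_eq_Ioc (μ := volume))]
    exact h.memLp.mono_measure (Measure.restrict_mono (Ioo_subset_Ioo hs ht) le_rfl)
  rw [h.sub_eq hsm htm]
  have h1 : ‖∫ r in s..t, v r‖ ≤ ∫ r in s..t, ‖v r‖ :=
    intervalIntegral.norm_integral_le_integral_norm hst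
  have h2 : (∫ r in s..t, ‖v r‖) ^ 2 ≤ (t - s) * ∫ r in s..t, ‖v r‖ ^ 2 := by
    rw [intervalIntegral.integral_of_le hst, intervalIntegral.integral_of_le hst]
    have := integral_mul_le_Lp_mul_Lq_of_nonneg (μ := volume.restrict (Ioc s t))
      (f := fun _ => (1 : ℝ)) (g := fun r => ‖v r‖) (p := 2) (q := 2)
      (by constructor <;> norm_num) (Eventually.of_forall fun _ => zero_le_one)
      (Eventually.of_forall fun _ => norm_nonneg _) (memLp_const _)
      (by simpa using hl.norm)
    simp only [one_mul, Real.one_rpow, integral_const, smul_eq_mul, mul_one, measureReal_def,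
      Measure.restrict_apply_univ, Real.volume_Ioc, ENNReal.toReal_ofReal (sub_nonneg.2 hst)] at this
    have hp : 0 ≤ ∫ r in Ioc s t, ‖v r‖ ^ 2 := integral_nonneg fun _ => by positivity
    have hp' : 0 ≤ ∫ r in Ioc s t, ‖v r‖ := integral_nonneg fun _ => by positivity
    simp only [Real.rpow_two, ← Real.sqrt_eq_rpow] at this
    calc (∫ r in Ioc s t, ‖v r‖) ^ 2
        ≤ (√(t - s) * √(∫ r in Ioc s t, ‖v r‖ ^ 2)) ^ 2 := by gcongr
      _ = _ := by rw [mul_pow, Real.sq_sqrt (sub_nonneg.2 hst), Real.sq_sqrt hp]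
  calc _ ≤ (∫ r in s..t, ‖v r‖) ^ 2 := by gcongr
    _ ≤ _ := h2

end H1

/-! ### Bounds on the coefficients -/

section Coefficients

variable {n : ℕ}

local notation "𝔼" n => EuclideanSpace ℝ (Fin n)

variable {V : (𝔼 n) → ℝ} {c : (𝔼 n) → 𝔼 n} {a : (𝔼 n) → Matrix (Fin n) (Fin n) ℝ}

theorem toEuclideanLin_mul_apply (A B : Matrix (Fin n) (Fin n) ℝ) (v : 𝔼 n) :
    Matrix.toEuclideanLin A (Matrix.toEuclideanLin B v) = Matrix.toEuclideanLin (A * B) v := by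
  simp [Matrix.toLpLin_apply, Matrix.mulVec_mulVec]

theorem toEuclideanLin_one_apply (v : 𝔼 n) :
    Matrix.toEuclideanLin (1 : Matrix (Fin n) (Fin n) ℝ) v = v := by
  simp

namespace Admissible

theorem inner_symm (h : Admissible V c a) (x u v : 𝔼 n) :
    inner ℝ (Matrix.toEuclideanLin (a x) u) v = inner ℝ u (Matrix.toEuclideanLin (a x) v) := by
  have h1 : (a x).IsHermitian := by
    rw [Matrix.IsHermitian, Matrix.conjTranspose_eq_transpose_of_trivial]
    exact h.a_symm x
  exact (Matrix.isSymmetric_toEuclideanLin_iff.2 h1) u v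

theorem isUnit_det (h : Admissible V c a) (x : 𝔼 n) : IsUnit (a x).det := by
  obtain ⟨C, hC, hell⟩ := h.a_elliptic
  rw [← Matrix.isUnit_iff_isUnit_det, ← Matrix.mulVec_injective_iff_isUnit]
  refine (injective_iff_map_eq_zero (Matrix.mulVecLin (a x))).2 fun v hv => ?_
  have h1 := hell x (WithLp.toLp 2 v)
  have h2 : Matrix.toEuclideanLin (a x) (WithLp.toLp 2 v) = 0 := by
    rw [Matrix.toLpLin_apply]
    rw [Matrix.mulVecLin_apply] at hv
    simp [hv]
  rw [h2, inner_zero_right] at h1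
  have h3 : ‖WithLp.toLp 2 v‖ ^ 2 ≤ 0 := by
    by_contra hc
    have := mul_pos (inv_pos.2 hC) (not_le.1 hc)
    linarith
  have h4 : WithLp.toLp 2 v = (0 : 𝔼 n) := by
    rw [← norm_eq_zero]
    exact pow_eq_zero_iff (two_ne_zero) |>.1 (le_antisymm h3 (by positivity))
  simpa using congrArg (WithLp.ofLp) h4

theorem apply_inv (h : Admissible V c a) (x u : 𝔼 n) :
    Matrix.toEuclideanLin (a x) (Matrix.toEuclideanLin (a x)⁻¹ u) = u := by
  rw [toEuclideanLin_mul_apply, Matrix.mul_nonsing_inv _ (h.isUnit_det x), toEuclideanLin_one_apply]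

theorem inv_apply (h : Admissible V c a) (x u : 𝔼 n) :
    Matrix.toEuclideanLin (a x)⁻¹ (Matrix.toEuclideanLin (a x) u) = u := by
  rw [toEuclideanLin_mul_apply, Matrix.nonsing_inv_mul _ (h.isUnit_det x), toEuclideanLin_one_apply]

theorem exists_elliptic (h : Admissible V c a) : ∃ lam : ℝ, 0 < lam ∧
    ∀ x v, lam * ‖v‖ ^ 2 ≤ inner ℝ v (Matrix.toEuclideanLin (a x) v) := by
  obtain ⟨C, hC, hell⟩ := h.a_elliptic
  exact ⟨C⁻¹, inv_pos.2 hC, hell⟩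

theorem exists_norm_le (h : Admissible V c a) : ∃ Lam : ℝ, 0 < Lam ∧
    ∀ x v, ‖Matrix.toEuclideanLin (a x) v‖ ≤ Lam * ‖v‖ := by
  obtain ⟨M, hM⟩ := h.a_bounded
  have hM' : ∀ i j x, |a x i j| ≤ M := fun i j x => by
    have := hM i j 0 (by norm_num) x
    rwa [norm_iteratedFDeriv_zero, Real.norm_eq_abs] at this
  refine ⟨(n : ℝ) * (n * |M|) + 1, by positivity, fun x v => ?_⟩
  have h1 : ∀ i, |Matrix.toEuclideanLin (a x) v i| ≤ n * |M| * ‖v‖ := fun i => by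
    rw [Matrix.toLpLin_apply]
    simp only [Matrix.mulVec, dotProduct]
    calc |∑ j, a x i j * v j| ≤ ∑ j, |a x i j * v j| := Finset.abs_sum_le_sum_abs _ _
      _ ≤ ∑ _j : Fin n, |M| * ‖v‖ := Finset.sum_le_sum fun j _ => by
          rw [abs_mul]
          exact mul_le_mul ((hM' i j x).trans (le_abs_self M)) (PiLp.norm_apply_le v j)
            (abs_nonneg _) (abs_nonneg _)
      _ = _ := by simp; ring
  set w := Matrix.toEuclideanLin (a x) v
  have h2 : ‖w‖ ≤ ∑ i, |w i| := by
    have := norm_sum_le Finset.univ fun i => (EuclideanSpace.single i (w i) : 𝔼 n)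
    have e : (∑ i, (EuclideanSpace.single i (w i) : 𝔼 n)) = w := by
      ext j
      simp [Finset.sum_apply, Pi.single_apply]
    rw [e] at this
    simpa using this
  calc ‖w‖ ≤ ∑ i, |w i| := h2
    _ ≤ ∑ _i : Fin n, n * |M| * ‖v‖ := Finset.sum_le_sum fun i _ => h1 i
    _ = n * (n * |M|) * ‖v‖ := by simp; ring
    _ ≤ _ := by nlinarith [norm_nonneg v]

theorem exists_inv_norm_le (h : Admissible V c a) : ∃ K : ℝ, 0 < K ∧
    ∀ x u, ‖Matrix.toEuclideanLin (a x)⁻¹ u‖ ≤ K * ‖u‖ := by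
  obtain ⟨lam, hl, hell⟩ := h.exists_elliptic
  refine ⟨lam⁻¹, inv_pos.2 hl, fun x u => ?_⟩
  set w := Matrix.toEuclideanLin (a x)⁻¹ u with hw
  have h1 := hell x w
  rw [hw, h.apply_inv, ← hw] at h1
  have h2 := real_inner_le_norm w u
  rcases (norm_nonneg w).eq_or_lt with h0 | h0
  · rw [← h0]; positivity
  · rw [inv_mul_eq_div, le_div_iff₀ hl]
    have : ‖w‖ * (‖w‖ * lam) ≤ ‖w‖ * ‖u‖ := by nlinarith
    exact le_of_mul_le_mul_left this h0

/-- With `w = a⁻¹u` the form is `w · a w ≥ λ|w|²`, and `|u| = |a w| ≤ Λ|w|`. -/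
theorem exists_inv_coercive (h : Admissible V c a) : ∃ κ : ℝ, 0 < κ ∧
    ∀ x u, κ * ‖u‖ ^ 2 ≤ inner ℝ u (Matrix.toEuclideanLin (a x)⁻¹ u) := by
  obtain ⟨lam, hl, hell⟩ := h.exists_elliptic
  obtain ⟨Lam, hL, hbd⟩ := h.exists_norm_le
  refine ⟨lam / Lam ^ 2, by positivity, fun x u => ?_⟩
  set w := Matrix.toEuclideanLin (a x)⁻¹ u with hw
  have h1 := hell x w
  have h2 := hbd x w
  rw [hw, h.apply_inv, ← hw] at h1 h2
  rw [real_inner_comm] at h1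
  refine le_trans ?_ h1
  rw [div_mul_eq_mul_div, div_le_iff₀ (by positivity), mul_assoc, ← mul_pow]
  gcongr
  rwa [mul_comm]

/-- The Fenchel inequality for the quadratic form of `a⁻¹`. -/
theorem fenchel_le (h : Admissible V c a) (x u p : 𝔼 n) :
    4 * inner ℝ p u - 4 * inner ℝ p (Matrix.toEuclideanLin (a x) p) ≤
      inner ℝ u (Matrix.toEuclideanLin (a x)⁻¹ u) := by
  obtain ⟨lam, hl, hell⟩ := h.exists_elliptic
  set w := Matrix.toEuclideanLin (a x)⁻¹ u with hw
  -- Completing the square: the form `a` at `w - 2p` expands to `w · a w - 4 p · u + 4 p · a p`,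
  -- where `a w = u`.
  have h1 : 0 ≤ inner ℝ (w - (2 : ℝ) • p) (Matrix.toEuclideanLin (a x) (w - (2 : ℝ) • p)) :=
    le_trans (by positivity) (hell x _)
  have h2 : inner ℝ w (Matrix.toEuclideanLin (a x) p) = inner ℝ p u := by
    rw [← h.inner_symm, hw, h.apply_inv, real_inner_comm]
  simp only [map_sub, map_smul, inner_sub_left, inner_sub_right, inner_smul_left, inner_smul_right,
    h2] at h1
  rw [hw, h.apply_inv, ← hw, real_inner_comm u w] at h1
  simp only [conj_trivial] at h1
  linarith

/-- The square in `fenchel_le` vanishes at `p = w/2`. Thus the quadratic form is a supremum of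
functions affine in `u`, attained at an explicit momentum; lower semicontinuity rests on this. -/
theorem fenchel_eq (h : Admissible V c a) (x u : 𝔼 n) {p : 𝔼 n}
    (hp : p = (2⁻¹ : ℝ) • Matrix.toEuclideanLin (a x)⁻¹ u) :
    4 * inner ℝ p u - 4 * inner ℝ p (Matrix.toEuclideanLin (a x) p) =
      inner ℝ u (Matrix.toEuclideanLin (a x)⁻¹ u) := by
  rw [hp, map_smul, h.apply_inv]
  simp only [inner_smul_left, inner_smul_right, conj_trivial]
  rw [real_inner_comm u]
  ring

theorem exists_c_norm_le (h : Admissible V c a) : ∃ M : ℝ, 0 ≤ M ∧ ∀ x, ‖c x‖ ≤ M := by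
  obtain ⟨M, hM⟩ := h.c_bounded
  refine ⟨|M|, abs_nonneg M, fun x => ?_⟩
  have := hM 0 (by norm_num) x
  rw [norm_iteratedFDeriv_zero] at this
  exact this.trans (le_abs_self M)

theorem continuous_a (h : Admissible V c a) : Continuous a :=
  continuous_matrix fun i j => (h.a_contDiff i j).continuous

theorem continuous_inv (h : Admissible V c a) : Continuous fun x => (a x)⁻¹ := by
  have hd : Continuous fun x => (a x).det := h.continuous_a.matrix_det
  have h1 : (fun x => (a x)⁻¹) = fun x => ((a x).det)⁻¹ • (a x).adjugate := by
    funext x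
    rw [Matrix.inv_def, Ring.inverse_eq_inv']
  rw [h1]
  exact (hd.inv₀ fun x => (h.isUnit_det x).ne_zero).smul h.continuous_a.matrix_adjugate

theorem continuous_gradient (h : Admissible V c a) : Continuous (gradient V) := by
  have h1 : Continuous (fderiv ℝ V) := h.V_contDiff.continuous_fderiv (by norm_num)
  exact (InnerProductSpace.toDual ℝ (𝔼 n)).symm.continuous.comp h1

end Admissible

theorem continuous_toEuclideanLin {α : Type*} [TopologicalSpace α]
    {A : α → Matrix (Fin n) (Fin n) ℝ} {v : α → 𝔼 n} (hA : Continuous A) (hv : Continuous v) :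
    Continuous fun t => Matrix.toEuclideanLin (A t) (v t) := by
  simp only [Matrix.toLpLin_apply]
  exact (PiLp.continuous_toLp 2 _).comp (hA.matrix_mulVec ((PiLp.continuous_ofLp 2 _).comp hv))

namespace Admissible

theorem continuous_drift (h : Admissible V c a) : Continuous (drift V c a) := by
  have h1 : Continuous fun x => Matrix.toEuclideanLin (a x) (gradient V x) :=
    continuous_toEuclideanLin h.continuous_a h.continuous_gradient
  exact h1.neg.add h.c_contDiff.continuous

end Admissible

/-- The quadratic form `[u - b(x)] · a⁻¹(x) [u - b(x)]`. -/
def lagrangian (V : (𝔼 n) → ℝ) (c : (𝔼 n) → 𝔼 n) (a : (𝔼 n) → Matrix (Fin n) (Fin n) ℝ)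
    (x u : 𝔼 n) : ℝ :=
  inner ℝ (u - drift V c a x) (Matrix.toEuclideanLin (a x)⁻¹ (u - drift V c a x))

namespace Admissible

theorem continuous_lagrangian (h : Admissible V c a) :
    Continuous fun p : (𝔼 n) × (𝔼 n) => lagrangian V c a p.1 p.2 := by
  have h1 : Continuous fun p : (𝔼 n) × (𝔼 n) => p.2 - drift V c a p.1 :=
    continuous_snd.sub (h.continuous_drift.comp continuous_fst)
  have h2 : Continuous fun p : (𝔼 n) × (𝔼 n) => (a p.1)⁻¹ := h.continuous_inv.comp continuous_fst
  have h3 : Continuous fun p : (𝔼 n) × (𝔼 n) =>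
      Matrix.toEuclideanLin (a p.1)⁻¹ (p.2 - drift V c a p.1) :=
    continuous_toEuclideanLin (A := fun p : (𝔼 n) × (𝔼 n) => (a p.1)⁻¹) h2 h1
  exact Continuous.inner (𝕜 := ℝ) h1 h3

theorem lagrangian_nonneg (h : Admissible V c a) (x u : 𝔼 n) : 0 ≤ lagrangian V c a x u := by
  obtain ⟨κ, hκ, hk⟩ := h.exists_inv_coercive
  exact le_trans (by positivity) (hk x _)

theorem exists_lagrangian_le (h : Admissible V c a) : ∃ K : ℝ, 0 < K ∧
    ∀ x u, lagrangian V c a x u ≤ K * (‖u‖ ^ 2 + ‖drift V c a x‖ ^ 2) := by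
  obtain ⟨K, hK, hk⟩ := h.exists_inv_norm_le
  refine ⟨2 * K, by positivity, fun x u => ?_⟩
  set w := u - drift V c a x with hw
  have h1 := real_inner_le_norm w (Matrix.toEuclideanLin (a x)⁻¹ w)
  have h2 := mul_le_mul_of_nonneg_left (hk x w) (norm_nonneg w)
  have h3 : ‖w‖ ^ 2 ≤ 2 * (‖u‖ ^ 2 + ‖drift V c a x‖ ^ 2) := by
    have := norm_sub_le u (drift V c a x)
    nlinarith [sq_nonneg (‖u‖ - ‖drift V c a x‖), norm_nonneg w, norm_nonneg u,
      norm_nonneg (drift V c a x)]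
  have : lagrangian V c a x u ≤ K * ‖w‖ ^ 2 := by
    rw [lagrangian, ← hw]; nlinarith
  nlinarith

theorem exists_norm_sq_le_lagrangian (h : Admissible V c a) : ∃ K : ℝ, 0 < K ∧
    ∀ x u, ‖u‖ ^ 2 ≤ K * lagrangian V c a x u + 2 * ‖drift V c a x‖ ^ 2 := by
  obtain ⟨κ, hκ, hk⟩ := h.exists_inv_coercive
  refine ⟨2 / κ, by positivity, fun x u => ?_⟩
  set w := u - drift V c a x with hw
  have h1 := hk x w
  have h3 : ‖u‖ ^ 2 ≤ 2 * ‖w‖ ^ 2 + 2 * ‖drift V c a x‖ ^ 2 := by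
    have : ‖u‖ ≤ ‖w‖ + ‖drift V c a x‖ := by
      have := norm_add_le w (drift V c a x)
      rwa [hw, sub_add_cancel] at this
    nlinarith [sq_nonneg (‖w‖ - ‖drift V c a x‖), norm_nonneg w, norm_nonneg u,
      norm_nonneg (drift V c a x)]
  have h4 : 2 * ‖w‖ ^ 2 ≤ 2 / κ * lagrangian V c a x u := by
    rw [lagrangian, ← hw, div_mul_eq_mul_div, le_div_iff₀ hκ]
    nlinarith
  linarith

/-- With `w = u - c(x)` and `g = ∇V(x)`, the Lagrangian is `w · a⁻¹w + 2 w · g + g · a g`. The cross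
term is an exact derivative along a path, apart from the bounded field `c`, whose contribution
Young's inequality absorbs. -/
theorem exists_le_lagrangian (h : Admissible V c a) : ∃ γ C : ℝ, 0 < γ ∧ 0 ≤ C ∧
    ∀ x u, γ * (‖u‖ ^ 2 + ‖gradient V x‖ ^ 2) + 2 * inner ℝ (gradient V x) u ≤
      lagrangian V c a x u + C := by
  obtain ⟨κ, hκ, hk⟩ := h.exists_inv_coercive
  obtain ⟨lam, hl, hell⟩ := h.exists_elliptic
  obtain ⟨M, hM, hc⟩ := h.exists_c_norm_le
  -- `κ/2` and `κM²` come from `|u|² ≤ 2|w|² + 2M²`; `lam/2` and `2M²/lam` come from spending half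
  -- of the ellipticity on `2M|g|`.
  refine ⟨min (κ / 2) (lam / 2), κ * M ^ 2 + 2 * M ^ 2 / lam, by positivity, by positivity,
    fun x u => ?_⟩
  set g := gradient V x with hg
  set w := u - c x with hw
  have e1 : u - drift V c a x = w + Matrix.toEuclideanLin (a x) g := by
    rw [drift, hw, hg]; abel
  have e2 : lagrangian V c a x u = inner ℝ w (Matrix.toEuclideanLin (a x)⁻¹ w) + 2 * inner ℝ w g +
      inner ℝ g (Matrix.toEuclideanLin (a x) g) := by
    rw [lagrangian, e1, map_add, h.inv_apply, inner_add_left, inner_add_right, inner_add_right,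
      h.inner_symm, h.apply_inv, h.inner_symm, real_inner_comm w g]
    ring
  have h1 := hk x w
  have h2 := hell x g
  have h3 : inner ℝ w g = inner ℝ g u - inner ℝ (c x) g := by
    rw [hw, inner_sub_left, real_inner_comm]
  have h4 : inner ℝ (c x) g ≤ M * ‖g‖ :=
    (real_inner_le_norm _ _).trans (mul_le_mul_of_nonneg_right (hc x) (norm_nonneg _))
  have h5 : 2 * (M * ‖g‖) ≤ lam / 2 * ‖g‖ ^ 2 + 2 * M ^ 2 / lam := by
    have : 0 ≤ (lam * ‖g‖ - 2 * M) ^ 2 / (2 * lam) := by positivity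
    have e : (lam * ‖g‖ - 2 * M) ^ 2 / (2 * lam) =
      lam / 2 * ‖g‖ ^ 2 + 2 * M ^ 2 / lam - 2 * (M * ‖g‖) := by field_simp; ring
    linarith
  have h6 : ‖u‖ ^ 2 ≤ 2 * ‖w‖ ^ 2 + 2 * M ^ 2 := by
    have h7 : ‖u‖ ≤ ‖w‖ + M := by
      have := norm_add_le w (c x)
      rw [hw, sub_add_cancel] at this
      exact this.trans (by rw [← hw]; linarith [hc x])
    nlinarith [sq_nonneg (‖w‖ - M), norm_nonneg w, norm_nonneg u]
  have m1 : min (κ / 2) (lam / 2) * ‖u‖ ^ 2 ≤ κ / 2 * ‖u‖ ^ 2 :=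
    mul_le_mul_of_nonneg_right (min_le_left _ _) (by positivity)
  have m2 : min (κ / 2) (lam / 2) * ‖g‖ ^ 2 ≤ lam / 2 * ‖g‖ ^ 2 :=
    mul_le_mul_of_nonneg_right (min_le_right _ _) (by positivity)
  rw [e2, h3]
  nlinarith

/-- The radial derivative of `V` is at most `|∇V|`. Hence a bound on the time average of `|∇V|²`
confines the path to a ball for most of the time. -/
theorem tendsto_norm_gradient (h : Admissible V c a) :
    Tendsto (fun x => ‖gradient V x‖) (Bornology.cobounded (𝔼 n)) atTop := by
  refine tendsto_atTop_mono (fun x => ?_) h.V_coercive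
  refine (real_inner_le_norm _ _).trans ?_
  rw [norm_smul, norm_inv, norm_norm]
  have : ‖x‖⁻¹ * ‖x‖ ≤ 1 := inv_mul_le_one
  nlinarith [norm_nonneg (gradient V x)]

end Admissible

end Coefficients

/-! ### The action functional -/

section Action

variable {n : ℕ}

local notation "𝔼" n => EuclideanSpace ℝ (Fin n)

variable {V : (𝔼 n) → ℝ} {c : (𝔼 n) → 𝔼 n} {a : (𝔼 n) → Matrix (Fin n) (Fin n) ℝ}

theorem isH1_of_fwAction_ne_top {T : ℝ} (hT : 0 ≤ T) {X : ℝ → 𝔼 n}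
    (h : fwAction V c a T X ≠ ⊤) : IsH1 T X (deriv X) := by
  by_cases hX : MemH1 T X
  · exact hX.isH1 hT
  · exact absurd (by rw [fwAction, if_neg hX]) h

theorem IsH1.fwAction_eq {T : ℝ} (hT : 0 ≤ T) {X v : ℝ → 𝔼 n} (h : IsH1 T X v) :
    fwAction V c a T X =
      4⁻¹ * ∫⁻ t in Ioo 0 T, ENNReal.ofReal (lagrangian V c a (X t) (v t)) := by
  rw [fwAction, if_pos (h.memH1 hT)]
  congr 1
  refine lintegral_congr_ae ?_
  filter_upwards [h.deriv_ae_eq hT] with t ht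
  rw [ht, lagrangian]

/-- The velocity of `X` also represents `Y` as an integral on `[0, T]`, so the behaviour of the two
extensions outside the interval does not matter. -/
theorem fwAction_congr {T : ℝ} (hT : 0 ≤ T) {X Y : ℝ → 𝔼 n} (h : EqOn X Y (Icc 0 T)) :
    fwAction V c a T X = fwAction V c a T Y := by
  have key : ∀ {X Y : ℝ → 𝔼 n}, EqOn X Y (Icc 0 T) →
      fwAction V c a T Y ≤ fwAction V c a T X := by
    intro X Y h
    by_cases ht : fwAction V c a T X = ⊤
    · rw [ht]; exact le_top
    · have hX := isH1_of_fwAction_ne_top hT ht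
      rw [hX.fwAction_eq hT, (hX.congr hT h).fwAction_eq hT]
      refine le_of_eq ?_
      congr 1
      refine setLIntegral_congr_fun measurableSet_Ioo fun t ht => ?_
      simp only [h (Ioo_subset_Icc_self ht)]
  exact le_antisymm (key h.symm) (key h)

theorem fwAction_mono {S T : ℝ} (hS : 0 ≤ S) (hST : S ≤ T) (X : ℝ → 𝔼 n) :
    fwAction V c a S X ≤ fwAction V c a T X := by
  by_cases ht : fwAction V c a T X = ⊤
  · rw [ht]; exact le_top
  · have hX := isH1_of_fwAction_ne_top (hS.trans hST) ht
    rw [hX.fwAction_eq (hS.trans hST), (hX.mono hS hST).fwAction_eq hS]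
    gcongr

theorem setLIntegral_Ioo_comp_add_right (f : ℝ → ℝ≥0∞) (p q s : ℝ) :
    ∫⁻ t in Ioo p q, f (t + s) = ∫⁻ t in Ioo (p + s) (q + s), f t := by
  have h := (measurePreserving_add_right (volume : Measure ℝ) s).setLIntegral_comp_preimage_emb
    (measurableEmbedding_addRight s) f (Ioo (p + s) (q + s))
  simpa using h

theorem setLIntegral_Ioo_comp_add (f : ℝ → ℝ≥0∞) (s T : ℝ) :
    ∫⁻ t in Ioo 0 T, f (t + s) = ∫⁻ t in Ioo s (T + s), f t := by
  rw [setLIntegral_Ioo_comp_add_right, zero_add]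

theorem fwAction_add_le {S T : ℝ} (hS : 0 ≤ S) (hT : 0 ≤ T) (X : ℝ → 𝔼 n) :
    fwAction V c a (T + S) X ≤
      fwAction V c a S X + fwAction V c a T (fun t => X (t + S)) := by
  by_cases h1 : fwAction V c a S X = ⊤
  · rw [h1, top_add]; exact le_top
  by_cases h2 : fwAction V c a T (fun t => X (t + S)) = ⊤
  · rw [h2, add_top]; exact le_top
  have hX := isH1_of_fwAction_ne_top hS h1
  have hY := isH1_of_fwAction_ne_top hT h2
  have hg := hX.glue hS hY
  rw [hX.fwAction_eq hS, hY.fwAction_eq hT, hg.fwAction_eq (by positivity), ← mul_add]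
  gcongr
  have hsub : Ioo 0 (T + S) ⊆ Ioc 0 S ∪ Ioo S (T + S) := fun t ht => by
    by_cases hc : t ≤ S
    · exact Or.inl ⟨ht.1, hc⟩
    · exact Or.inr ⟨not_le.1 hc, ht.2⟩
  refine (lintegral_mono_set hsub).trans ((lintegral_union_le _ _ _).trans (add_le_add ?_ ?_))
  · rw [setLIntegral_congr (Ioo_ae_eq_Ioc (μ := volume)).symm]
    refine (setLIntegral_congr_fun measurableSet_Ioo fun t ht => ?_).le
    simp only [ht.2.le, if_true]
  · set u := deriv fun t => X (t + S)
    have e := setLIntegral_Ioo_comp_add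
      (fun r => ENNReal.ofReal (lagrangian V c a (X r) (u (r - S)))) S T
    simp only [add_sub_cancel_right] at e
    rw [e]
    refine (setLIntegral_congr_fun measurableSet_Ioo fun t ht => ?_).le
    simp only [not_le.2 ht.1, if_false]

theorem IsH1.fwAction_window {S T s : ℝ} {X v : ℝ → 𝔼 n} (h : IsH1 T X v) (hs : 0 ≤ s)
    (hS : 0 ≤ S) (hsT : S + s ≤ T) :
    fwAction V c a S (fun t => X (t + s)) =
      4⁻¹ * ∫⁻ t in Ioo s (S + s), ENNReal.ofReal (lagrangian V c a (X t) (v t)) := by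
  rw [(h.window hs hS hsT).fwAction_eq hS,
    ← setLIntegral_Ioo_comp_add (fun t => ENNReal.ofReal (lagrangian V c a (X t) (v t)))]

theorem IsH1.aestronglyMeasurable {T : ℝ} (hT : 0 ≤ T) {X v : ℝ → 𝔼 n} (h : IsH1 T X v) :
    AEStronglyMeasurable X (volume.restrict (Ioo 0 T)) :=
  ((h.continuousOn hT).mono Ioo_subset_Icc_self).aestronglyMeasurable measurableSet_Ioo

theorem integrable_lagrangian_of_bounded (hA : Admissible V c a) {μ : Measure ℝ} [IsFiniteMeasure μ]
    {X v : ℝ → 𝔼 n} (hX : AEStronglyMeasurable X μ) (hv : MemLp v 2 μ) {β : ℝ}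
    (hβ : ∀ᵐ t ∂μ, ‖drift V c a (X t)‖ ≤ β) :
    Integrable (fun t => lagrangian V c a (X t) (v t)) μ := by
  obtain ⟨K, hK, hk⟩ := hA.exists_lagrangian_le
  have hm : AEStronglyMeasurable (fun t => lagrangian V c a (X t) (v t)) μ :=
    Continuous.comp_aestronglyMeasurable (g := fun p : (𝔼 n) × (𝔼 n) => lagrangian V c a p.1 p.2)
      (f := fun t => (X t, v t)) hA.continuous_lagrangian (hX.prodMk hv.1)
  have hi : Integrable (fun t => K * (‖v t‖ ^ 2 + β ^ 2)) μ :=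
    ((hv.integrable_norm_pow (by norm_num)).add (integrable_const _)).const_mul K
  refine hi.mono' hm ?_
  filter_upwards [hβ] with t ht
  rw [Real.norm_of_nonneg (hA.lagrangian_nonneg _ _)]
  refine (hk _ _).trans (mul_le_mul_of_nonneg_left ?_ hK.le)
  exact add_le_add_right (pow_le_pow_left₀ (norm_nonneg _) ht 2) _

theorem IsH1.exists_drift_le (hA : Admissible V c a) {T : ℝ} (hT : 0 ≤ T) {X v : ℝ → 𝔼 n}
    (h : IsH1 T X v) : ∃ β : ℝ, ∀ t ∈ Icc 0 T, ‖drift V c a (X t)‖ ≤ β := by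
  obtain ⟨β, hβ⟩ := isCompact_Icc.exists_bound_of_continuousOn
    (hA.continuous_drift.comp_continuousOn (h.continuousOn hT))
  exact ⟨β, hβ⟩

theorem IsH1.integrable_lagrangian (hA : Admissible V c a) {T : ℝ} (hT : 0 ≤ T) {X v : ℝ → 𝔼 n}
    (h : IsH1 T X v) :
    Integrable (fun t => lagrangian V c a (X t) (v t)) (volume.restrict (Ioo 0 T)) := by
  obtain ⟨β, hβ⟩ := h.exists_drift_le hA hT
  refine integrable_lagrangian_of_bounded hA (h.aestronglyMeasurable hT) h.memLp (β := β) ?_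
  filter_upwards [ae_restrict_mem measurableSet_Ioo] with t ht using hβ t (Ioo_subset_Icc_self ht)

theorem IsH1.fwAction_eq_ofReal (hA : Admissible V c a) {T : ℝ} (hT : 0 ≤ T) {X v : ℝ → 𝔼 n}
    (h : IsH1 T X v) : fwAction V c a T X =
      ENNReal.ofReal (4⁻¹ * ∫ t in Ioo 0 T, lagrangian V c a (X t) (v t)) := by
  rw [h.fwAction_eq hT, ← ofReal_integral_eq_lintegral_ofReal (h.integrable_lagrangian hA hT)
    (Eventually.of_forall fun _ => hA.lagrangian_nonneg _ _), ENNReal.ofReal_mul (by norm_num),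
    ENNReal.ofReal_inv_of_pos (by norm_num)]
  norm_num

theorem IsH1.integral_lagrangian (hA : Admissible V c a) {T : ℝ} (hT : 0 ≤ T) {X v : ℝ → 𝔼 n}
    (h : IsH1 T X v) :
    ∫ t in Ioo 0 T, lagrangian V c a (X t) (v t) = 4 * (fwAction V c a T X).toReal := by
  rw [h.fwAction_eq_ofReal hA hT, ENNReal.toReal_ofReal]
  · ring
  · exact mul_nonneg (by norm_num) (integral_nonneg fun _ => hA.lagrangian_nonneg _ _)

/-- The chain rule along an absolutely continuous path. -/
theorem IsH1.integral_inner_gradient (hA : Admissible V c a) {T : ℝ} (hT : 0 ≤ T)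
    {X v : ℝ → 𝔼 n} (h : IsH1 T X v) :
    ∫ t in Ioo 0 T, inner ℝ (gradient V (X t)) (v t) = V (X T) - V (X 0) := by
  obtain ⟨R, hR⟩ := isCompact_Icc.exists_bound_of_continuousOn (h.continuousOn hT)
  obtain ⟨G, hG⟩ := (isCompact_closedBall (0 : 𝔼 n) R).exists_bound_of_continuousOn
    ((hA.V_contDiff.continuous_fderiv (by norm_num)).continuousOn)
  have hdiff : Differentiable ℝ V := hA.V_contDiff.differentiable (by norm_num)
  have hlip : ∀ x ∈ Metric.closedBall (0 : 𝔼 n) R, ∀ y ∈ Metric.closedBall (0 : 𝔼 n) R,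
      ‖V y - V x‖ ≤ G * ‖y - x‖ := fun x hx y hy =>
    (convex_closedBall (0 : 𝔼 n) R).norm_image_sub_le_of_norm_fderiv_le
      (fun z _ => hdiff z) hG hx hy
  -- The path stays in a ball on which `V` is Lipschitz, and a Lipschitz function of an absolutely
  -- continuous path is absolutely continuous.
  have hac : AbsolutelyContinuousOnInterval (fun t => V (X t)) 0 T := by
    have h0 := (h.absolutelyContinuous hT)
    have h1 : Tendsto (fun E : ℕ × (ℕ → ℝ × ℝ) => G * ∑ i ∈ Finset.range E.1,
        dist (X (E.2 i).1) (X (E.2 i).2)) (AbsolutelyContinuousOnInterval.totalLengthFilter ⊓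
        𝓟 (AbsolutelyContinuousOnInterval.disjWithin 0 T)) (𝓝 0) := by
      simpa using Tendsto.const_mul G h0
    have hev : ∀ᶠ E in AbsolutelyContinuousOnInterval.totalLengthFilter ⊓
        𝓟 (AbsolutelyContinuousOnInterval.disjWithin 0 T),
        E ∈ AbsolutelyContinuousOnInterval.disjWithin 0 T := eventually_inf_principal.2 (by simp)
    refine squeeze_zero' (Eventually.of_forall fun _ => Finset.sum_nonneg fun _ _ => dist_nonneg)
      (hev.mono fun E hE => ?_) h1
    rw [Finset.mul_sum]
    refine Finset.sum_le_sum fun j hj => ?_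
    have hj' := hE.1 j hj
    rw [uIcc_of_le hT] at hj'
    rw [dist_eq_norm, dist_eq_norm]
    exact hlip _ (by simpa using hR _ hj'.2) _ (by simpa using hR _ hj'.1)
  rw [← hac.integral_deriv_eq_sub, intervalIntegral.integral_of_le hT,
    integral_Ioc_eq_integral_Ioo]
  refine setIntegral_congr_ae measurableSet_Ioo ?_
  filter_upwards [h.ae_hasDerivAt hT] with t ht hmem
  have h1 := (hdiff (X t)).hasGradientAt.hasFDerivAt.comp_hasDerivAt t (ht hmem)
  have h2 := h1.deriv
  simp only [InnerProductSpace.toDual_apply_apply] at h2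
  exact h2.symm

/-- The energy estimate: the action controls the kinetic energy and the time integral of
`|∇V|²`. -/
theorem exists_energy_le (hA : Admissible V c a) : ∃ C : ℝ, 0 ≤ C ∧
    ∀ {T : ℝ} {X v : ℝ → 𝔼 n}, 0 ≤ T → IsH1 T X v →
      IntegrableOn (fun t => ‖v t‖ ^ 2 + ‖gradient V (X t)‖ ^ 2) (Ioo 0 T) ∧
      ∫ t in Ioo 0 T, (‖v t‖ ^ 2 + ‖gradient V (X t)‖ ^ 2) ≤
        C * ((fwAction V c a T X).toReal + V (X 0) + T) := by
  obtain ⟨γ, C, hγ, hC, hle⟩ := hA.exists_le_lagrangian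
  refine ⟨(4 + C) / γ, by positivity, fun {T X v} hT h => ?_⟩
  have i1 : Integrable (fun t => ‖v t‖ ^ 2) (volume.restrict (Ioo 0 T)) :=
    h.memLp.integrable_norm_pow (by norm_num)
  have hg : ContinuousOn (fun t => gradient V (X t)) (Icc 0 T) :=
    hA.continuous_gradient.comp_continuousOn (h.continuousOn hT)
  have i2 : Integrable (fun t => ‖gradient V (X t)‖ ^ 2) (volume.restrict (Ioo 0 T)) :=
    IntegrableOn.mono_set ((hg.norm.pow 2).integrableOn_compact isCompact_Icc)
      Ioo_subset_Icc_self
  have i3 : Integrable (fun t => inner ℝ (gradient V (X t)) (v t)) (volume.restrict (Ioo 0 T)) := by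
    refine (i1.add i2).mono' (((hg.mono Ioo_subset_Icc_self).aestronglyMeasurable
      measurableSet_Ioo).inner h.memLp.1) (Eventually.of_forall fun t => ?_)
    refine (norm_inner_le_norm _ _).trans ?_
    simp only [Pi.add_apply]
    nlinarith [sq_nonneg (‖gradient V (X t)‖ - ‖v t‖), sq_nonneg ‖gradient V (X t)‖,
      sq_nonneg ‖v t‖]
  have i4 := h.integrable_lagrangian hA hT
  refine ⟨i1.add i2, ?_⟩
  have key : ∫ t in Ioo 0 T, (γ * (‖v t‖ ^ 2 + ‖gradient V (X t)‖ ^ 2) +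
      2 * inner ℝ (gradient V (X t)) (v t)) ≤
      ∫ t in Ioo 0 T, (lagrangian V c a (X t) (v t) + C) :=
    integral_mono (((i1.add i2).const_mul γ).add (i3.const_mul 2)) (i4.add (integrable_const C))
      fun t => hle _ _
  have i5 : Integrable (fun t => γ * (‖v t‖ ^ 2 + ‖gradient V (X t)‖ ^ 2))
    (volume.restrict (Ioo 0 T)) := (i1.add i2).const_mul γ
  -- The cross term integrates to `2 (V(X_T) - V(X_0))`; the end value is discarded below because `V
  -- ≥ 0`.
  rw [integral_add i5 (i3.const_mul 2), integral_add i4 (integrable_const C),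
    integral_const_mul, integral_const_mul, h.integral_inner_gradient hA hT,
    h.integral_lagrangian hA hT] at key
  simp only [integral_const, measureReal_def, Measure.restrict_apply_univ, Real.volume_Ioo, sub_zero,
    ENNReal.toReal_ofReal hT, smul_eq_mul] at key
  have v0 := hA.V_nonneg (X 0)
  have v1 := hA.V_nonneg (X T)
  have p0 : 0 ≤ (fwAction V c a T X).toReal := ENNReal.toReal_nonneg
  rw [div_mul_eq_mul_div, le_div_iff₀ hγ]
  nlinarith [mul_nonneg hC p0, mul_nonneg hC v0]

/-- The straight line between two points of a ball has bounded action. -/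
theorem exists_fwAction_line_le (hA : Admissible V c a) (R : ℝ) : ∃ B : ℝ, 0 ≤ B ∧
    ∀ x y : 𝔼 n, ‖x‖ ≤ R → ‖y‖ ≤ R →
      fwAction V c a 1 (fun t => x + t • (y - x)) ≤ ENNReal.ofReal B := by
  obtain ⟨K, hK, hk⟩ := hA.exists_lagrangian_le
  obtain ⟨β, hβ⟩ := (isCompact_closedBall (0 : 𝔼 n) R).exists_bound_of_continuousOn
    hA.continuous_drift.continuousOn
  refine ⟨4⁻¹ * (K * ((2 * R) ^ 2 + β ^ 2)), by positivity, fun x y hx hy => ?_⟩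
  have h : IsH1 1 (fun t : ℝ => x + t • (y - x)) (fun _ => y - x) :=
    ⟨memLp_const _, fun t _ => by simp [smul_sub]⟩
  rw [h.fwAction_eq_ofReal hA zero_le_one]
  refine ENNReal.ofReal_le_ofReal (mul_le_mul_of_nonneg_left ?_ (by norm_num))
  have h1 : ∀ t ∈ Ioo (0 : ℝ) 1, lagrangian V c a (x + t • (y - x)) (y - x) ≤
      K * ((2 * R) ^ 2 + β ^ 2) := fun t ht => by
    have hm : x + t • (y - x) ∈ Metric.closedBall (0 : 𝔼 n) R :=
      (convex_closedBall (0 : 𝔼 n) R).add_smul_sub_mem (by simpa using hx) (by simpa using hy)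
        ⟨ht.1.le, ht.2.le⟩
    refine (hk _ _).trans ?_
    have := norm_sub_le y x
    gcongr
    · linarith
    · exact hβ _ hm
  calc ∫ t in Ioo (0 : ℝ) 1, lagrangian V c a (x + t • (y - x)) (y - x)
      ≤ ∫ t in Ioo (0 : ℝ) 1, K * ((2 * R) ^ 2 + β ^ 2) :=
        setIntegral_mono_on (h.integrable_lagrangian hA zero_le_one)
          (integrable_const _) measurableSet_Ioo h1
    _ = _ := by simp

end Action

/-! ### Lower semicontinuity of the action -/

/-- Bounded sequences in a Hilbert space converge weakly along ultrafilters. -/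
theorem exists_weak_limit {H : Type*} [NormedAddCommGroup H] [InnerProductSpace ℝ H]
    [CompleteSpace H] {u : ℕ → H} {D : ℝ} (hu : ∀ k, ‖u k‖ ≤ D) (U : Ultrafilter ℕ) :
    ∃ v : H, ∀ h : H, Tendsto (fun k => inner ℝ (u k) h) U (𝓝 (inner ℝ v h)) := by
  -- Banach–Alaoglu in the dual, transported by the Riesz isomorphism. Along an ultrafilter no
  -- subsequence has to be extracted.
  let φ : ℕ → WeakDual ℝ H := fun k => StrongDual.toWeakDual (InnerProductSpace.toDual ℝ H (u k))
  have hc := WeakDual.isCompact_closedBall (0 : StrongDual ℝ H) D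
  obtain ⟨ψ, -, hψ⟩ := hc.ultrafilter_le_nhds' (U.map φ) (by
    refine Ultrafilter.mem_map.2 (Eventually.of_forall fun k => ?_)
    simpa [φ] using hu k)
  refine ⟨(InnerProductSpace.toDual ℝ H).symm (WeakDual.toStrongDual ψ), fun h => ?_⟩
  have h1 : Tendsto φ U (𝓝 ψ) := hψ
  have h2 := ((WeakDual.eval_continuous (𝕜 := ℝ) h).tendsto ψ).comp h1
  rw [InnerProductSpace.toDual_symm_apply]
  exact h2

section Lsc

variable {n : ℕ}

local notation "𝔼" n => EuclideanSpace ℝ (Fin n)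

variable {V : (𝔼 n) → ℝ} {c : (𝔼 n) → 𝔼 n} {a : (𝔼 n) → Matrix (Fin n) (Fin n) ℝ}

/-- A pointwise limit of paths whose derivatives are bounded in `L²` has as derivative any weak
limit of the derivatives. -/
theorem IsH1.of_weak_limit {T : ℝ} {w : ℕ → ℝ → 𝔼 n} {v : ℕ → ℝ → 𝔼 n}
    {w₀ : ℝ → 𝔼 n} (h : ∀ k, IsH1 T (w k) (v k)) {U : Ultrafilter ℕ}
    (hw : ∀ t ∈ Icc 0 T, Tendsto (fun k => w k t) U (𝓝 (w₀ t)))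
    {v₀ : Lp (𝔼 n) 2 (volume.restrict (Ioo 0 T))}
    (hv : ∀ f : Lp (𝔼 n) 2 (volume.restrict (Ioo 0 T)),
      Tendsto (fun k => inner ℝ ((h k).memLp.toLp) f) U (𝓝 (inner ℝ v₀ f))) :
    IsH1 T w₀ v₀ := by
  refine ⟨Lp.memLp v₀, fun t ht => ?_⟩
  have hT : (0 : ℝ) ≤ T := ht.1.trans ht.2
  have hms : (volume.restrict (Ioo 0 T)) (Ioo 0 t) ≠ ⊤ := measure_ne_top _ _
  have hsub : Ioo 0 t ⊆ Ioo 0 T := Ioo_subset_Ioo_right ht.2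
  -- Testing against `e` times the indicator of `(0, t)` turns weak convergence of the velocities
  -- into convergence of the increments.
  have hinner : ∀ (e : 𝔼 n) (f : Lp (𝔼 n) 2 (volume.restrict (Ioo 0 T))),
      inner ℝ f (indicatorConstLp 2 measurableSet_Ioo hms e) =
        inner ℝ e (∫ s in (0 : ℝ)..t, f s) := fun e f => by
    rw [real_inner_comm, L2.inner_indicatorConstLp_eq_inner_setIntegral ℝ measurableSet_Ioo,
      Measure.restrict_restrict measurableSet_Ioo, inter_eq_left.2 hsub,
      intervalIntegral.integral_of_le ht.1, integral_Ioc_eq_integral_Ioo]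
  have hk : ∀ (e : 𝔼 n) (k : ℕ), inner ℝ ((h k).memLp.toLp)
      (indicatorConstLp 2 measurableSet_Ioo hms e) = inner ℝ e (w k t - w k 0) := fun e k => by
    rw [hinner, (h k).sub_eq (left_mem_Icc.2 hT) ht, intervalIntegral.integral_of_le ht.1,
      intervalIntegral.integral_of_le ht.1, integral_Ioc_eq_integral_Ioo,
      integral_Ioc_eq_integral_Ioo]
    congr 1
    refine integral_congr_ae ?_
    exact ae_mono (Measure.restrict_mono hsub le_rfl) (h k).memLp.coeFn_toLp
  have heq : w₀ t - w₀ 0 = ∫ s in (0 : ℝ)..t, v₀ s := by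
    refine ext_inner_left ℝ fun e => ?_
    have l1 := hv (indicatorConstLp 2 measurableSet_Ioo hms e)
    simp only [hk] at l1
    rw [hinner] at l1
    have l2 : Tendsto (fun k => inner ℝ e (w k t - w k 0)) U (𝓝 (inner ℝ e (w₀ t - w₀ 0))) :=
      tendsto_const_nhds.inner ((hw t ht).sub (hw 0 (left_mem_Icc.2 hT)))
    exact tendsto_nhds_unique l2 l1
  rw [← heq]
  abel

/-- Fix the momentum `p` that is optimal for the limit path. The Fenchel bound `4 p · (Ẋ - b(X)) - 4
p · a(X) p` lies below the Lagrangian of every path of the sequence. It is affine in `Ẋ` and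
continuous in `X`, so its integral converges under weak convergence of the velocities and pointwise
convergence of the positions with bounded drift. At the limit it equals the Lagrangian. -/
theorem fwAction_le_of_tendsto (hA : Admissible V c a) {T : ℝ} (hT : 0 ≤ T) {w : ℕ → C(ℝ, 𝔼 n)}
    {w₀ : C(ℝ, 𝔼 n)} (hw : Tendsto w atTop (𝓝 w₀)) {y : ℝ≥0∞} (hy : y ≠ ⊤)
    (hle : ∀ k, fwAction V c a T (w k) ≤ y) : fwAction V c a T w₀ ≤ y := by
  set μ : Measure ℝ := volume.restrict (Ioo 0 T) with hμ
  have hH : ∀ k, IsH1 T (w k) (deriv (w k)) := fun k =>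
    isH1_of_fwAction_ne_top hT (ne_top_of_le_ne_top hy (hle k))
  obtain ⟨K, hK, hk⟩ := hA.exists_norm_sq_le_lagrangian
  obtain ⟨K', hK', hk'⟩ := hA.exists_inv_norm_le
  obtain ⟨Lam, hLam, hLa⟩ := hA.exists_norm_le
  -- the drift is bounded along all the paths
  have hcomp : IsCompact (insert w₀ (range w) ×ˢ Icc 0 T) :=
    hw.isCompact_insert_range.prod isCompact_Icc
  obtain ⟨β, hβ⟩ := hcomp.exists_bound_of_continuousOn (f := fun p => drift V c a (p.1 p.2))
    (hA.continuous_drift.comp (by fun_prop : Continuous fun p : C(ℝ, 𝔼 n) × ℝ => p.1 p.2)).continuousOn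
  have hβk : ∀ k, ∀ t ∈ Ioo 0 T, ‖drift V c a (w k t)‖ ≤ β := fun k t ht =>
    hβ (w k, t) ⟨mem_insert_of_mem _ (mem_range_self k), Ioo_subset_Icc_self ht⟩
  have hβ₀ : ∀ t ∈ Ioo 0 T, ‖drift V c a (w₀ t)‖ ≤ β := fun t ht =>
    hβ (w₀, t) ⟨mem_insert _ _, Ioo_subset_Icc_self ht⟩
  -- the derivatives are bounded in `L²`
  have hlag : ∀ k, ∫ t in Ioo 0 T, lagrangian V c a (w k t) (deriv (w k) t) ≤ 4 * y.toReal :=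
    fun k => by
      rw [(hH k).integral_lagrangian hA hT]
      exact mul_le_mul_of_nonneg_left (ENNReal.toReal_mono hy (hle k)) (by norm_num)
  have hsq : ∀ k, ∫ t, ‖deriv (w k) t‖ ^ 2 ∂μ ≤ K * (4 * y.toReal) + 2 * β ^ 2 * T := fun k => by
    have i1 : Integrable (fun t => K * lagrangian V c a (w k t) (deriv (w k) t)) μ :=
      ((hH k).integrable_lagrangian hA hT).const_mul K
    calc ∫ t, ‖deriv (w k) t‖ ^ 2 ∂μ
        ≤ ∫ t, (K * lagrangian V c a (w k t) (deriv (w k) t) + 2 * β ^ 2) ∂μ := by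
          refine integral_mono_ae ((hH k).memLp.integrable_norm_pow (by norm_num))
            (i1.add (integrable_const _)) ?_
          filter_upwards [ae_restrict_mem measurableSet_Ioo] with t ht
          refine (hk (w k t) _).trans ?_
          have := hβk k t ht
          gcongr
      _ = K * (∫ t, lagrangian V c a (w k t) (deriv (w k) t) ∂μ) + 2 * β ^ 2 * T := by
          rw [integral_add i1 (integrable_const _), integral_const_mul]
          simp [hμ, hT, mul_comm]
      _ ≤ _ := by gcongr; exact hlag k
  have hnorm : ∀ k, ‖(hH k).memLp.toLp‖ ≤ √(K * (4 * y.toReal) + 2 * β ^ 2 * T) := fun k => by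
    refine Real.le_sqrt_of_sq_le ?_
    rw [← real_inner_self_eq_norm_sq, L2.inner_def]
    refine le_trans (le_of_eq ?_) (hsq k)
    refine integral_congr_ae ?_
    filter_upwards [(hH k).memLp.coeFn_toLp] with t ht
    rw [ht, real_inner_self_eq_norm_sq]
  -- the weak limit is the derivative of the limit
  obtain ⟨v, hv⟩ := exists_weak_limit hnorm (hyperfilter ℕ)
  -- The velocities converge only along the ultrafilter, which refines `atTop` and therefore keeps
  -- the limits of the positions.
  have hU : (hyperfilter ℕ : Filter ℕ) ≤ atTop := by
    rw [← Nat.cofinite_eq_atTop]; exact hyperfilter_le_cofinite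
  have hpt : ∀ t, Tendsto (fun k => w k t) atTop (𝓝 (w₀ t)) := fun t =>
    ((by fun_prop : Continuous fun f : C(ℝ, 𝔼 n) => f t).tendsto w₀).comp hw
  have hH₀ : IsH1 T w₀ v := IsH1.of_weak_limit hH (fun t _ => (hpt t).mono_left hU) hv
  -- the optimal momentum
  set p : ℝ → 𝔼 n := fun t =>
    (2⁻¹ : ℝ) • Matrix.toEuclideanLin (a (w₀ t))⁻¹ (v t - drift V c a (w₀ t)) with hp
  have hcinv : Continuous fun q : (𝔼 n) × (𝔼 n) =>
      (2⁻¹ : ℝ) • Matrix.toEuclideanLin (a q.1)⁻¹ (q.2 - drift V c a q.1) := by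
    have h1 : Continuous fun q : (𝔼 n) × (𝔼 n) => q.2 - drift V c a q.1 :=
      continuous_snd.sub (hA.continuous_drift.comp continuous_fst)
    have h2 := continuous_toEuclideanLin (A := fun q : (𝔼 n) × (𝔼 n) => (a q.1)⁻¹)
      (hA.continuous_inv.comp continuous_fst) h1
    exact h2.const_smul (2⁻¹ : ℝ)
  have hpm : AEStronglyMeasurable p μ :=
    Continuous.comp_aestronglyMeasurable (f := fun t => (w₀ t, v t)) hcinv
      (w₀.continuous.aestronglyMeasurable.prodMk (Lp.aestronglyMeasurable v))
  have hpL : MemLp p 2 μ := by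
    refine MemLp.of_le (g := fun t => K' * (‖v t‖ + β)) ?_ hpm ?_
    · exact (((Lp.memLp v).norm).add (memLp_const β)).const_mul K'
    · filter_upwards [ae_restrict_mem measurableSet_Ioo] with t ht
      have h1 := hk' (w₀ t) (v t - drift V c a (w₀ t))
      have h2 := norm_sub_le (v t) (drift V c a (w₀ t))
      have h3 := hβ₀ t ht
      have h4 : 0 ≤ K' * (‖v t‖ + β) :=
        mul_nonneg hK'.le (add_nonneg (norm_nonneg _) ((norm_nonneg _).trans h3))
      rw [Real.norm_of_nonneg h4, hp, norm_smul]
      have h5 : K' * ‖v t - drift V c a (w₀ t)‖ ≤ K' * (‖v t‖ + β) := by gcongr; linarith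
      have h6 : ‖(2⁻¹ : ℝ)‖ = 2⁻¹ := by norm_num
      rw [h6]
      linarith [norm_nonneg (Matrix.toEuclideanLin (a (w₀ t))⁻¹ (v t - drift V c a (w₀ t)))]
  have hpI : Integrable (fun t => ‖p t‖ ^ 2) μ := hpL.integrable_norm_pow (by norm_num)
  have hpI1 : Integrable (fun t => ‖p t‖) μ := (hpL.integrable (by norm_num)).norm
  -- the part of the Fenchel bound that converges by dominated convergence
  set G : C(ℝ, 𝔼 n) → ℝ → ℝ := fun ω t =>
    inner ℝ (p t) (drift V c a (ω t)) + inner ℝ (p t) (Matrix.toEuclideanLin (a (ω t)) (p t)) with hG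
  have hGm : ∀ ω : C(ℝ, 𝔼 n), AEStronglyMeasurable (G ω) μ := fun ω => by
    have m1 : AEStronglyMeasurable (fun t => drift V c a (ω t)) μ :=
      (hA.continuous_drift.comp ω.continuous).aestronglyMeasurable
    have m2 : AEStronglyMeasurable (fun t => Matrix.toEuclideanLin (a (ω t)) (p t)) μ :=
      Continuous.comp_aestronglyMeasurable (f := fun t => (ω t, p t))
        (g := fun q : (𝔼 n) × (𝔼 n) => Matrix.toEuclideanLin (a q.1) q.2)
        (continuous_toEuclideanLin (hA.continuous_a.comp continuous_fst) continuous_snd)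
        (ω.continuous.aestronglyMeasurable.prodMk hpm)
    exact (hpm.inner m1).add (hpm.inner m2)
  have hbdI : Integrable (fun t => ‖p t‖ * β + Lam * ‖p t‖ ^ 2) μ :=
    (hpI1.mul_const β).add (hpI.const_mul Lam)
  have hGb : ∀ ω : C(ℝ, 𝔼 n), (∀ t ∈ Ioo 0 T, ‖drift V c a (ω t)‖ ≤ β) →
      ∀ᵐ t ∂μ, ‖G ω t‖ ≤ ‖p t‖ * β + Lam * ‖p t‖ ^ 2 := fun ω hω => by
    filter_upwards [ae_restrict_mem measurableSet_Ioo] with t ht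
    refine (norm_add_le _ _).trans (add_le_add ?_ ?_)
    · exact (norm_inner_le_norm _ _).trans (mul_le_mul_of_nonneg_left (hω t ht) (norm_nonneg _))
    · refine (norm_inner_le_norm _ _).trans ?_
      have := mul_le_mul_of_nonneg_left (hLa (ω t) (p t)) (norm_nonneg (p t))
      nlinarith
  have hGlim : Tendsto (fun k => ∫ t, G (w k) t ∂μ) atTop (𝓝 (∫ t, G w₀ t ∂μ)) := by
    refine tendsto_integral_of_dominated_convergence _ (fun k => hGm (w k)) hbdI
      (fun k => hGb _ (hβk k)) (Eventually.of_forall fun t => ?_)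
    have hc : Continuous fun x : 𝔼 n =>
        inner ℝ (p t) (drift V c a x) + inner ℝ (p t) (Matrix.toEuclideanLin (a x) (p t)) :=
      (continuous_const.inner hA.continuous_drift).add
        (continuous_const.inner (continuous_toEuclideanLin hA.continuous_a continuous_const))
    exact (hc.tendsto (w₀ t)).comp (hpt t)
  have hinn : ∀ (f : Lp (𝔼 n) 2 μ) (g : ℝ → 𝔼 n), f =ᵐ[μ] g →
      Integrable (fun t => inner ℝ (p t) (g t)) μ ∧
      ∫ t, inner ℝ (p t) (g t) ∂μ = inner ℝ f hpL.toLp := fun f g hfg => by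
    have e : (fun t => inner ℝ (f t) ((hpL.toLp : Lp (𝔼 n) 2 μ) t)) =ᵐ[μ]
        fun t => inner ℝ (p t) (g t) := by
      filter_upwards [hfg, hpL.coeFn_toLp] with t h1 h2
      rw [h1, h2, real_inner_comm]
    exact ⟨(L2.integrable_inner (𝕜 := ℝ) f hpL.toLp).congr e, by
      rw [L2.inner_def]; exact (integral_congr_ae e).symm⟩
  have hlow : ∀ k, 4 * inner ℝ ((hH k).memLp.toLp) hpL.toLp - 4 * ∫ t, G (w k) t ∂μ ≤
      4 * y.toReal := fun k => by
    obtain ⟨j1, j2⟩ := hinn _ _ (hH k).memLp.coeFn_toLp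
    have j3 : Integrable (G (w k)) μ := hbdI.mono' (hGm _) (hGb _ (hβk k))
    rw [← j2, ← integral_const_mul, ← integral_const_mul,
      ← integral_sub (j1.const_mul 4) (j3.const_mul 4)]
    refine (integral_mono ((j1.const_mul 4).sub (j3.const_mul 4))
      ((hH k).integrable_lagrangian hA hT) fun t => ?_).trans (hlag k)
    have := hA.fenchel_le (w k t) (deriv (w k) t - drift V c a (w k t)) (p t)
    rw [inner_sub_right] at this
    simp only [hG, lagrangian, Pi.sub_apply]
    linarith
  have hfin : 4 * inner ℝ v hpL.toLp - 4 * ∫ t, G w₀ t ∂μ ≤ 4 * y.toReal :=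
    le_of_tendsto (((hv hpL.toLp).const_mul 4).sub ((hGlim.mono_left hU).const_mul 4))
      (Eventually.of_forall hlow)
  obtain ⟨j1, j2⟩ := hinn v v EventuallyEq.rfl
  have j3 : Integrable (G w₀) μ := hbdI.mono' (hGm _) (hGb _ hβ₀)
  have hval : ∫ t in Ioo 0 T, lagrangian V c a (w₀ t) (v t) ≤ 4 * y.toReal := by
    refine le_trans (le_of_eq ?_) hfin
    rw [← j2, ← integral_const_mul, ← integral_const_mul,
      ← integral_sub (j1.const_mul 4) (j3.const_mul 4)]
    refine integral_congr_ae (Eventually.of_forall fun t => ?_)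
    have := hA.fenchel_eq (w₀ t) (v t - drift V c a (w₀ t)) (p := p t) rfl
    rw [inner_sub_right] at this
    simp only [hG, lagrangian]
    linarith
  rw [hH₀.fwAction_eq_ofReal hA hT]
  refine (ENNReal.ofReal_le_iff_le_toReal hy).2 ?_
  linarith

/-- Sublevel sets are closed because they are sequentially closed. This also provides Borel
measurability of the action on continuous paths. -/
theorem lowerSemicontinuous_fwAction (hA : Admissible V c a) {T : ℝ} (hT : 0 ≤ T) :
    LowerSemicontinuous fun w : C(ℝ, 𝔼 n) => fwAction V c a T w := by
  refine lowerSemicontinuous_iff_isClosed_preimage.2 fun y => ?_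
  by_cases hy : y = ⊤
  · simp [hy]
  · refine IsSeqClosed.isClosed fun w w₀ hw hlim => ?_
    exact fwAction_le_of_tendsto hA hT hlim hy hw

end Lsc

/-- Integrals of lower semicontinuous functions are lower semicontinuous under weak convergence. -/
theorem lintegral_le_of_tendsto_of_lowerSemicontinuous {S : Type*} [TopologicalSpace S]
    [MeasurableSpace S] [BorelSpace S] [HasOuterApproxClosed S] {μs : ℕ → ProbabilityMeasure S}
    {μ : ProbabilityMeasure S} (hμ : Tendsto μs atTop (𝓝 μ)) {f : S → ℝ≥0∞}
    (hf : LowerSemicontinuous f) {M : ℝ≥0∞} (hM : M ≠ ⊤) (hfM : ∀ x, f x ≤ M) :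
    ∫⁻ x, f x ∂(μ : Measure S) ≤ liminf (fun k => ∫⁻ x, f x ∂(μs k : Measure S)) atTop := by
  have hfm : Measurable fun x => (f x).toReal := hf.measurable.ennreal_toReal
  -- Layer-cake formula. The superlevel sets of `f` are open, so the portmanteau inequality applies
  -- to each of them and Fatou's lemma integrates it.
  have hr : ∀ ν : Measure S, ∫⁻ x, f x ∂ν = ∫⁻ t in Ioi (0 : ℝ), ν {x | t < (f x).toReal} := by
    intro ν
    rw [← lintegral_eq_lintegral_meas_lt ν (Eventually.of_forall fun _ => ENNReal.toReal_nonneg)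
      hfm.aemeasurable]
    refine lintegral_congr fun x => ?_
    rw [ENNReal.ofReal_toReal (ne_top_of_le_ne_top hM (hfM x))]
  simp only [hr]
  refine le_trans ?_ (lintegral_liminf_le fun k => Antitone.measurable fun s t hst =>
    measure_mono fun x hx => lt_of_le_of_lt hst hx)
  refine setLIntegral_mono' measurableSet_Ioi fun t ht => ?_
  refine ProbabilityMeasure.le_liminf_measure_open_of_tendsto hμ ?_
  have : {x | t < (f x).toReal} = f ⁻¹' Ioi (ENNReal.ofReal t) := by
    ext x
    exact (ENNReal.ofReal_lt_iff_lt_toReal (le_of_lt ht) (ne_top_of_le_ne_top hM (hfM x))).symm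
  rw [this]
  exact hf.isOpen_preimage _

/-! ### Time averages of laws and comparison with the empirical process -/

/-- The uniform probability on `(0, T]`. -/
def uniformLaw {T : ℝ} (hT : 0 < T) : ProbabilityMeasure ℝ :=
  ⟨(ENNReal.ofReal T)⁻¹ • volume.restrict (Ioc (0 : ℝ) T), by
    constructor
    simp only [Measure.smul_apply, Measure.restrict_apply_univ, Real.volume_Ioc, sub_zero,
      smul_eq_mul]
    exact ENNReal.inv_mul_cancel (by simpa using hT) ENNReal.ofReal_ne_top⟩

theorem toMeasure_uniformLaw {T : ℝ} (hT : 0 < T) :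
    (uniformLaw hT : Measure ℝ) = (ENNReal.ofReal T)⁻¹ • volume.restrict (Ioc (0 : ℝ) T) := rfl

/-- The time average `T⁻¹ ∫₀ᵀ δ_{w t} dt`. -/
def averageLaw {S : Type*} [MeasurableSpace S] {T : ℝ} (hT : 0 < T) {w : ℝ → S}
    (hw : Measurable w) : ProbabilityMeasure S :=
  (uniformLaw hT).map hw.aemeasurable

section Average

variable {S : Type*} [MeasurableSpace S]

theorem toMeasure_averageLaw {T : ℝ} (hT : 0 < T) {w : ℝ → S} (hw : Measurable w) :
    (averageLaw hT hw : Measure S) =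
      (ENNReal.ofReal T)⁻¹ • (volume.restrict (Ioc (0 : ℝ) T)).map w := by
  rw [averageLaw, ProbabilityMeasure.toMeasure_map, toMeasure_uniformLaw, Measure.map_smul]

theorem integral_averageLaw {T : ℝ} (hT : 0 < T) {w : ℝ → S} (hw : Measurable w) {f : S → ℝ}
    (hf : StronglyMeasurable f) :
    ∫ x, f x ∂(averageLaw hT hw : Measure S) = T⁻¹ * ∫ t in (0 : ℝ)..T, f (w t) := by
  rw [toMeasure_averageLaw, integral_smul_measure,
    integral_map hw.aemeasurable hf.aestronglyMeasurable, intervalIntegral.integral_of_le hT.le,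
    ENNReal.toReal_inv, ENNReal.toReal_ofReal hT.le, smul_eq_mul]

theorem lintegral_averageLaw {T : ℝ} (hT : 0 < T) {w : ℝ → S} (hw : Measurable w) {f : S → ℝ≥0∞}
    (hf : Measurable f) :
    ∫⁻ x, f x ∂(averageLaw hT hw : Measure S) =
      (ENNReal.ofReal T)⁻¹ * ∫⁻ t in Ioc (0 : ℝ) T, f (w t) := by
  rw [toMeasure_averageLaw, lintegral_smul_measure, lintegral_map hf hw, smul_eq_mul]

theorem averageLaw_apply {T : ℝ} (hT : 0 < T) {w : ℝ → S} (hw : Measurable w) {A : Set S}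
    (hA : MeasurableSet A) :
    (averageLaw hT hw : Measure S) A =
      (ENNReal.ofReal T)⁻¹ * volume (w ⁻¹' A ∩ Ioc (0 : ℝ) T) := by
  rw [toMeasure_averageLaw, Measure.smul_apply, Measure.map_apply hw hA,
    Measure.restrict_apply (hw hA), smul_eq_mul]

end Average

section Compare

variable {E : Type*} [MetricSpace E]

/-- The empirical process averages backward views `θ_t`, the window laws forward ones. The
reflection `t ↦ T - t` and the `T`-periodicity of the path exchange the two. -/
theorem integral_empiricalProcess {T : ℝ} (hT : 0 < T) (X : C(Icc (0 : ℝ) T, E))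
    {f : CadlagPath E → ℝ} (hf : StronglyMeasurable f) :
    ∫ Y, f Y ∂((empiricalProcess hT X).1 : Measure (CadlagPath E)) =
      T⁻¹ * ∫ t in (0 : ℝ)..T, f (shift (-t) (periodization hT X)) := by
  have h1 : ((empiricalProcess hT X).1 : Measure (CadlagPath E)) =
      averageLaw hT (continuous_shift_left (periodization hT X)).measurable := by
    rw [toMeasure_averageLaw]; rfl
  rw [h1, integral_averageLaw hT _ hf]
  congr 1
  have h2 := intervalIntegral.integral_comp_sub_left (a := 0) (b := T)
    (fun t => f (shift t (periodization hT X))) T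
  rw [sub_self, sub_zero] at h2
  rw [← h2]
  refine intervalIntegral.integral_congr fun t _ => ?_
  have h3 := shift_periodization_add hT X 1 (-t)
  rw [Int.cast_one, one_mul, ← sub_eq_add_neg] at h3
  simp only [h3]

theorem abs_integral_sub_le {T C ε : ℝ} (hT : 0 < T) {f g : ℝ → ℝ}
    (hf : IntervalIntegrable f volume 0 T) (hg : IntervalIntegrable g volume 0 T) {B : Set ℝ}
    (hB : MeasurableSet B) (hBt : volume B ≠ ⊤) (hC : 0 ≤ C) (hbound : ∀ t, |f t - g t| ≤ C)
    (hε : ∀ t ∈ Ioc 0 T \ B, |f t - g t| ≤ ε) (hε0 : 0 ≤ ε) :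
    |(∫ t in (0 : ℝ)..T, f t) - ∫ t in (0 : ℝ)..T, g t| ≤ ε * T + C * (volume B).toReal := by
  rw [← intervalIntegral.integral_sub hf hg, intervalIntegral.integral_of_le hT.le]
  have i1 : IntegrableOn (fun t => |f t - g t|) (Ioc 0 T) := by
    have := (hf.sub hg).norm
    rw [intervalIntegrable_iff_integrableOn_Ioc_of_le hT.le] at this
    exact this
  have i2 : Integrable (B.indicator fun _ => C) (volume : Measure ℝ) :=
    (integrable_indicator_iff hB).2 (integrableOn_const hBt)
  calc |∫ t in Ioc 0 T, (f t - g t)| ≤ ∫ t in Ioc 0 T, |f t - g t| :=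
        abs_integral_le_integral_abs
    _ ≤ ∫ t in Ioc 0 T, (ε + B.indicator (fun _ => C) t) := by
        refine setIntegral_mono_on i1 ((integrable_const ε).add i2.integrableOn) measurableSet_Ioc
          fun t ht => ?_
        by_cases hb : t ∈ B
        · rw [indicator_of_mem hb]; linarith [hbound t]
        · rw [indicator_of_notMem hb, add_zero]; exact hε t ⟨ht, hb⟩
    _ = ε * T + ∫ t in Ioc 0 T, B.indicator (fun _ => C) t := by
        rw [integral_add (integrable_const ε) i2.integrableOn]
        simp [hT.le, mul_comm]
    _ ≤ ε * T + ∫ t, B.indicator (fun _ => C) t := by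
        exact add_le_add_right (setIntegral_le_integral i2
          (Eventually.of_forall fun t => indicator_nonneg (fun _ _ => hC) t)) _
    _ = _ := by
        rw [integral_indicator hB]
        simp [measureReal_def, mul_comm]

/-- If, for all but a negligible fraction of the times `t`, the path `w t` agrees on a given window
with the periodized path seen from time `t`, then the empirical process has the same limit as the
time averages of `w`. -/
theorem tendsto_empiricalProcess {ι : Type*} {l : Filter ι} [l.IsCountablyGenerated] {T : ι → ℝ}
    (hT : ∀ i, 0 < T i) (X : ∀ i, C(Icc (0 : ℝ) (T i), E)) {w : ι → ℝ → C(ℝ, E)}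
    (hw : ∀ i, Measurable (w i)) {μ : ProbabilityMeasure C(ℝ, E)}
    (hμ : Tendsto (fun i => averageLaw (hT i) (hw i)) l (𝓝 μ))
    (hbad : ∀ m : ℕ, ∀ ε : ℝ, 0 < ε → ∀ᶠ i in l, ∃ B : Set ℝ, MeasurableSet B ∧
      volume B ≤ ENNReal.ofReal (ε * T i) ∧ ∀ t ∈ Ioc 0 (T i) \ B, ∀ s ∈ Icc (-(m : ℝ)) m,
        w i t s = periodization (hT i) (X i) (s + t)) :
    Tendsto (fun i => (empiricalProcess (hT i) (X i)).1) l
      (𝓝 (μ.map continuous_ofContinuous.measurable.aemeasurable)) := by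
  -- A metric makes bounded Lipschitz tests sufficient. Such a test is uniformly continuous, hence
  -- nearly equal on two paths that agree on a large window.
  let : PseudoMetricSpace (CadlagPath E) := UniformSpace.pseudoMetricSpace (CadlagPath E)
  refine tendsto_iff_forall_lipschitz_integral_tendsto.2 ?_
  rintro f ⟨C, hC⟩ ⟨L, hL⟩
  have hfm : StronglyMeasurable f := hL.continuous.measurable.stronglyMeasurable
  have hlim := tendsto_iff_forall_lipschitz_integral_tendsto.1
    (((ProbabilityMeasure.continuous_map continuous_ofContinuous).tendsto μ).comp hμ) f ⟨C, hC⟩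
    ⟨L, hL⟩
  -- Nonnegativity is read off at an actual path, and an index `i` is what supplies one.
  have hC0 : ∀ i : ι, 0 ≤ C := fun i =>
    dist_nonneg.trans (hC (ofContinuous (w i 0)) (ofContinuous (w i 0)))
  have hbdd : ∀ g : ℝ → CadlagPath E, Measurable g → ∀ b,
      IntervalIntegrable (fun t => f (g t)) volume 0 b := fun g hg b => by
    rw [intervalIntegrable_iff]
    refine Measure.integrableOn_of_bounded (M := |f (g 0)| + C) (by simp)
      (hfm.comp_measurable hg).aestronglyMeasurable (Eventually.of_forall fun t => ?_)
    have h1 := hC (g t) (g 0)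
    rw [Real.dist_eq] at h1
    have h2 := abs_add_le (f (g t) - f (g 0)) (f (g 0))
    rw [sub_add_cancel] at h2
    rw [Real.norm_eq_abs]
    linarith
  have hzero : Tendsto (fun i => (∫ Y, f Y ∂((empiricalProcess (hT i) (X i)).1 :
      Measure (CadlagPath E))) - ∫ Y, f Y ∂(((averageLaw (hT i) (hw i)).map
        continuous_ofContinuous.measurable.aemeasurable : ProbabilityMeasure (CadlagPath E)) :
          Measure (CadlagPath E))) l (𝓝 0) := by
    refine Metric.tendsto_nhds.2 fun ε hε => ?_
    have hU : {p : CadlagPath E × CadlagPath E | dist (f p.1) (f p.2) < ε / 2} ∈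
        uniformity (CadlagPath E) :=
      hL.uniformContinuous (Metric.dist_mem_uniformity (by positivity))
    obtain ⟨m, hm⟩ := exists_window_mem hU
    -- With this fraction the bad times contribute at most `ε/4` to the average; the good times
    -- contribute at most `ε/2`.
    filter_upwards [hbad m (ε / (4 * (|C| + 1))) (by positivity)] with i hi
    obtain ⟨B, hB, hBv, hagree⟩ := hi
    have hBt : volume B ≠ ⊤ := ne_top_of_le_ne_top ENNReal.ofReal_ne_top hBv
    have hTi := hT i
    have hBr : (volume B).toReal ≤ ε / (4 * (|C| + 1)) * T i :=
      (ENNReal.toReal_mono ENNReal.ofReal_ne_top hBv).trans_eq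
        (ENNReal.toReal_ofReal (by positivity))
    rw [integral_empiricalProcess _ _ hfm, ProbabilityMeasure.toMeasure_map,
      integral_map continuous_ofContinuous.measurable.aemeasurable hfm.aestronglyMeasurable,
      integral_averageLaw (hT i) (hw i) (f := fun x => f (ofContinuous x))
        (hfm.comp_measurable continuous_ofContinuous.measurable), ← mul_sub,
      Real.dist_eq, sub_zero, abs_mul, abs_of_pos (inv_pos.2 hTi)]
    have hest := abs_integral_sub_le hTi
      (hbdd (fun t => shift (-t) (periodization (hT i) (X i)))
        ((continuous_shift_left _).comp continuous_neg).measurable (T i))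
      (hbdd (fun t => ofContinuous (w i t)) (continuous_ofContinuous.measurable.comp (hw i)) (T i))
      hB hBt (hC0 i) (fun t => hC _ _) (ε := ε / 2) (fun t ht => by
        have : (shift (-t) (periodization (hT i) (X i)), ofContinuous (w i t)) ∈
            {p : CadlagPath E × CadlagPath E | dist (f p.1) (f p.2) < ε / 2} := by
          refine hm _ _ fun s hs => ?_
          rw [ofContinuous_apply, hagree t ht s hs, shift_apply, sub_neg_eq_add]
        exact le_of_lt this) (by positivity)
    have h3 : C * (volume B).toReal ≤ ε / 4 * T i := by
      have h4 : C ≤ |C| + 1 := (le_abs_self C).trans (by linarith)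
      calc C * (volume B).toReal ≤ (|C| + 1) * (ε / (4 * (|C| + 1)) * T i) :=
            mul_le_mul h4 hBr ENNReal.toReal_nonneg (by positivity)
        _ = ε / 4 * T i := by field_simp
    rw [inv_mul_lt_iff₀ hTi]
    refine hest.trans_lt ?_
    nlinarith
  have := hzero.add hlim
  simp only [zero_add] at this
  refine this.congr fun i => ?_
  simp

end Compare

/-! ### Tightness of the time averages -/

section Holder

variable {F : Type*} [NormedAddCommGroup F]

theorem dist_lt_of_holder {f : ℝ → F} {M : ℕ → ℝ}
    (hf : ∀ m : ℕ, ∀ s ∈ Icc (-(m : ℝ)) m, ∀ t ∈ Icc (-(m : ℝ)) m, ‖f t - f s‖ ^ 2 ≤ M m * |t - s|)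
    {t₀ ε : ℝ} (hε : 0 < ε) {m : ℕ} (hm : |t₀| + 1 ≤ m) {t : ℝ}
    (ht : dist t t₀ < min 1 (ε ^ 2 / (|M m| + 1))) : dist (f t₀) (f t) < ε := by
  rw [Real.dist_eq] at ht
  have h1 := ht.trans_le (min_le_left _ _)
  have h2 := ht.trans_le (min_le_right _ _)
  have a1 := abs_le.1 (le_refl |t₀|)
  have a2 := abs_lt.1 h1
  have h3 := hf m t₀ ⟨by linarith, by linarith⟩ t ⟨by linarith, by linarith⟩
  rw [lt_div_iff₀ (by positivity)] at h2
  have h4 : ‖f t - f t₀‖ ^ 2 < ε ^ 2 := by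
    nlinarith [le_abs_self (M m), abs_nonneg (t - t₀),
      mul_le_mul_of_nonneg_right (le_abs_self (M m)) (abs_nonneg (t - t₀))]
  rw [dist_comm, dist_eq_norm]
  exact lt_of_pow_lt_pow_left₀ 2 hε.le h4

/-- A set of continuous paths that are bounded at `0` and locally uniformly Hölder continuous is
compact. -/
theorem isCompact_holder [ProperSpace F] (R : ℝ) (M : ℕ → ℝ) :
    IsCompact {w : C(ℝ, F) | ‖w 0‖ ≤ R ∧ ∀ m : ℕ, ∀ s ∈ Icc (-(m : ℝ)) m,
      ∀ t ∈ Icc (-(m : ℝ)) m, ‖w t - w s‖ ^ 2 ≤ M m * |t - s|} := by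
  have hex : ∀ t₀ : ℝ, ∃ m : ℕ, |t₀| + 1 ≤ m := fun t₀ => exists_nat_ge _
  refine ArzelaAscoli.isCompact_of_equicontinuous _ ?_ ?_
  -- The Hölder bounds force continuity by themselves, so the image of the set in the product space
  -- is cut out by closed pointwise conditions. It lies in a product of balls, and Tychonoff
  -- applies.
  · set H : Set (ℝ → F) := {f | ‖f 0‖ ≤ R ∧ ∀ m : ℕ, ∀ s ∈ Icc (-(m : ℝ)) m,
      ∀ t ∈ Icc (-(m : ℝ)) m, ‖f t - f s‖ ^ 2 ≤ M m * |t - s|} with hH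
    have himage : (ContinuousMap.toFun '' {w : C(ℝ, F) | ‖w 0‖ ≤ R ∧ ∀ m : ℕ,
        ∀ s ∈ Icc (-(m : ℝ)) m, ∀ t ∈ Icc (-(m : ℝ)) m, ‖w t - w s‖ ^ 2 ≤ M m * |t - s|}) = H := by
      ext f
      constructor
      · rintro ⟨w, hw, rfl⟩
        exact hw
      · intro hf
        refine ⟨⟨f, continuous_iff_continuousAt.2 fun t₀ => Metric.continuousAt_iff.2 fun ε hε => ?_⟩,
          hf, rfl⟩
        obtain ⟨m, hm⟩ := hex t₀
        refine ⟨min 1 (ε ^ 2 / (|M m| + 1)), by positivity, fun t ht => ?_⟩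
        rw [dist_comm]
        exact dist_lt_of_holder hf.2 hε hm ht
    rw [himage]
    have hclosed : IsClosed H := by
      simp only [hH, ofPred_and, ofPred_forall]
      refine IsClosed.inter (isClosed_le (by fun_prop) (by fun_prop)) ?_
      refine isClosed_iInter fun m => isClosed_iInter fun s => isClosed_iInter fun _ =>
        isClosed_iInter fun t => isClosed_iInter fun _ => isClosed_le (by fun_prop) (by fun_prop)
    choose m hm using hex
    refine (isCompact_univ_pi (s := fun t : ℝ => Metric.closedBall (0 : F)
      (R + √(|M (m t)| * |t|))) fun t => isCompact_closedBall _ _).of_isClosed_subset hclosed ?_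
    intro f hf t _
    have hmt := hm t
    have a1 := abs_le.1 (le_refl |t|)
    have h1 := hf.2 (m t) 0 ⟨by simp, by simp⟩ t ⟨by linarith, by linarith⟩
    rw [sub_zero] at h1
    have h2 : ‖f t - f 0‖ ≤ √(|M (m t)| * |t|) := by
      refine Real.le_sqrt_of_sq_le (h1.trans ?_)
      exact mul_le_mul_of_nonneg_right (le_abs_self _) (abs_nonneg _)
    have h3 := norm_add_le (f t - f 0) (f 0)
    rw [sub_add_cancel] at h3
    rw [mem_closedBall_zero_iff]
    linarith [hf.1]
  · intro t₀
    refine Metric.equicontinuousAt_iff.2 fun ε hε => ?_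
    obtain ⟨m, hm⟩ := hex t₀
    exact ⟨min 1 (ε ^ 2 / (|M m| + 1)), by positivity, fun t ht w =>
      dist_lt_of_holder w.2.2 hε hm ht⟩

end Holder

/-- Tonelli and translation invariance: each instant is seen by windows whose centres fill a length
`2m`. -/
theorem lintegral_window (G : ℝ → ℝ≥0∞) (hG : Measurable G) (m : ℕ) :
    ∫⁻ t, ∫⁻ s in Ioo (-(m : ℝ)) m, G (s + t) = ENNReal.ofReal (2 * m) * ∫⁻ t, G t := by
  rw [lintegral_lintegral_swap (by fun_prop)]
  have : ∀ s : ℝ, ∫⁻ t, G (s + t) = ∫⁻ t, G t := fun s => lintegral_add_left_eq_self G s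
  simp only [this, lintegral_const, Measure.restrict_apply_univ, Real.volume_Ioo]
  rw [mul_comm]
  congr 2
  ring

/-- The extension of a path on `[0, T]` by constants. -/
def extendPath {E : Type*} [TopologicalSpace E] {T : ℝ} (hT : 0 < T) (X : C(Icc (0 : ℝ) T, E)) :
    C(ℝ, E) := ⟨IccExtend hT.le X, X.continuous.Icc_extend'⟩

theorem coe_extendPath {E : Type*} [TopologicalSpace E] {T : ℝ} (hT : 0 < T)
    (X : C(Icc (0 : ℝ) T, E)) : (extendPath hT X : ℝ → E) = IccExtend hT.le X := rfl

theorem periodization_eq_extendPath {E : Type*} [MetricSpace E] {T : ℝ} (hT : 0 < T)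
    (X : C(Icc (0 : ℝ) T, E)) {t : ℝ} (ht : t ∈ Ico 0 T) :
    periodization hT X t = extendPath hT X t := by
  rw [periodization_apply, coe_extendPath]
  have : ⌊t / T⌋ = 0 := Int.floor_eq_iff.2
    ⟨by simpa using div_nonneg ht.1 hT.le, by simpa using (div_lt_one hT).2 ht.2⟩
  simp [this]

section Tight

variable {n : ℕ}

local notation "𝔼" n => EuclideanSpace ℝ (Fin n)

variable {V : (𝔼 n) → ℝ} {c : (𝔼 n) → 𝔼 n} {a : (𝔼 n) → Matrix (Fin n) (Fin n) ℝ}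

/-- The squared speed of a path on `[0, T]`, extended by `0`. -/
def speedSq (T : ℝ) (X : ℝ → 𝔼 n) : ℝ → ℝ≥0∞ := (Ioo 0 T).indicator fun t => ‖deriv X t‖ₑ ^ 2

theorem measurable_speedSq (T : ℝ) (X : ℝ → 𝔼 n) : Measurable (speedSq T X) :=
  (((measurable_deriv X).enorm).pow_const 2).indicator measurableSet_Ioo

theorem lintegral_speedSq (T : ℝ) (X : ℝ → 𝔼 n) :
    ∫⁻ t, speedSq T X t = ∫⁻ t in Ioo 0 T, ‖deriv X t‖ₑ ^ 2 :=
  lintegral_indicator measurableSet_Ioo _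

/-- The extended path is constant outside `[0, T]`, so both times may be clamped to `[0, T]` without
changing the increment. Clamping shrinks their distance and the interval of integration. -/
theorem ofReal_norm_sub_sq_le {T : ℝ} (hT : 0 < T) (X : C(Icc (0 : ℝ) T, 𝔼 n))
    (h : IsH1 T (extendPath hT X) (deriv (extendPath hT X))) {s r : ℝ} (hsr : s ≤ r) :
    ENNReal.ofReal (‖extendPath hT X r - extendPath hT X s‖ ^ 2) ≤
      ENNReal.ofReal (r - s) * ∫⁻ u in Ioo s r, speedSq T (extendPath hT X) u := by
  set v := deriv (extendPath hT X) with hv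
  set s' : ℝ := max 0 (min T s) with hs'
  set r' : ℝ := max 0 (min T r) with hr'
  have e : ∀ u : ℝ, extendPath hT X u = extendPath hT X (max 0 (min T u)) := fun u => by
    simp only [coe_extendPath, IccExtend_apply]
    congr 2
    have h0 : min T (max 0 (min T u)) = max 0 (min T u) :=
      min_eq_right (max_le hT.le (min_le_left _ _))
    rw [h0, max_eq_right (le_max_left _ _)]
  have hs0 : 0 ≤ s' := le_max_left _ _
  have hrT : r' ≤ T := max_le hT.le (min_le_left _ _)
  have hsr' : s' ≤ r' := max_le_max le_rfl (min_le_min le_rfl hsr)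
  have hdiff : r' - s' ≤ r - s := by
    rw [hs', hr']
    rcases le_total T s with h1 | h1 <;> rcases le_total T r with h2 | h2 <;>
      rcases le_total 0 s with h3 | h3 <;> rcases le_total 0 r with h4 | h4 <;>
      simp only [min_eq_left, min_eq_right, max_eq_left, max_eq_right, h1, h2, h3, h4, hT.le] <;>
      linarith
  rw [e r, e s]
  refine (ENNReal.ofReal_le_ofReal (h.norm_sub_sq_le hs0 hsr' hrT)).trans ?_
  rw [ENNReal.ofReal_mul (sub_nonneg.2 hsr')]
  refine mul_le_mul' (ENNReal.ofReal_le_ofReal hdiff) ?_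
  have hint : Integrable (fun r => ‖v r‖ ^ 2) (volume.restrict (Ioo s' r')) :=
    IntegrableOn.mono_set (h.memLp.integrable_norm_pow (by norm_num)) (Ioo_subset_Ioo hs0 hrT)
  rw [intervalIntegral.integral_of_le hsr', integral_Ioc_eq_integral_Ioo,
    ofReal_integral_eq_lintegral_ofReal hint (Eventually.of_forall fun _ => by positivity)]
  have hsub : Ioo s' r' ⊆ Ioo s r := fun u hu => by
    constructor
    · have h1 : s' < T := hu.1.trans (hu.2.trans_le hrT)
      have h2 : min T s < T := (le_max_right _ _).trans_lt h1
      have h3 : s < T := by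
        by_contra hc
        rw [min_eq_left (not_lt.1 hc)] at h2
        exact lt_irrefl _ h2
      have h4 : s ≤ s' := by rw [hs', min_eq_right h3.le]; exact le_max_right _ _
      exact h4.trans_lt hu.1
    · have h1 : 0 < r' := hs0.trans_lt (hu.1.trans hu.2)
      have h2 : r' = min T r := by
        rw [hr']
        refine max_eq_right ?_
        by_contra hc
        rw [hr', max_eq_left (not_le.1 hc).le] at h1
        exact lt_irrefl _ h1
      exact hu.2.trans_le (h2.le.trans (min_le_right _ _))
  calc ∫⁻ u in Ioo s' r', ENNReal.ofReal (‖v u‖ ^ 2)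
      = ∫⁻ u in Ioo s' r', speedSq T (extendPath hT X) u := by
        refine setLIntegral_congr_fun measurableSet_Ioo fun u hu => ?_
        have : u ∈ Ioo 0 T := ⟨hs0.trans_lt hu.1, hu.2.trans_le hrT⟩
        simp only [speedSq, indicator_of_mem this]
        rw [ENNReal.ofReal_pow (norm_nonneg _), ofReal_norm]
    _ ≤ _ := lintegral_mono_set hsub

theorem holder_of_speed_le {T : ℝ} (hT : 0 < T) (X : C(Icc (0 : ℝ) T, 𝔼 n))
    (h : IsH1 T (extendPath hT X) (deriv (extendPath hT X))) {m : ℕ} {M t : ℝ} (hM : 0 ≤ M)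
    (hle : ∫⁻ s in Ioo (-(m : ℝ)) m, speedSq T (extendPath hT X) (s + t) ≤ ENNReal.ofReal M)
    {s r : ℝ} (hs : s ∈ Icc (-(m : ℝ)) m) (hr : r ∈ Icc (-(m : ℝ)) m) :
    ‖advance t (extendPath hT X) r - advance t (extendPath hT X) s‖ ^ 2 ≤ M * |r - s| := by
  have key : ∀ {s r : ℝ}, s ∈ Icc (-(m : ℝ)) m → r ∈ Icc (-(m : ℝ)) m → s ≤ r →
      ‖advance t (extendPath hT X) r - advance t (extendPath hT X) s‖ ^ 2 ≤ M * |r - s| := by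
    intro s r hs hr hsr
    have h1 := ofReal_norm_sub_sq_le hT X h (s := s + t) (r := r + t) (by linarith)
    have h2 : ∫⁻ u in Ioo (s + t) (r + t), speedSq T (extendPath hT X) u ≤ ENNReal.ofReal M := by
      rw [setLIntegral_Ioo_comp_add_right] at hle
      exact (lintegral_mono_set (Ioo_subset_Ioo (by linarith [hs.1]) (by linarith [hr.2]))).trans hle
    have h3 := h1.trans (mul_le_mul_right h2 _)
    rw [← ENNReal.ofReal_mul (by linarith), ENNReal.ofReal_le_ofReal_iff
      (mul_nonneg (by linarith) hM)] at h3
    rw [abs_of_nonneg (sub_nonneg.2 hsr), advance_apply, advance_apply]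
    linarith
  rcases le_total s r with hsr | hsr
  · exact key hs hr hsr
  · rw [norm_sub_rev, abs_sub_comm]
    exact key hr hs hsr

/-- The law of a path seen from a uniform random time of `(0, T]`. -/
def windowLaw {E : Type*} [TopologicalSpace E] {T : ℝ} (hT : 0 < T) (X : C(Icc (0 : ℝ) T, E)) :
    ProbabilityMeasure C(ℝ, E) :=
  averageLaw hT (continuous_advance_left (extendPath hT X)).measurable

/-- A window lies in the compact Hölder set unless `|∇V|` is large at its centre or its kinetic
energy on some `[-m, m]` is large. Markov's inequality bounds the proportion of times for each of
these events. -/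
theorem isTightMeasureSet_windowLaw (hA : Admissible V c a) {ι : Type*} {T : ι → ℝ}
    (hT : ∀ i, 0 < T i) (X : ∀ i, C(Icc (0 : ℝ) (T i), 𝔼 n)) {C : ℝ} (hC : 0 ≤ C)
    (hH : ∀ i, IsH1 (T i) (extendPath (hT i) (X i)) (deriv (extendPath (hT i) (X i))))
    (hkin : ∀ i, ∫⁻ t in Ioo 0 (T i), ‖deriv (extendPath (hT i) (X i)) t‖ₑ ^ 2 ≤
      ENNReal.ofReal (C * T i))
    (hgrad : ∀ i, ∫⁻ t in Ioo 0 (T i), ‖gradient V (extendPath (hT i) (X i) t)‖ₑ ^ 2 ≤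
      ENNReal.ofReal (C * T i)) :
    IsTightMeasureSet {μ | ∃ ν ∈ range fun i => windowLaw (hT i) (X i),
      ((ν : ProbabilityMeasure C(ℝ, 𝔼 n)) : Measure C(ℝ, 𝔼 n)) = μ} := by
  refine isTightMeasureSet_iff_exists_isCompact_measure_compl_le.2 fun ε hε => ?_
  -- The allowed mass `ε` is shared among countably many bad events: `none` for the position, `some
  -- m` for the energy on `[-m, m]`.
  obtain ⟨δ, hδ, hsum⟩ := ENNReal.exists_pos_sum_of_countable hε.ne' (Option ℕ)
  -- a ball outside which the gradient is large
  set A : ℝ := (C + 1) / δ none with hAdef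
  have hδ0 : (0 : ℝ) < δ none := hδ none
  have hA0 : 0 < A := by positivity
  obtain ⟨R, hR⟩ : ∃ R : ℝ, ∀ x : 𝔼 n, R < ‖x‖ → √A ≤ ‖gradient V x‖ := by
    have := hA.tendsto_norm_gradient.eventually_ge_atTop (√A)
    rw [← comap_norm_atTop, eventually_comap] at this
    obtain ⟨R, hR⟩ := eventually_atTop.1 this
    exact ⟨R, fun x hx => hR ‖x‖ hx.le x rfl⟩
  -- The mean energy of a window `[-m, m]` is at most `2mC`, so at this level Markov's bound is
  -- below `δ (some m)`; the `+ 1` keeps `M m` positive when `m = 0`.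
  set M : ℕ → ℝ := fun m => (2 * m * C + 1) / δ (some m) with hM
  have hM0 : ∀ m, 0 < M m := fun m => by
    have : (0 : ℝ) < δ (some m) := hδ (some m)
    positivity
  refine ⟨_, isCompact_holder R M, ?_⟩
  rintro _ ⟨_, ⟨i, rfl⟩, rfl⟩
  have hTi := hT i
  set Y := extendPath (hT i) (X i) with hY
  set 𝒦 : Set C(ℝ, 𝔼 n) := {w | ‖w 0‖ ≤ R ∧ ∀ m : ℕ, ∀ s ∈ Icc (-(m : ℝ)) m,
    ∀ t ∈ Icc (-(m : ℝ)) m, ‖w t - w s‖ ^ 2 ≤ M m * |t - s|} with hK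
  have hKm : MeasurableSet 𝒦ᶜ := (isCompact_holder R M).isClosed.measurableSet.compl
  set μ : Measure ℝ := volume.restrict (Ioo 0 (T i)) with hμ
  set b : Option ℕ → Set ℝ := fun o => match o with
    | none => {t | ENNReal.ofReal A ≤ ‖gradient V (Y t)‖ₑ ^ 2}
    | some m => {t | ENNReal.ofReal (M m) ≤ ∫⁻ s in Ioo (-(m : ℝ)) m, speedSq (T i) Y (s + t)} with hb
  have hsub : (fun t => advance t Y) ⁻¹' 𝒦ᶜ ⊆ ⋃ o, b o := by
    intro t ht
    by_contra hc
    simp only [mem_iUnion, not_exists] at hc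
    refine ht ⟨?_, fun m s hs r hr => ?_⟩
    · by_contra hn
      refine hc none ?_
      have h1 := hR (Y t) (by simpa using not_le.1 hn)
      simp only [hb, mem_ofPred_eq]
      rw [← ofReal_norm, ← ENNReal.ofReal_pow (norm_nonneg _)]
      refine ENNReal.ofReal_le_ofReal ?_
      rw [← Real.sq_sqrt hA0.le]
      gcongr
    · have h1 := hc (some m)
      simp only [hb, mem_ofPred_eq, not_le] at h1
      exact holder_of_speed_le (hT i) (X i) (hH i) (hM0 m).le h1.le hs hr
  have hbm : ∀ o, μ (b o) ≤ δ o * ENNReal.ofReal (T i) := by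
    intro o
    have hscal : ∀ {D W : ℝ} {d : NNReal}, 0 < D → 0 ≤ W → 0 < d → W ≤ D * d →
        ∀ {x : ℝ≥0∞}, ENNReal.ofReal D * x ≤ ENNReal.ofReal (W * T i) →
          x ≤ d * ENNReal.ofReal (T i) := by
      intro D W d hD hW hd hWD x hx
      have h1 : ENNReal.ofReal (W * T i) ≤ ENNReal.ofReal D * (d * ENNReal.ofReal (T i)) := by
        rw [← ENNReal.ofReal_coe_nnreal, ← ENNReal.ofReal_mul d.coe_nonneg,
          ← ENNReal.ofReal_mul hD.le]
        refine ENNReal.ofReal_le_ofReal ?_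
        rw [← mul_assoc]
        gcongr
      exact (ENNReal.mul_le_mul_iff_right (by simpa using hD) ENNReal.ofReal_ne_top).1 (hx.trans h1)
    cases o with
    | none =>
      refine hscal hA0 hC (hδ none) ?_ ((mul_meas_ge_le_lintegral₀ ?_ _).trans (hgrad i))
      · rw [hAdef, div_mul_cancel₀ _ hδ0.ne']; linarith
      · exact (((hA.continuous_gradient.comp Y.continuous).enorm.measurable).pow_const 2).aemeasurable
    | some m =>
      have hδm : (0 : ℝ) < δ (some m) := hδ (some m)
      refine hscal (hM0 m) (W := 2 * m * C) (by positivity) (hδ (some m)) ?_ ?_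
      · rw [hM]; simp only; rw [div_mul_cancel₀ _ hδm.ne']; linarith
      · have hmeas : Measurable fun t => ∫⁻ s in Ioo (-(m : ℝ)) m, speedSq (T i) Y (s + t) := by
          refine Measurable.lintegral_prod_right' (f := fun p : ℝ × ℝ => speedSq (T i) Y (p.2 + p.1)) ?_
          exact (measurable_speedSq _ _).comp (measurable_snd.add measurable_fst)
        -- The restriction of `t` to `(0, T)` is dropped so that `lintegral_window` applies on the
        -- whole line; the speed vanishes outside `(0, T)`, so the bound stays finite.
        refine (mul_le_mul_right (Measure.restrict_apply_le _ _) _).trans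
          ((mul_meas_ge_le_lintegral₀ hmeas.aemeasurable _).trans ?_)
        rw [lintegral_window _ (measurable_speedSq _ _), lintegral_speedSq, mul_assoc (2 * (m : ℝ)),
          ENNReal.ofReal_mul (p := 2 * (m : ℝ)) (by positivity)]
        exact mul_le_mul_right (hkin i) _
  have hval := averageLaw_apply (hT i) (continuous_advance_left Y).measurable hKm
  refine le_of_eq_of_le hval ?_
  have h1 : volume ((fun t => advance t Y) ⁻¹' 𝒦ᶜ ∩ Ioc 0 (T i)) ≤ ε * ENNReal.ofReal (T i) := by
    calc volume ((fun t => advance t Y) ⁻¹' 𝒦ᶜ ∩ Ioc 0 (T i))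
        = μ ((fun t => advance t Y) ⁻¹' 𝒦ᶜ) := by
          rw [hμ, Measure.restrict_congr_set (Ioo_ae_eq_Ioc (μ := volume)),
            Measure.restrict_apply ((continuous_advance_left Y).measurable hKm)]
      _ ≤ μ (⋃ o, b o) := measure_mono hsub
      _ ≤ ∑' o, μ (b o) := measure_iUnion_le _
      _ ≤ ∑' o, δ o * ENNReal.ofReal (T i) := ENNReal.tsum_le_tsum hbm
      _ = (∑' o, (δ o : ℝ≥0∞)) * ENNReal.ofReal (T i) := ENNReal.tsum_mul_right
      _ ≤ _ := by gcongr
  calc (ENNReal.ofReal (T i))⁻¹ * volume ((fun t => advance t Y) ⁻¹' 𝒦ᶜ ∩ Ioc 0 (T i))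
      ≤ (ENNReal.ofReal (T i))⁻¹ * (ε * ENNReal.ofReal (T i)) := by gcongr
    _ = ε := by
      rw [mul_left_comm, ENNReal.inv_mul_cancel (by simpa using hTi) ENNReal.ofReal_ne_top, mul_one]

/-- Paths with action of order `T` started from a compact set: along a subsequence, both the window
laws and the empirical processes converge, to the same limit. -/
theorem exists_subseq_tendsto (hA : Admissible V c a) {K : Set (𝔼 n)} (hK : IsCompact K)
    {T : ℕ → ℝ} (hT1 : ∀ k, 1 ≤ T k) (hTlim : Tendsto T atTop atTop) (hT : ∀ k, 0 < T k)
    (X : ∀ k, C(Icc (0 : ℝ) (T k), 𝔼 n)) (hX0 : ∀ k, extendPath (hT k) (X k) 0 ∈ K) {M : ℝ}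
    (hM0 : 0 ≤ M)
    (hM : ∀ k, fwAction V c a (T k) (extendPath (hT k) (X k)) ≤ ENNReal.ofReal (M * T k)) :
    ∃ (φ : ℕ → ℕ) (μ : ProbabilityMeasure C(ℝ, 𝔼 n)), StrictMono φ ∧
      Tendsto (fun k => windowLaw (hT (φ k)) (X (φ k))) atTop (𝓝 μ) ∧
      Tendsto (fun k => (empiricalProcess (hT (φ k)) (X (φ k))).1) atTop
        (𝓝 (μ.map continuous_ofContinuous.measurable.aemeasurable)) := by
  obtain ⟨C, hC, hen⟩ := exists_energy_le hA
  obtain ⟨v₀, hv₀⟩ := hK.exists_bound_of_continuousOn hA.V_contDiff.continuous.continuousOn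
  have hH : ∀ k, IsH1 (T k) (extendPath (hT k) (X k)) (deriv (extendPath (hT k) (X k))) := fun k =>
    isH1_of_fwAction_ne_top (hT k).le (ne_top_of_le_ne_top ENNReal.ofReal_ne_top (hM k))
  set D : ℝ := C * (M + |v₀| + 1) with hD
  have hbound : ∀ k, ∫⁻ t in Ioo 0 (T k), ENNReal.ofReal (‖deriv (extendPath (hT k) (X k)) t‖ ^ 2 +
      ‖gradient V (extendPath (hT k) (X k) t)‖ ^ 2) ≤ ENNReal.ofReal (D * T k) := fun k => by
    obtain ⟨i1, i2⟩ := hen (hT k).le (hH k)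
    rw [← ofReal_integral_eq_lintegral_ofReal i1 (Eventually.of_forall fun _ => by positivity)]
    refine ENNReal.ofReal_le_ofReal (i2.trans ?_)
    have h1 : (fwAction V c a (T k) (extendPath (hT k) (X k))).toReal ≤ M * T k := by
      refine (ENNReal.toReal_mono ENNReal.ofReal_ne_top (hM k)).trans_eq
        (ENNReal.toReal_ofReal (mul_nonneg hM0 (hT k).le))
    -- The initial energy is bounded on `K`, and `T ≥ 1` absorbs it into a multiple of `T`.
    have h2 : V (extendPath (hT k) (X k) 0) ≤ |v₀| * T k := by
      have h3 := (le_abs_self _).trans (hv₀ _ (hX0 k))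
      have h4 := le_abs_self v₀
      nlinarith [abs_nonneg v₀, hT1 k]
    rw [hD, mul_assoc]
    refine mul_le_mul_of_nonneg_left ?_ hC
    linarith
  have hconv : ∀ x : 𝔼 n, ‖x‖ₑ ^ 2 = ENNReal.ofReal (‖x‖ ^ 2) := fun x => by
    rw [ENNReal.ofReal_pow (norm_nonneg _), ofReal_norm]
  have htight := isTightMeasureSet_windowLaw hA hT X (C := D) (by positivity) hH
    (fun k => by
      refine le_trans (lintegral_mono fun t => ?_) (hbound k)
      rw [hconv]
      exact ENNReal.ofReal_le_ofReal (le_add_of_nonneg_right (by positivity)))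
    (fun k => by
      refine le_trans (lintegral_mono fun t => ?_) (hbound k)
      rw [hconv]
      exact ENNReal.ofReal_le_ofReal (le_add_of_nonneg_left (by positivity)))
  have hcomp := isCompact_closure_of_isTightMeasureSet htight
  obtain ⟨μ, -, φ, hφ, hlim⟩ := hcomp.tendsto_subseq
    (x := fun k => windowLaw (hT k) (X k)) fun k => subset_closure (mem_range_self k)
  refine ⟨φ, μ, hφ, hlim, ?_⟩
  refine tendsto_empiricalProcess (fun k => hT (φ k)) (fun k => X (φ k))
    (fun k => (continuous_advance_left (extendPath (hT (φ k)) (X (φ k)))).measurable) hlim ?_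
  intro m ε hε
  filter_upwards [(hTlim.comp hφ.tendsto_atTop).eventually_ge_atTop (2 * m / ε)] with k hk
  -- Bad times lie within `m` of an end of `[0, T]`: only then can the window reach the seam of the
  -- periodization.
  refine ⟨Icc 0 m ∪ Icc (T (φ k) - m) (T (φ k)), measurableSet_Icc.union measurableSet_Icc, ?_, ?_⟩
  · refine (measure_union_le _ _).trans ?_
    rw [Real.volume_Icc, Real.volume_Icc, ← ENNReal.ofReal_add (by simp) (by simp)]
    refine ENNReal.ofReal_le_ofReal ?_
    simp only [Function.comp_apply] at hk
    rw [div_le_iff₀ hε] at hk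
    linarith
  · intro t ht s hs
    rw [advance_apply]
    have h1 : ¬ (t ≤ m) := fun hc => ht.2 (Or.inl ⟨ht.1.1.le, hc⟩)
    have h2 : ¬ (T (φ k) - m ≤ t) := fun hc => ht.2 (Or.inr ⟨hc, ht.1.2⟩)
    exact (periodization_eq_extendPath _ _ ⟨by linarith [hs.1], by linarith [hs.2]⟩).symm

end Tight

/-! ### Compactness and the lower bound -/

section LowerBound

variable {n : ℕ}

local notation "𝔼" n => EuclideanSpace ℝ (Fin n)

variable {V : (𝔼 n) → ℝ} {c : (𝔼 n) → 𝔼 n} {a : (𝔼 n) → Matrix (Fin n) (Fin n) ℝ}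

theorem exists_path_of_contractedRate_lt {x : 𝔼 n} {T : ℝ} {P : InvariantProb (𝔼 n)} {M : ℝ≥0∞}
    (h : contractedRate V c a x T P < M) :
    ∃ (hT : 0 < T) (X : C(Icc (0 : ℝ) T, 𝔼 n)), empiricalProcess hT X = P ∧
      extendPath hT X 0 = x ∧ fwAction V c a T (extendPath hT X) < M := by
  simp only [contractedRate, iInf_lt_iff] at h
  obtain ⟨hT, X, hX, hlt⟩ := h
  refine ⟨hT, X, hX, ?_⟩
  by_cases h0 : X ⟨0, left_mem_Icc.2 hT.le⟩ = x
  · rw [fwActionFrom, if_pos h0] at hlt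
    refine ⟨?_, hlt⟩
    rw [coe_extendPath, IccExtend_of_mem _ _ (left_mem_Icc.2 hT.le), h0]
  · rw [fwActionFrom, if_neg h0] at hlt
    exact absurd hlt not_top_lt

theorem exists_seq_of_liminf_lt {x : ℝ → 𝔼 n} {P : ℝ → InvariantProb (𝔼 n)} {M : ℝ≥0∞}
    (h : liminf (fun T : ℝ => contractedRate V c a (x T) T (P T) / ENNReal.ofReal T) atTop < M) :
    ∃ (T : ℕ → ℝ) (hT : ∀ k, 0 < T k) (X : ∀ k, C(Icc (0 : ℝ) (T k), 𝔼 n)),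
      (∀ k, 1 ≤ T k) ∧ Tendsto T atTop atTop ∧ (∀ k, empiricalProcess (hT k) (X k) = P (T k)) ∧
      (∀ k, extendPath (hT k) (X k) 0 = x (T k)) ∧
      ∀ k, fwAction V c a (T k) (extendPath (hT k) (X k)) ≤ M * ENNReal.ofReal (T k) := by
  have hf := frequently_atTop.1 (frequently_lt_of_liminf_lt (by isBoundedDefault) h)
  choose T hT hlt using fun k : ℕ => hf ((k : ℝ) + 1)
  have h1 : ∀ k, 1 ≤ T k := fun k => le_trans (by linarith [k.cast_nonneg (α := ℝ)]) (hT k)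
  have h2 : ∀ k, contractedRate V c a (x (T k)) (T k) (P (T k)) < M * ENNReal.ofReal (T k) :=
    fun k => (ENNReal.div_lt_iff (Or.inl (by simpa using zero_lt_one.trans_le (h1 k)))
      (Or.inl ENNReal.ofReal_ne_top)).1 (hlt k)
  choose hT0 X hX hX0 hXM using fun k => exists_path_of_contractedRate_lt (h2 k)
  refine ⟨T, hT0, X, h1, ?_, hX, hX0, fun k => (hXM k).le⟩
  exact tendsto_atTop_mono hT (tendsto_atTop_add_const_right _ _ tendsto_natCast_atTop_atTop)

/-- Translations act continuously on laws and weak limits are unique, so invariance is a closed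
condition; a limit found among all probabilities stays in `𝒫_θ`. -/
theorem invariant_of_tendsto {E : Type*} [MetricSpace E] {Q : ℕ → InvariantProb E}
    {P : ProbabilityMeasure (CadlagPath E)} (h : Tendsto (fun k => (Q k).1) atTop (𝓝 P)) (t : ℝ) :
    MeasurePreserving (shift t) (P : Measure (CadlagPath E)) (P : Measure (CadlagPath E)) := by
  refine ⟨(continuous_shift t).measurable, ?_⟩
  have h1 := ((ProbabilityMeasure.continuous_map (continuous_shift (E := E) t)).tendsto P).comp h
  have h2 : ((fun ν : ProbabilityMeasure (CadlagPath E) =>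
      ν.map (continuous_shift t).measurable.aemeasurable) ∘ fun k => (Q k).1) =
      fun k => (Q k).1 := by
    funext k
    refine Subtype.ext ?_
    exact ((Q k).2 t).map_eq
  rw [h2] at h1
  have h3 := tendsto_nhds_unique h1 h
  exact congrArg Subtype.val h3

/-- Families of bounded mean action have convergent subsequences. -/
theorem precompact_of_liminf_lt_top (hA : Admissible V c a) {K : Set (𝔼 n)} (hK : IsCompact K)
    {P : ℝ → InvariantProb (𝔼 n)} {x : ℝ → 𝔼 n} (hx : ∀ T, x T ∈ K)
    (h : liminf (fun T : ℝ => contractedRate V c a (x T) T (P T) / ENNReal.ofReal T) atTop < ⊤) :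
    ∃ τ : ℕ → ℝ, Tendsto τ atTop atTop ∧ IsCompact (closure (range fun k => P (τ k))) := by
  obtain ⟨M, hM1, hM2⟩ := exists_between h
  obtain ⟨T, hT, X, hT1, hTlim, hXP, hX0, hXM⟩ := exists_seq_of_liminf_lt hM1
  obtain ⟨φ, μ, hφ, -, hlim⟩ := exists_subseq_tendsto hA hK hT1 hTlim hT X
    (fun k => by rw [hX0]; exact hx _) (M := M.toReal) ENNReal.toReal_nonneg (fun k => by
      rw [ENNReal.ofReal_mul ENNReal.toReal_nonneg, ENNReal.ofReal_toReal hM2.ne]; exact hXM k)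
  simp only [hXP] at hlim
  refine ⟨T ∘ φ, hTlim.comp hφ.tendsto_atTop, ?_⟩
  have hlim' : Tendsto (fun k => P ((T ∘ φ) k)) atTop
      (𝓝 ⟨_, invariant_of_tendsto (Q := fun k => P (T (φ k))) hlim⟩) :=
    tendsto_subtype_rng.2 hlim
  exact hlim'.isCompact_insert_range.closure_of_subset (subset_insert _ _)

/-- Tonelli: unit windows starting before `T - 1` count the Lagrangian of each instant at most once
in total. Later windows leave `[0, T]`, where only the truncation bounds their action; the resulting
`N` disappears after division by a large `T`. -/
theorem lintegral_min_windowLaw_le (hA : Admissible V c a) {T : ℝ} (hT : 0 < T)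
    (X : C(Icc (0 : ℝ) T, 𝔼 n)) (N : ℝ≥0∞) :
    ∫⁻ w, min (fwAction V c a 1 w) N ∂(windowLaw hT X : Measure C(ℝ, 𝔼 n)) ≤
      (ENNReal.ofReal T)⁻¹ * (fwAction V c a T (extendPath hT X) + N) := by
  set Y := extendPath hT X with hY
  have hmeas : Measurable fun w : C(ℝ, 𝔼 n) => min (fwAction V c a 1 w) N :=
    (lowerSemicontinuous_fwAction hA zero_le_one).measurable.min measurable_const
  by_cases htop : fwAction V c a T Y = ⊤
  · rw [htop, top_add, ENNReal.mul_top (by simp)]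
    exact le_top
  have hH := isH1_of_fwAction_ne_top hT.le htop
  refine (lintegral_averageLaw hT _ hmeas).trans_le (mul_le_mul_right ?_ _)
  set g : ℝ → ℝ≥0∞ := (Ioo 0 T).indicator fun u =>
    4⁻¹ * ENNReal.ofReal (lagrangian V c a (Y u) (deriv Y u)) with hg
  have hgm : Measurable g := by
    refine Measurable.indicator (Measurable.const_mul ?_ _) measurableSet_Ioo
    exact (hA.continuous_lagrangian.measurable.comp
      (Y.continuous.measurable.prodMk (measurable_deriv Y))).ennreal_ofReal
  have hsub : Ioc 0 T ⊆ Ioc 0 (T - 1) ∪ Ioc (T - 1) T := fun t ht => by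
    by_cases hc : t ≤ T - 1
    · exact Or.inl ⟨ht.1, hc⟩
    · exact Or.inr ⟨not_le.1 hc, ht.2⟩
  refine (lintegral_mono_set hsub).trans ((lintegral_union_le _ _ _).trans (add_le_add ?_ ?_))
  · calc ∫⁻ t in Ioc 0 (T - 1), min (fwAction V c a 1 (advance t Y)) N
        ≤ ∫⁻ t in Ioc 0 (T - 1), ∫⁻ s in Ioo (0 : ℝ) 1, g (s + t) := by
          refine setLIntegral_mono' measurableSet_Ioc fun t ht => (min_le_left _ _).trans ?_
          have h1 := hH.fwAction_window (V := V) (c := c) (a := a) (S := 1) (s := t) ht.1.le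
            zero_le_one (by linarith [ht.2])
          refine (le_of_eq h1).trans ?_
          rw [setLIntegral_Ioo_comp_add, ← lintegral_const_mul' _ _ (by simp)]
          refine setLIntegral_mono' measurableSet_Ioo fun u hu => ?_
          have : u ∈ Ioo 0 T := ⟨ht.1.trans hu.1, by linarith [hu.2, ht.2]⟩
          rw [hg, indicator_of_mem this]
      _ ≤ ∫⁻ t, ∫⁻ s in Ioo (0 : ℝ) 1, g (s + t) := setLIntegral_le_lintegral _ _
      _ = ∫⁻ s in Ioo (0 : ℝ) 1, ∫⁻ t, g (s + t) := lintegral_lintegral_swap (by fun_prop)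
      _ = ∫⁻ t, g t := by
          have : ∀ s : ℝ, ∫⁻ t, g (s + t) = ∫⁻ t, g t := fun s => lintegral_add_left_eq_self g s
          simp [this]
      _ = fwAction V c a T Y := by
          rw [hg, lintegral_indicator measurableSet_Ioo, hH.fwAction_eq hT.le,
            lintegral_const_mul' _ _ (by simp)]
  · calc ∫⁻ t in Ioc (T - 1) T, min (fwAction V c a 1 (advance t Y)) N
        ≤ ∫⁻ _ in Ioc (T - 1) T, N := lintegral_mono fun _ => min_le_right _ _
      _ = N := by simp

/-- The liminf inequality. -/
theorem rate_le_liminf (hA : Admissible V c a) {K : Set (𝔼 n)} (hK : IsCompact K)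
    {P : InvariantProb (𝔼 n)} {x : ℝ → 𝔼 n} {Q : ℝ → InvariantProb (𝔼 n)} (hx : ∀ T, x T ∈ K)
    (hQ : Tendsto Q atTop (𝓝 P)) :
    rate V c a P ≤
      liminf (fun T : ℝ => contractedRate V c a (x T) T (Q T) / ENNReal.ofReal T) atTop := by
  refine le_of_forall_gt_imp_ge_of_dense fun M hM => ?_
  by_cases hMt : M = ⊤
  · rw [hMt]; exact le_top
  obtain ⟨T, hT, X, hT1, hTlim, hXP, hX0, hXM⟩ := exists_seq_of_liminf_lt hM
  obtain ⟨φ, μ, hφ, hwin, hlim⟩ := exists_subseq_tendsto hA hK hT1 hTlim hT X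
    (fun k => by rw [hX0]; exact hx _) (M := M.toReal) ENNReal.toReal_nonneg (fun k => by
      rw [ENNReal.ofReal_mul ENNReal.toReal_nonneg, ENNReal.ofReal_toReal hMt]; exact hXM k)
  simp only [hXP] at hlim
  have hTφ : Tendsto (fun k => T (φ k)) atTop atTop := hTlim.comp hφ.tendsto_atTop
  -- The law on continuous paths produced by compactness must represent `P`, since the empirical
  -- processes also converge to `P`.
  have hP : P.1 = μ.map continuous_ofContinuous.measurable.aemeasurable :=
    tendsto_nhds_unique ((continuous_subtype_val.tendsto P).comp (hQ.comp hTφ)) hlim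
  have hlsc := lowerSemicontinuous_fwAction hA (V := V) (c := c) (a := a) zero_le_one
  -- Truncation serves both the bounded form of lower semicontinuity and the end effect; monotone
  -- convergence in `N` removes it afterwards.
  have hmin : ∀ N : ℕ, ∫⁻ w, min (fwAction V c a 1 w) N ∂(μ : Measure C(ℝ, 𝔼 n)) ≤ M := by
    intro N
    refine (lintegral_le_of_tendsto_of_lowerSemicontinuous hwin (hlsc.inf lowerSemicontinuous_const)
      (ENNReal.natCast_ne_top N) fun _ => min_le_right _ _).trans ?_
    have hev : ∀ k, ∫⁻ w, min (fwAction V c a 1 w) N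
        ∂(windowLaw (hT (φ k)) (X (φ k)) : Measure C(ℝ, 𝔼 n)) ≤
        M + (ENNReal.ofReal (T (φ k)))⁻¹ * N := fun k => by
      refine (lintegral_min_windowLaw_le hA (hT (φ k)) (X (φ k)) N).trans ?_
      rw [mul_add]
      refine add_le_add ?_ le_rfl
      refine (mul_le_mul_right (hXM (φ k)) _).trans_eq ?_
      rw [mul_left_comm, ENNReal.inv_mul_cancel (by simpa using hT (φ k)) ENNReal.ofReal_ne_top,
        mul_one]
    have htend : Tendsto (fun k => M + (ENNReal.ofReal (T (φ k)))⁻¹ * (N : ℝ≥0∞)) atTop (𝓝 M) := by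
      have h1 : Tendsto (fun k => (ENNReal.ofReal (T (φ k)))⁻¹) atTop (𝓝 0) :=
        tendsto_inv_iff.1 (by simpa using hTφ)
      have h2 := ENNReal.Tendsto.mul_const (b := (N : ℝ≥0∞)) h1
        (Or.inr (ENNReal.natCast_ne_top N))
      rw [zero_mul] at h2
      simpa using h2.const_add M
    exact (liminf_le_liminf (Eventually.of_forall hev)).trans_eq htend.liminf_eq
  rw [rate, hP, ProbabilityMeasure.toMeasure_map]
  -- This direction of the change of variables holds for every function, measurable or not.
  refine (lintegral_map_le _ _).trans ?_
  have hsup : ∀ w : C(ℝ, 𝔼 n), fwAction V c a 1 (ofContinuous w) =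
      ⨆ N : ℕ, min (fwAction V c a 1 w) N := fun w => by
    rw [ofContinuous_coe]
    refine le_antisymm ?_ (iSup_le fun N => min_le_left _ _)
    refine le_of_forall_lt fun b hb => ?_
    obtain ⟨N, hN⟩ := ENNReal.exists_nat_gt hb.ne_top
    exact lt_of_lt_of_le (lt_min hb hN) (le_iSup (fun N : ℕ => min (fwAction V c a 1 w) N) N)
  simp only [hsup]
  rw [lintegral_iSup (fun N => hlsc.measurable.min measurable_const)
    fun N N' hN w => min_le_min le_rfl (by exact_mod_cast hN)]
  exact iSup_le hmin

end LowerBound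

/-! ### Invariant laws of finite rate and sampling -/

section Support

variable {n : ℕ}

local notation "𝔼" n => EuclideanSpace ℝ (Fin n)

variable {V : (𝔼 n) → ℝ} {c : (𝔼 n) → 𝔼 n} {a : (𝔼 n) → Matrix (Fin n) (Fin n) ℝ}

/-- Paths outside `ucSet` have infinite action on `[0, 1]`, so they form a null set when the rate is
finite. Invariance carries this to all half-integer translates, which together cover the line. -/
theorem ae_continuous_of_rate_ne_top {P : InvariantProb (𝔼 n)} (h : rate V c a P ≠ ⊤) :
    ∀ᵐ X : CadlagPath (𝔼 n) ∂(P.1 : Measure (CadlagPath (𝔼 n))), Continuous (X : ℝ → 𝔼 n) := by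
  set Q : Measure (CadlagPath (𝔼 n)) := (P.1 : Measure (CadlagPath (𝔼 n))) with hQ
  have h0 : Q (ucSet (𝔼 n))ᶜ = 0 := by
    by_contra hne
    refine h (top_le_iff.1 ?_)
    calc (⊤ : ℝ≥0∞) = ⊤ * Q (ucSet (𝔼 n))ᶜ := (ENNReal.top_mul hne).symm
      _ = ∫⁻ X, (ucSet (𝔼 n))ᶜ.indicator (fun _ => ⊤) X ∂Q :=
          (lintegral_indicator_const measurableSet_ucSet.compl ⊤).symm
      _ ≤ rate V c a P := lintegral_mono fun X => by
          by_cases hX : X ∈ ucSet (𝔼 n)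
          · rw [indicator_of_notMem (by simpa using hX)]; exact zero_le
          · have : fwAction V c a 1 X = ⊤ := by
              by_contra hc
              exact hX (mem_ucSet_of_continuousOn
                ((isH1_of_fwAction_ne_top zero_le_one hc).continuousOn zero_le_one))
            rw [this]; exact le_top
  have h1 : ∀ᵐ X ∂Q, ∀ j : ℤ, shift (-((j : ℝ) / 2)) X ∈ ucSet (𝔼 n) := by
    refine ae_all_iff.2 fun j => ?_
    exact (P.2 (-((j : ℝ) / 2))).quasiMeasurePreserving.ae (p := fun X => X ∈ ucSet (𝔼 n)) h0
  filter_upwards [h1] with X hX using continuous_of_forall_shift_mem_ucSet hX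

/-- An invariant law of finite rate is carried by the continuous paths. -/
theorem exists_law_of_rate_ne_top {P : InvariantProb (𝔼 n)} (h : rate V c a P ≠ ⊤) :
    ∃ μ : ProbabilityMeasure C(ℝ, 𝔼 n),
      μ.map continuous_ofContinuous.measurable.aemeasurable = P.1 ∧
      (∀ t, MeasurePreserving (advance t) (μ : Measure C(ℝ, 𝔼 n)) (μ : Measure C(ℝ, 𝔼 n))) ∧
      ∫⁻ w, fwAction V c a 1 w ∂(μ : Measure C(ℝ, 𝔼 n)) = rate V c a P := by
  set Q : Measure (CadlagPath (𝔼 n)) := (P.1 : Measure (CadlagPath (𝔼 n))) with hQ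
  have he : MeasurableEmbedding (ofContinuous : C(ℝ, 𝔼 n) → CadlagPath (𝔼 n)) :=
    measurableEmbedding_ofContinuous
  have hr : ∀ᵐ X ∂Q, X ∈ range (ofContinuous : C(ℝ, 𝔼 n) → CadlagPath (𝔼 n)) := by
    filter_upwards [ae_continuous_of_rate_ne_top h] with X hX
    exact ⟨⟨X, hX⟩, rfl⟩
  have hmap : (Q.comap ofContinuous).map ofContinuous = Q := by
    rw [he.map_comap, Measure.restrict_eq_self_of_ae_mem hr]
  have hprob : IsProbabilityMeasure (Q.comap (ofContinuous : C(ℝ, 𝔼 n) → CadlagPath (𝔼 n))) := by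
    constructor
    rw [he.comap_apply, image_univ]
    exact (prob_compl_eq_zero_iff he.measurableSet_range).1 hr
  refine ⟨⟨Q.comap ofContinuous, hprob⟩, Subtype.ext hmap, fun t => ?_, ?_⟩
  · refine ⟨(continuous_advance t).measurable, ?_⟩
    have h1 : ((Q.comap ofContinuous).map (advance t)).map
        (ofContinuous : C(ℝ, 𝔼 n) → CadlagPath (𝔼 n)) = (Q.comap ofContinuous).map ofContinuous := by
      have h2 : (ofContinuous : C(ℝ, 𝔼 n) → CadlagPath (𝔼 n)) ∘ advance t =
          shift (-t) ∘ ofContinuous := funext fun w => ofContinuous_advance t w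
      rw [Measure.map_map he.measurable (continuous_advance t).measurable, h2,
        ← Measure.map_map (continuous_shift (-t)).measurable he.measurable, hmap]
      exact (P.2 (-t)).map_eq
    have h3 := congrArg (Measure.comap (ofContinuous : C(ℝ, 𝔼 n) → CadlagPath (𝔼 n))) h1
    rwa [he.comap_map, he.comap_map] at h3
  · have h5 := he.lintegral_map (μ := Q.comap ofContinuous)
      (fun X : CadlagPath (𝔼 n) => fwAction V c a 1 X)
    rw [hmap] at h5
    exact h5.symm

end Support

/-- Almost every i.i.d. sample realises the means of countably many integrable functions. -/
theorem exists_seq_tendsto_average {S : Type*} [MeasurableSpace S] (ν : Measure S)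
    [IsProbabilityMeasure ν] {J : Type*} [Countable J] {f : J → S → ℝ}
    (hfm : ∀ j, Measurable (f j)) (hf : ∀ j, Integrable (f j) ν) {A : Set S} (hA : ∀ᵐ x ∂ν, x ∈ A) :
    ∃ w : ℕ → S, (∀ i, w i ∈ A) ∧ ∀ j, Tendsto
      (fun k : ℕ => (∑ i ∈ Finset.range k, f j (w i)) / k) atTop (𝓝 (∫ x, f j x ∂ν)) := by
  obtain ⟨Ω, _, P, X, hXm, hXl, hXi, hP⟩ := ProbabilityTheory.exists_iid ℕ ν
  have h1 : ∀ᵐ ω ∂P, ∀ i, X i ω ∈ A := ae_all_iff.2 fun i => by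
    have := (hXl i).map_eq ▸ hA
    exact ae_of_ae_map (hXm i).aemeasurable this
  have h2 : ∀ᵐ ω ∂P, ∀ j, Tendsto (fun k : ℕ => (∑ i ∈ Finset.range k, f j (X i ω)) / k) atTop
      (𝓝 (∫ x, f j x ∂ν)) := by
    refine ae_all_iff.2 fun j => ?_
    have hmean : ∫ ω, f j (X 0 ω) ∂P = ∫ x, f j x ∂ν := by
      rw [← (hXl 0).map_eq, integral_map (hXm 0).aemeasurable (hfm j).aestronglyMeasurable]
    have hint : Integrable (fun ω => f j (X 0 ω)) P := by
      have := (hXl 0).map_eq ▸ hf j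
      exact this.comp_measurable (hXm 0)
    have := ProbabilityTheory.strong_law_ae_real (μ := P) (fun i ω => f j (X i ω)) hint
      (fun i k hik => (hXi.indepFun hik).comp (hfm j) (hfm j))
      (fun i => by
        have hd : ProbabilityTheory.IdentDistrib (X i) (X 0) P P :=
          ⟨(hXm i).aemeasurable, (hXm 0).aemeasurable, by rw [(hXl i).map_eq, (hXl 0).map_eq]⟩
        exact hd.comp (hfm j))
    simpa only [hmean] using this
  obtain ⟨ω, hω1, hω2⟩ := (h1.and h2).exists
  exact ⟨fun i => X i ω, hω1, hω2⟩

/-! ### Concatenation of path segments -/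

section Block

variable {E : Type*} [MetricSpace E]

/-- The index of the cell of length `N + 1` that contains `t`. -/
def cellIndex (N : ℕ) (t : ℝ) : ℕ := ⌊t / ((N : ℝ) + 1)⌋₊

/-- The member of the family `w` that is followed at time `t`, seen from time `t`. -/
def blockWindow (N : ℕ) (w : ℕ → C(ℝ, E)) (t : ℝ) : C(ℝ, E) :=
  advance (t - cellIndex N t * ((N : ℝ) + 1) - 1) (w (cellIndex N t))

theorem measurable_cellIndex (N : ℕ) : Measurable (cellIndex N) :=
  Nat.measurable_floor.comp (measurable_id.div_const _)

theorem measurable_blockWindow (N : ℕ) (w : ℕ → C(ℝ, E)) : Measurable (blockWindow N w) := by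
  have h : Measurable fun p : ℕ × ℝ => advance (p.2 - p.1 * ((N : ℝ) + 1) - 1) (w p.1) :=
    measurable_from_prod_countable_right fun i =>
      ((continuous_advance_left (w i)).comp (by fun_prop)).measurable
  exact h.comp ((measurable_cellIndex N).prodMk measurable_id)

theorem cellIndex_add {N : ℕ} (i : ℕ) {s : ℝ} (hs : s ∈ Ico 0 ((N : ℝ) + 1)) :
    cellIndex N (s + i * ((N : ℝ) + 1)) = i := by
  have hL : (0 : ℝ) < N + 1 := by positivity
  rw [cellIndex, add_div, mul_div_cancel_right₀ _ hL.ne', Nat.floor_add_natCast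
    (div_nonneg hs.1 hL.le), Nat.floor_eq_zero.2 ((div_lt_one hL).2 hs.2), zero_add]

theorem sub_cellIndex_mem (N : ℕ) {t : ℝ} (ht : 0 ≤ t) :
    t - cellIndex N t * ((N : ℝ) + 1) ∈ Ico 0 ((N : ℝ) + 1) := by
  have hL : (0 : ℝ) < N + 1 := by positivity
  have h1 := Nat.floor_le (div_nonneg ht hL.le)
  have h2 := Nat.lt_floor_add_one (t / ((N : ℝ) + 1))
  rw [le_div_iff₀ hL] at h1
  rw [div_lt_iff₀ hL] at h2
  exact ⟨by rw [cellIndex]; linarith, by rw [cellIndex]; linarith⟩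

/-- The first unit of each cell is reserved for the link, so time `s` of the cell is time `s - 1` of
`w i`. During the link the block window still follows `w i`, at negative times, which keeps its
averages exactly stationary. -/
theorem blockWindow_add {N : ℕ} (w : ℕ → C(ℝ, E)) (i : ℕ) {s : ℝ} (hs : s ∈ Ico 0 ((N : ℝ) + 1)) :
    blockWindow N w (s + i * ((N : ℝ) + 1)) = advance (s - 1) (w i) := by
  rw [blockWindow, cellIndex_add i hs, add_sub_cancel_right]

theorem intervalIntegral_blockWindow (N : ℕ) (w : ℕ → C(ℝ, E)) 
    (f : BoundedContinuousFunction C(ℝ, E) ℝ) (k : ℕ) :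
    ∫ t in (0 : ℝ)..k * ((N : ℝ) + 1), f (blockWindow N w t) =
      ∑ i ∈ Finset.range k, ∫ s in (0 : ℝ)..((N : ℝ) + 1), f (advance (s - 1) (w i)) := by
  set L : ℝ := (N : ℝ) + 1 with hLdef
  have hL : 0 < L := by positivity
  have hint : ∀ p q, IntervalIntegrable (fun t => f (blockWindow N w t)) volume p q := fun p q => by
    rw [intervalIntegrable_iff]
    refine Measure.integrableOn_of_bounded (M := ‖f‖) (by simp)
      (f.continuous.measurable.comp (measurable_blockWindow N w)).aestronglyMeasurable
      (Eventually.of_forall fun t => f.norm_coe_le_norm _)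
  have h := intervalIntegral.sum_integral_adjacent_intervals (n := k) (a := fun i : ℕ => (i : ℝ) * L)
    (f := fun t => f (blockWindow N w t)) (μ := volume) fun i _ => hint _ _
  simp only [Nat.cast_zero, zero_mul] at h
  rw [← h]
  refine Finset.sum_congr rfl fun i _ => ?_
  have e := intervalIntegral.integral_comp_add_right (a := 0) (b := L)
    (fun t => f (blockWindow N w t)) ((i : ℝ) * L)
  rw [zero_add, show L + i * L = ((i + 1 : ℕ) : ℝ) * L by push_cast; ring] at e
  rw [← e]
  refine intervalIntegral.integral_congr_ae ?_
  -- At `s = L` the cell index has already moved to the next cell; this single time is negligible.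
  filter_upwards [measure_eq_zero_iff_ae_notMem.1 (Real.volume_singleton (a := L))] with s hs hs'
  rw [uIoc_of_le hL.le] at hs'
  rw [hLdef, blockWindow_add w i ⟨hs'.1.le, lt_of_le_of_ne hs'.2 hs⟩]

end Block

section Concat

variable {E : Type*} [NormedAddCommGroup E] [NormedSpace ℝ E]

/-- The path that goes from `z` to `w 0` at constant speed in unit time and then follows `w`. -/
def cell (z : E) (w : C(ℝ, E)) (s : ℝ) : E := if s ≤ 1 then z + s • (w 0 - z) else w (s - 1)

theorem cell_of_one_le (z : E) (w : C(ℝ, E)) {s : ℝ} (hs : 1 ≤ s) : cell z w s = w (s - 1) := by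
  rcases hs.eq_or_lt with rfl | hs
  · simp [cell]
  · rw [cell, if_neg (not_le.2 hs)]

/-- The point where the `i`-th cell of a concatenation starts. -/
def startPoint (N : ℕ) (x : E) (w : ℕ → C(ℝ, E)) : ℕ → E
  | 0 => x
  | i + 1 => w i N

/-- The path from `x` that follows `w 0`, `w 1`, … for time `N` each, linked by segments run through
in unit time. -/
def concat (N : ℕ) (x : E) (w : ℕ → C(ℝ, E)) (t : ℝ) : E :=
  cell (startPoint N x w (cellIndex N t)) (w (cellIndex N t)) (t - cellIndex N t * ((N : ℝ) + 1))

/-- The right endpoint is included because cell `i` ends at `w i N`, the point where the next link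
starts. The closed interval is what allows actions of consecutive cells to be added. -/
theorem concat_add {N : ℕ} (x : E) (w : ℕ → C(ℝ, E)) (i : ℕ) {s : ℝ}
    (hs : s ∈ Icc 0 ((N : ℝ) + 1)) :
    concat N x w (s + i * ((N : ℝ) + 1)) = cell (startPoint N x w i) (w i) s := by
  rcases hs.2.eq_or_lt with rfl | hlt
  · have h := cellIndex_add (N := N) (i + 1) (s := 0) ⟨le_rfl, by positivity⟩
    have e : (N : ℝ) + 1 + i * ((N : ℝ) + 1) = 0 + ((i + 1 : ℕ) : ℝ) * ((N : ℝ) + 1) := by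
      push_cast; ring
    rw [cell_of_one_le _ (w i) (by simp), e, concat, h]
    simp [cell, startPoint]
  · rw [concat, cellIndex_add i ⟨hs.1, hlt⟩, add_sub_cancel_right]

theorem concat_zero (N : ℕ) (x : E) (w : ℕ → C(ℝ, E)) : concat N x w 0 = x := by
  simp [concat, cellIndex, cell, startPoint]

/-- Away from the links, the concatenation seen from time `t` is the block window. -/
theorem exists_bad_set (N m : ℕ) (x : E) (w : ℕ → C(ℝ, E)) {T : ℝ} (hT : 0 < T) :
    ∃ B : Set ℝ, MeasurableSet B ∧
      volume B ≤ ENNReal.ofReal ((T / ((N : ℝ) + 1) + 1) * (2 * m + 1) + m) ∧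
      ∀ t ∈ Ioc 0 T \ B, ∀ s ∈ Icc (-(m : ℝ)) m,
        s + t ∈ Ico 0 T ∧ blockWindow N w t s = concat N x w (s + t) := by
  set L : ℝ := (N : ℝ) + 1 with hLdef
  have hL : 0 < L := by positivity
  -- In a cell, a window of radius `m` misses the link and the neighbouring cells unless its centre
  -- is within `1 + m` of the start or within `m` of the end.
  let G : ℕ → Set ℝ := fun i => Icc (i * L) (i * L + (1 + m)) ∪ Icc ((i + 1) * L - m) ((i + 1) * L)
  have hG : ∀ i, volume (G i) ≤ ENNReal.ofReal (2 * m + 1) := fun i => by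
    refine (measure_union_le _ _).trans_eq ?_
    rw [Real.volume_Icc, Real.volume_Icc, ← ENNReal.ofReal_add (by simp; positivity) (by simp)]
    congr 1
    ring
  refine ⟨(⋃ i ∈ Finset.range (⌊T / L⌋₊ + 1), G i) ∪ Icc (T - m) T,
    (Finset.measurableSet_biUnion _ fun i _ => measurableSet_Icc.union measurableSet_Icc).union
      measurableSet_Icc, ?_, ?_⟩
  · have h1 : volume (⋃ i ∈ Finset.range (⌊T / L⌋₊ + 1), G i) ≤
        ENNReal.ofReal ((T / L + 1) * (2 * m + 1)) := by
      refine (measure_biUnion_finset_le _ _).trans ((Finset.sum_le_sum fun i _ => hG i).trans ?_)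
      rw [Finset.sum_const, Finset.card_range, nsmul_eq_mul, ENNReal.ofReal_mul (by positivity),
        ← ENNReal.ofReal_natCast]
      gcongr
      push_cast
      gcongr
      exact Nat.floor_le (by positivity)
    refine (measure_union_le _ _).trans ((add_le_add h1 le_rfl).trans_eq ?_)
    rw [Real.volume_Icc, sub_sub_cancel, ← ENNReal.ofReal_add (by positivity) (by positivity)]
  · rintro t ⟨ht, hB⟩ s hs
    simp only [mem_union, mem_iUnion, not_or, not_exists] at hB
    have hTm : t < T - m := by
      by_contra hc
      exact hB.2 ⟨not_lt.1 hc, ht.2⟩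
    set i := cellIndex N t with hi
    have hik : i ∈ Finset.range (⌊T / L⌋₊ + 1) := by
      rw [Finset.mem_range, Nat.lt_succ_iff]
      exact Nat.floor_mono (by gcongr; exact ht.2)
    have hr := sub_cellIndex_mem N ht.1.le
    rw [← hi, ← hLdef] at hr
    have hg := hB.1 i hik
    simp only [G, mem_union, mem_Icc, not_or, not_and, not_le] at hg
    have hr1 : 1 + m < t - i * L := by linarith [hg.1 (by linarith [hr.1])]
    have hr2 : t - i * L < L - m := by
      by_contra hc
      have h5 := hg.2 (by linarith)
      linarith [hr.2]
    refine ⟨⟨?_, by linarith [hs.2]⟩, ?_⟩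
    · have : (0 : ℝ) ≤ i * L := by positivity
      linarith [hs.1]
    · have e : s + t = (s + (t - i * L)) + i * L := by ring
      rw [e, concat_add x w i ⟨by linarith [hs.1], by linarith [hs.2]⟩,
        cell_of_one_le _ _ (by linarith [hs.1]), blockWindow, ← hi, ← hLdef, advance_apply]
      congr 1
      ring

end Concat

section ConcatAction

variable {n : ℕ}

local notation "𝔼" n => EuclideanSpace ℝ (Fin n)

variable {V : (𝔼 n) → ℝ} {c : (𝔼 n) → 𝔼 n} {a : (𝔼 n) → Matrix (Fin n) (Fin n) ℝ}

theorem fwAction_cell_le (N : ℕ) (z : 𝔼 n) (w : C(ℝ, 𝔼 n)) :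
    fwAction V c a ((N : ℝ) + 1) (cell z w) ≤
      fwAction V c a 1 (fun t => z + t • (w 0 - z)) + fwAction V c a N w := by
  refine (fwAction_add_le zero_le_one N.cast_nonneg _).trans (add_le_add (le_of_eq ?_) (le_of_eq ?_))
  · exact fwAction_congr zero_le_one fun t ht => if_pos ht.2
  · refine fwAction_congr N.cast_nonneg fun t ht => ?_
    simp only [cell_of_one_le z w (le_add_of_nonneg_left ht.1), add_sub_cancel_right]

theorem fwAction_zero (X : ℝ → 𝔼 n) : fwAction V c a 0 X = 0 := by
  have h : IsH1 0 X 0 := ⟨MemLp.zero, fun t ht => by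
    rw [Icc_self, mem_singleton_iff] at ht
    simp [ht]⟩
  rw [h.fwAction_eq le_rfl]
  simp

theorem fwAction_concat_le (N : ℕ) (x : 𝔼 n) (w : ℕ → C(ℝ, 𝔼 n)) (k : ℕ) :
    fwAction V c a (k * ((N : ℝ) + 1)) (concat N x w) ≤ ∑ i ∈ Finset.range k,
      (fwAction V c a 1 (fun t => startPoint N x w i + t • (w i 0 - startPoint N x w i)) +
        fwAction V c a N (w i)) := by
  induction k with
  | zero => simp [fwAction_zero]
  | succ k ih =>
    have e : ((k + 1 : ℕ) : ℝ) * ((N : ℝ) + 1) = ((N : ℝ) + 1) + k * ((N : ℝ) + 1) := by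
      push_cast; ring
    rw [e, Finset.sum_range_succ]
    refine (fwAction_add_le (by positivity) (by positivity) _).trans (add_le_add ih ?_)
    refine le_trans (le_of_eq ?_) (fwAction_cell_le N (startPoint N x w k) (w k))
    exact fwAction_congr (by positivity) fun s hs => concat_add x w k hs

end ConcatAction

/-! ### Approximation of invariant laws by block averages -/

/-- Weak neighbourhoods are controlled by finitely many bounded continuous functions. -/
theorem exists_finite_test {Ω : Type*} [MeasurableSpace Ω] [TopologicalSpace Ω]
    [OpensMeasurableSpace Ω] {μ : ProbabilityMeasure Ω} {U : Set (ProbabilityMeasure Ω)}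
    (hU : U ∈ 𝓝 μ) : ∃ I : Set (BoundedContinuousFunction Ω ℝ), I.Finite ∧ ∃ δ : ℝ, 0 < δ ∧
      ∀ ν : ProbabilityMeasure Ω,
        (∀ f ∈ I, |∫ x, f x ∂(ν : Measure Ω) - ∫ x, f x ∂(μ : Measure Ω)| < δ) → ν ∈ U := by
  -- `l` is the filter induced by the convergence of all test integrals to those of `μ`. It is
  -- contained in every neighbourhood filter statement at `μ` through `l ≤ 𝓝 μ`, and the basis of an
  -- infimum involves finitely many tests.
  set l : Filter (ProbabilityMeasure Ω) := ⨅ f : BoundedContinuousFunction Ω ℝ,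
    comap (fun ν : ProbabilityMeasure Ω => ∫ x, f x ∂(ν : Measure Ω)) (𝓝 (∫ x, f x ∂(μ : Measure Ω)))
    with hl
  have hid : Tendsto (fun ν : ProbabilityMeasure Ω => ν) l (𝓝 μ) :=
    ProbabilityMeasure.tendsto_iff_forall_integral_tendsto.2 fun f =>
      tendsto_comap.mono_left (iInf_le _ f)
  have hb := HasBasis.iInf' fun f : BoundedContinuousFunction Ω ℝ =>
    (Metric.nhds_basis_ball (x := ∫ x, f x ∂(μ : Measure Ω))).comap
      (fun ν : ProbabilityMeasure Ω => ∫ x, f x ∂(ν : Measure Ω))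
  obtain ⟨⟨I, r⟩, ⟨hI, hr⟩, hsub⟩ := hb.mem_iff.1 (hid hU)
  have hδ : ∀ᶠ δ : ℝ in 𝓝[>] 0, ∀ f ∈ I, δ < r f :=
    hI.eventually_all.2 fun f hf => nhdsWithin_le_nhds (eventually_lt_nhds (hr f hf))
  obtain ⟨δ, hδ, hδ0⟩ := (hδ.and self_mem_nhdsWithin).exists
  refine ⟨I, hI, δ, hδ0, fun ν hν => hsub ?_⟩
  simp only [mem_iInter, mem_preimage, Metric.mem_ball, Real.dist_eq]
  exact fun f hf => (hν f hf).trans (hδ f hf)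

/-- The difference is `μ(Aᶜ)` times the conditional mean, minus the integral over `Aᶜ`; each is at
most `C μ(Aᶜ)`. -/
theorem abs_integral_cond_sub_le {Ω : Type*} [MeasurableSpace Ω] {μ : Measure Ω}
    [IsProbabilityMeasure μ] {A : Set Ω} (hA : MeasurableSet A) (hA0 : μ A ≠ 0) {g : Ω → ℝ} {C : ℝ}
    (hg : Measurable g) (hC : ∀ x, |g x| ≤ C) :
    |∫ x, g x ∂(ProbabilityTheory.cond μ A) - ∫ x, g x ∂μ| ≤ 2 * C * μ.real Aᶜ := by
  have := ProbabilityTheory.cond_isProbabilityMeasure hA0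
  have hi : Integrable g μ := Integrable.of_bound hg.aestronglyMeasurable C
    (Eventually.of_forall hC)
  have hp : μ.real A ≠ 0 := (ENNReal.toReal_ne_zero.2 ⟨hA0, measure_ne_top _ _⟩)
  have h1 : ∫ x in A, g x ∂μ = μ.real A * ∫ x, g x ∂(ProbabilityTheory.cond μ A) := by
    rw [ProbabilityTheory.cond, integral_smul_measure, ENNReal.toReal_inv, smul_eq_mul,
      ← measureReal_def, mul_inv_cancel_left₀ hp]
  have h2 := integral_add_compl hA hi
  have h3 : |∫ x in Aᶜ, g x ∂μ| ≤ C * μ.real Aᶜ := by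
    rw [← Real.norm_eq_abs]
    exact norm_setIntegral_le_of_norm_le_const (measure_lt_top _ _) fun x _ => hC x
  have h4 : |∫ x, g x ∂(ProbabilityTheory.cond μ A)| ≤ C := by
    have := norm_integral_le_of_norm_le_const (μ := ProbabilityTheory.cond μ A) (f := g) (C := C)
      (Eventually.of_forall hC)
    simpa using this
  have h5 : μ.real Aᶜ = 1 - μ.real A := probReal_compl_eq_one_sub hA
  have h6 : ∫ x, g x ∂(ProbabilityTheory.cond μ A) - ∫ x, g x ∂μ =
      μ.real Aᶜ * (∫ x, g x ∂(ProbabilityTheory.cond μ A)) - ∫ x in Aᶜ, g x ∂μ := by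
    rw [← h2, h1, h5]; ring
  rw [h6]
  refine (abs_sub _ _).trans ?_
  rw [abs_mul, abs_of_nonneg measureReal_nonneg]
  nlinarith [measureReal_nonneg (μ := μ) (s := Aᶜ)]

theorem lintegral_cond_le {Ω : Type*} [MeasurableSpace Ω] (μ : Measure Ω) (A : Set Ω)
    (h : Ω → ℝ≥0∞) : ∫⁻ x, h x ∂(ProbabilityTheory.cond μ A) ≤ (μ A)⁻¹ * ∫⁻ x, h x ∂μ := by
  rw [ProbabilityTheory.cond, lintegral_smul_measure, smul_eq_mul]
  gcongr
  exact Measure.restrict_le_self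

theorem tendsto_floor_div_atTop {L : ℝ} (hL : 0 < L) :
    Tendsto (fun T : ℝ => (⌊T / L⌋₊ : ℝ) / T) atTop (𝓝 L⁻¹) := by
  have := tendsto_nat_floor_mul_div_atTop (inv_nonneg.2 hL.le)
  refine this.congr fun T => ?_
  rw [inv_mul_eq_div]

theorem tendsto_floor_atTop {L : ℝ} (hL : 0 < L) :
    Tendsto (fun T : ℝ => ⌊T / L⌋₊) atTop atTop :=
  tendsto_nat_floor_atTop.comp (tendsto_id.atTop_div_const hL)

/-- Discrete averages along the cells determine the continuous time averages. -/
theorem tendsto_sum_floor_div {u : ℕ → ℝ} {G L : ℝ} (hL : 0 < L)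
    (hu : Tendsto (fun k : ℕ => (∑ i ∈ Finset.range k, u i) / k) atTop (𝓝 G)) (r : ℕ) :
    Tendsto (fun T : ℝ => (∑ i ∈ Finset.range (⌊T / L⌋₊ + r), u i) / T) atTop (𝓝 (G / L)) := by
  have h1 : Tendsto (fun T : ℝ => ⌊T / L⌋₊ + r) atTop atTop :=
    tendsto_atTop_mono (fun T => Nat.le_add_right _ r) (tendsto_floor_atTop hL)
  have h2 : Tendsto (fun T : ℝ => ((⌊T / L⌋₊ + r : ℕ) : ℝ) / T) atTop (𝓝 L⁻¹) := by
    have := (tendsto_floor_div_atTop hL).add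
      ((tendsto_const_nhds (x := (r : ℝ))).div_atTop (tendsto_id (α := ℝ) (x := atTop)))
    rw [add_zero] at this
    refine this.congr fun T => ?_
    push_cast
    rw [add_div]
    rfl
  have h3 := (hu.comp h1).mul h2
  rw [← div_eq_mul_inv] at h3
  refine h3.congr' ?_
  filter_upwards [h1.eventually_gt_atTop 0] with T hT
  have : ((⌊T / L⌋₊ + r : ℕ) : ℝ) ≠ 0 := by exact_mod_cast hT.ne'
  simp only [Function.comp_apply]
  rw [div_mul_div_comm, mul_comm, mul_div_mul_left _ _ this]

section Sampling

variable {E : Type*} [MetricSpace E]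

/-- The integral of `f` over the cell that follows `w`. -/
def cellIntegral (N : ℕ) (f : BoundedContinuousFunction C(ℝ, E) ℝ) (w : C(ℝ, E)) : ℝ :=
  ∫ s in (0 : ℝ)..((N : ℝ) + 1), f (advance (s - 1) w)

theorem measurable_uncurry_cell (f : BoundedContinuousFunction C(ℝ, E) ℝ) :
    Measurable fun p : ℝ × C(ℝ, E) => f (advance (p.1 - 1) p.2) := by
  refine (f.continuous.comp ?_).measurable
  exact continuous_advance_uncurry.comp
    (f := fun p : ℝ × C(ℝ, E) => ((p.1 - 1, p.2) : ℝ × C(ℝ, E))) (by fun_prop)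

theorem measurable_cellIntegral (N : ℕ) (f : BoundedContinuousFunction C(ℝ, E) ℝ) :
    Measurable (cellIntegral N f) := by
  have hN : (0 : ℝ) ≤ N + 1 := by positivity
  have e : cellIntegral N f = fun w => ∫ s in Ioc (0 : ℝ) (N + 1), f (advance (s - 1) w) :=
    funext fun w => intervalIntegral.integral_of_le hN
  rw [e]
  exact (StronglyMeasurable.integral_prod_left (μ := volume.restrict (Ioc (0 : ℝ) (N + 1)))
    (f := fun (s : ℝ) (w : C(ℝ, E)) => f (advance (s - 1) w))
    (measurable_uncurry_cell f).stronglyMeasurable).measurable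

theorem abs_cellIntegral_le (N : ℕ) (f : BoundedContinuousFunction C(ℝ, E) ℝ) (w : C(ℝ, E)) :
    |cellIntegral N f w| ≤ ‖f‖ * ((N : ℝ) + 1) := by
  have := intervalIntegral.norm_integral_le_of_norm_le_const (a := 0) (b := (N : ℝ) + 1) (C := ‖f‖)
    (f := fun s => f (advance (s - 1) w)) fun s _ => f.norm_coe_le_norm _
  rwa [sub_zero, abs_of_nonneg (by positivity)] at this

theorem integral_cellIntegral {μ : Measure C(ℝ, E)} [IsProbabilityMeasure μ]
    (hμ : ∀ t, MeasurePreserving (advance t) μ μ) (N : ℕ)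
    (f : BoundedContinuousFunction C(ℝ, E) ℝ) :
    ∫ w, cellIntegral N f w ∂μ = ((N : ℝ) + 1) * ∫ w, f w ∂μ := by
  have hN : (0 : ℝ) ≤ N + 1 := by positivity
  simp only [cellIntegral, intervalIntegral.integral_of_le hN]
  rw [← integral_integral_swap (f := fun (s : ℝ) (w : C(ℝ, E)) => f (advance (s - 1) w))
    (Integrable.of_bound (measurable_uncurry_cell f).aestronglyMeasurable ‖f‖
      (Eventually.of_forall fun p => f.norm_coe_le_norm _))]
  have h : ∀ s : ℝ, ∫ w, f (advance (s - 1) w) ∂μ = ∫ w, f w ∂μ := fun s => by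
    rw [← integral_map (hμ (s - 1)).measurable.aemeasurable
      f.continuous.measurable.aestronglyMeasurable, (hμ (s - 1)).map_eq]
  simp only [h]
  simp [hN]

/-- Complete cells contribute the sums of `cellIntegral`; the unfinished last cell contributes at
most `‖f‖ L`, which is lost after division by `T`. -/
theorem tendsto_integral_blockWindow {N : ℕ} {w : ℕ → C(ℝ, E)}
    {f : BoundedContinuousFunction C(ℝ, E) ℝ} {G : ℝ}
    (h : Tendsto (fun k : ℕ => (∑ i ∈ Finset.range k, cellIntegral N f (w i)) / k) atTop (𝓝 G)) :
    Tendsto (fun T : ℝ => T⁻¹ * ∫ t in (0 : ℝ)..T, f (blockWindow N w t)) atTop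
      (𝓝 (G / ((N : ℝ) + 1))) := by
  set L : ℝ := (N : ℝ) + 1 with hLdef
  have hL : 0 < L := by positivity
  have h1 := tendsto_sum_floor_div hL h 0
  have hint : ∀ p q, IntervalIntegrable (fun t => f (blockWindow N w t)) volume p q := fun p q => by
    rw [intervalIntegrable_iff]
    refine Measure.integrableOn_of_bounded (M := ‖f‖) (by simp)
      (f.continuous.measurable.comp (measurable_blockWindow N w)).aestronglyMeasurable
      (Eventually.of_forall fun t => f.norm_coe_le_norm _)
  have h2 : Tendsto (fun T : ℝ => T⁻¹ * (∫ t in (0 : ℝ)..T, f (blockWindow N w t)) -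
      (∑ i ∈ Finset.range (⌊T / L⌋₊ + 0), cellIntegral N f (w i)) / T) atTop (𝓝 0) := by
    have h3 : Tendsto (fun T : ℝ => ‖f‖ * L / T) atTop (𝓝 0) :=
      tendsto_const_nhds.div_atTop tendsto_id
    refine squeeze_zero_norm' ?_ h3
    filter_upwards [eventually_gt_atTop 0] with T hT
    have e : ∑ i ∈ Finset.range (⌊T / L⌋₊ + 0), cellIntegral N f (w i) =
        ∫ t in (0 : ℝ)..⌊T / L⌋₊ * L, f (blockWindow N w t) :=
      (intervalIntegral_blockWindow N w f ⌊T / L⌋₊).symm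
    rw [e, inv_mul_eq_div, ← sub_div, intervalIntegral.integral_interval_sub_left (hint _ _)
      (hint _ _), norm_div, Real.norm_of_nonneg hT.le]
    gcongr
    refine (intervalIntegral.norm_integral_le_of_norm_le_const
      fun t _ => f.norm_coe_le_norm _).trans ?_
    gcongr
    have := sub_cellIndex_mem N hT.le
    rw [cellIndex, ← hLdef] at this
    rw [abs_of_nonneg this.1]
    exact this.2.le
  have h4 := h2.add h1
  rw [zero_add] at h4
  exact h4.congr fun T => by ring

end Sampling

/-! ### Recovery sequences -/

section Recovery

variable {n : ℕ}

local notation "𝔼" n => EuclideanSpace ℝ (Fin n)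

variable {V : (𝔼 n) → ℝ} {c : (𝔼 n) → 𝔼 n} {a : (𝔼 n) → Matrix (Fin n) (Fin n) ℝ}

/-- Subadditivity over unit intervals, each of which has the same mean action by invariance. -/
theorem lintegral_fwAction_natCast_le (hA : Admissible V c a) {μ : Measure C(ℝ, 𝔼 n)}
    (hμ : ∀ t, MeasurePreserving (advance t) μ μ) (N : ℕ) :
    ∫⁻ w, fwAction V c a N w ∂μ ≤ N * ∫⁻ w, fwAction V c a 1 w ∂μ := by
  induction N with
  | zero => simp [fwAction_zero]
  | succ N ih =>
    have hm1 : Measurable fun w : C(ℝ, 𝔼 n) => fwAction V c a 1 w :=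
      (lowerSemicontinuous_fwAction hA zero_le_one).measurable
    calc ∫⁻ w, fwAction V c a (N + 1 : ℕ) w ∂μ
        ≤ ∫⁻ w, (fwAction V c a N w + fwAction V c a 1 (advance N w)) ∂μ :=
          lintegral_mono fun w => by
            rw [Nat.cast_add, Nat.cast_one, add_comm]
            exact fwAction_add_le N.cast_nonneg zero_le_one w
      _ = ∫⁻ w, fwAction V c a N w ∂μ + ∫⁻ w, fwAction V c a 1 w ∂μ := by
          rw [← (hμ N).lintegral_comp hm1]
          exact lintegral_add_right _ (hm1.comp (continuous_advance N).measurable)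
      _ ≤ _ := by
          rw [Nat.cast_add, Nat.cast_one, add_mul, one_mul]
          gcongr

/-- All one-time marginals coincide and a single law is tight. Uniformity in `t` matters because the
block length `N` is chosen after the radius `R`. -/
theorem exists_norm_eval_le {μ : Measure C(ℝ, 𝔼 n)} [IsProbabilityMeasure μ]
    (hμ : ∀ t, MeasurePreserving (advance t) μ μ) {η : ℝ≥0∞} (hη : 0 < η) :
    ∀ᶠ R : ℝ in atTop, ∀ t : ℝ, μ {w | R < ‖w t‖} ≤ η := by
  have hm : Measurable fun w : C(ℝ, 𝔼 n) => w 0 := (continuous_eval_const (0 : ℝ)).measurable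
  have h1 := tendsto_measure_norm_gt_of_isTightMeasureSet
    (isTightMeasureSet_singleton (μ := μ.map fun w : C(ℝ, 𝔼 n) => w 0))
  filter_upwards [h1.eventually_lt_const hη] with R hR t
  simp only [mem_singleton_iff, iSup_iSup_eq_left] at hR
  have hs : MeasurableSet {x : 𝔼 n | R < ‖x‖} := (isOpen_lt continuous_const continuous_norm).measurableSet
  rw [Measure.map_apply hm hs] at hR
  have h2 := (hμ t).measure_preimage (hm hs).nullMeasurableSet
  have h3 : advance t ⁻¹' ((fun w : C(ℝ, 𝔼 n) => w 0) ⁻¹' {x : 𝔼 n | R < ‖x‖}) =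
      {w | R < ‖w t‖} := by
    ext w; simp
  rw [h3] at h2
  rw [h2]
  exact hR.le

/-- An invariant law of finite rate is approximated by the time averages of block windows, and the
concatenated path has nearly the cost of the law. -/
theorem exists_block_approx (hA : Admissible V c a) {K : Set (𝔼 n)} (hK : IsCompact K)
    {μ : ProbabilityMeasure C(ℝ, 𝔼 n)}
    (hμ : ∀ t, MeasurePreserving (advance t) (μ : Measure C(ℝ, 𝔼 n)) (μ : Measure C(ℝ, 𝔼 n)))
    {ρ : ℝ≥0∞} (hρ : ∫⁻ w, fwAction V c a 1 w ∂(μ : Measure C(ℝ, 𝔼 n)) = ρ) (hρt : ρ ≠ ⊤)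
    {U : Set (ProbabilityMeasure C(ℝ, 𝔼 n))} (hU : U ∈ 𝓝 μ) {ε : ℝ} (hε : 0 < ε) (N₀ : ℕ) :
    ∃ N ≥ N₀, ∃ w : ℕ → C(ℝ, 𝔼 n), ∀ᶠ T : ℝ in atTop,
      (∀ hT : 0 < T, averageLaw hT (measurable_blockWindow N w) ∈ U) ∧
      ∀ x ∈ K, fwAction V c a T (concat N x w) ≤ (ρ + ENNReal.ofReal ε) * ENNReal.ofReal T := by
  obtain ⟨I, hI, δ, hδ, hIU⟩ := exists_finite_test hU
  obtain ⟨M, hM⟩ := (hI.image norm).bddAbove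
  replace hM : ∀ f ∈ I, ‖f‖ ≤ M := fun f hf => hM (mem_image_of_mem _ hf)
  set r := ρ.toReal with hr
  have hr0 : 0 ≤ r := ENNReal.toReal_nonneg
  -- `η` bounds both the mass lost by conditioning and the link cost per unit time. The first
  -- smallness condition controls the test integrals, the second the total cost `η + r/(1 - η)`.
  obtain ⟨η, hη0, hη1, hηδ, hηε⟩ : ∃ η : ℝ, 0 < η ∧ η < 1 ∧ 2 * M * η < δ ∧
      η + r / (1 - η) < r + ε := by
    have c1 : ContinuousAt (fun η : ℝ => 2 * M * η) 0 := by fun_prop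
    have c2 : ContinuousAt (fun η : ℝ => η + r / (1 - η)) 0 :=
      continuousAt_id.add (continuousAt_const.div (continuousAt_const.sub continuousAt_id) (by simp))
    have e1 := c1.eventually_lt_const (u := δ) (by simpa using hδ)
    have e2 := c2.eventually_lt_const (u := r + ε) (by simpa using hε)
    have e3 := ((e1.and e2).and (eventually_lt_nhds (zero_lt_one' ℝ))).filter_mono
      (nhdsWithin_le_nhds (s := Ioi 0))
    obtain ⟨η, ⟨⟨h1, h2⟩, h3⟩, h4⟩ := (e3.and self_mem_nhdsWithin).exists
    exact ⟨η, h4, h3, h1, h2⟩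
  obtain ⟨R₀, hR₀⟩ := hK.isBounded.exists_norm_le
  obtain ⟨R, hR, hRK⟩ := ((exists_norm_eval_le hμ (η := ENNReal.ofReal (η / 2))
    (by simpa using hη0)).and (eventually_ge_atTop R₀)).exists
  obtain ⟨B, hB0, hB⟩ := exists_fwAction_line_le hA R
  -- The bound `B` on the cost of a link depends on `R` but not on `N`, so long blocks make `B/(N +
  -- 1) ≤ η`.
  obtain ⟨N, hNB, hN0⟩ := (((tendsto_const_nhds (x := B)).div_atTop
    (tendsto_atTop_add_const_right atTop (1 : ℝ) tendsto_natCast_atTop_atTop)).eventually_le_const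
      hη0 |>.and (eventually_ge_atTop N₀)).exists
  refine ⟨N, hN0, ?_⟩
  set L : ℝ := (N : ℝ) + 1 with hLdef
  have hL : 0 < L := by positivity
  set m : Measure C(ℝ, 𝔼 n) := (μ : Measure C(ℝ, 𝔼 n)) with hm
  -- Samples are conditioned to have both endpoints in the ball of radius `R`, so that every link
  -- joins two points of that ball.
  set A : Set C(ℝ, 𝔼 n) := {w | ‖w 0‖ ≤ R} ∩ {w | ‖w N‖ ≤ R} with hAdef
  have hAm : MeasurableSet A :=
    ((isClosed_le (continuous_eval_const (0 : ℝ)).norm continuous_const).inter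
      (isClosed_le (continuous_eval_const (N : ℝ)).norm
        continuous_const)).measurableSet
  have hAc : m.real Aᶜ ≤ η := by
    have h1 : m Aᶜ ≤ ENNReal.ofReal η := by
      have h2 : Aᶜ ⊆ {w | R < ‖w 0‖} ∪ {w | R < ‖w N‖} := fun w hw => by
        by_contra hc
        simp only [mem_union, mem_ofPred_eq, not_or, not_lt] at hc
        exact hw hc
      refine (measure_mono h2).trans ((measure_union_le _ _).trans
        ((add_le_add (hR 0) (hR N)).trans_eq ?_))
      rw [← ENNReal.ofReal_add (by positivity) (by positivity), add_halves]
    exact ENNReal.toReal_le_of_le_ofReal hη0.le h1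
  have hAr : 1 - η ≤ m.real A := by
    have := probReal_compl_eq_one_sub (μ := m) hAm
    linarith
  have hA0 : m A ≠ 0 := fun h0 => by
    rw [measureReal_def, h0, ENNReal.toReal_zero] at hAr
    linarith
  set ν := ProbabilityTheory.cond m A with hν
  have hνp : IsProbabilityMeasure ν := ProbabilityTheory.cond_isProbabilityMeasure hA0
  have hcm : Measurable fun w : C(ℝ, 𝔼 n) => fwAction V c a N w :=
    (lowerSemicontinuous_fwAction hA N.cast_nonneg).measurable
  have hcost : ∫⁻ w, fwAction V c a N w ∂ν ≤ (m A)⁻¹ * (N * ρ) := by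
    refine (lintegral_cond_le m A _).trans ?_
    gcongr
    rw [← hρ]
    exact lintegral_fwAction_natCast_le hA hμ N
  have hcostt : (m A)⁻¹ * (N * ρ) ≠ ⊤ :=
    ENNReal.mul_ne_top (ENNReal.inv_ne_top.2 hA0) (ENNReal.mul_ne_top (ENNReal.natCast_ne_top N) hρt)
  have hcostf := ne_top_of_le_ne_top hcostt hcost
  have hci : Integrable (fun w : C(ℝ, 𝔼 n) => (fwAction V c a N w).toReal) ν :=
    integrable_toReal_of_lintegral_ne_top hcm.aemeasurable hcostf
  have hfin : ∀ᵐ w : C(ℝ, 𝔼 n) ∂ν, fwAction V c a N w < ⊤ := ae_lt_top hcm hcostf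
  have hH : ∫ w, (fwAction V c a N w).toReal ∂ν ≤ N * (r / (1 - η)) := by
    rw [integral_toReal hcm.aemeasurable hfin]
    refine (ENNReal.toReal_mono hcostt hcost).trans ?_
    rw [ENNReal.toReal_mul, ENNReal.toReal_mul, ENNReal.toReal_inv, ENNReal.toReal_natCast,
      ← measureReal_def, ← hr]
    have : (m.real A)⁻¹ ≤ (1 - η)⁻¹ := inv_anti₀ (by linarith) hAr
    calc (m.real A)⁻¹ * (N * r) ≤ (1 - η)⁻¹ * (N * r) := by gcongr
      _ = N * (r / (1 - η)) := by ring
  have : Countable I := hI.countable.to_subtype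
  -- One sample sequence must satisfy the law of large numbers for the cost of a cell (`none`) and
  -- for every test function (`some f`).
  let F : Option I → C(ℝ, 𝔼 n) → ℝ := fun j => j.elim
    (fun w => B + (fwAction V c a N w).toReal) fun f => cellIntegral N f.1
  obtain ⟨w, hw, hwF⟩ := exists_seq_tendsto_average ν (f := F)
    (A := A ∩ {w | fwAction V c a N w < ⊤})
    (fun j => by
      cases j with
      | none => exact measurable_const.add hcm.ennreal_toReal
      | some f => exact measurable_cellIntegral N f.1)
    (fun j => by
      cases j with
      | none => exact (integrable_const B).add hci
      | some f =>
        exact Integrable.of_bound (measurable_cellIntegral N f.1).aestronglyMeasurable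
          (‖f.1‖ * L) (Eventually.of_forall fun w => abs_cellIntegral_le N f.1 w))
    (by filter_upwards [ProbabilityTheory.ae_cond_mem hAm, hfin] with w h1 h2 using ⟨h1, h2⟩)
  refine ⟨w, ?_⟩
  have hmean : ∀ᶠ T : ℝ in atTop, ∀ f ∈ I,
      |T⁻¹ * (∫ t in (0 : ℝ)..T, f (blockWindow N w t)) - ∫ v, f v ∂m| < δ := by
    refine hI.eventually_all.2 fun f hf => ?_
    have h1 := tendsto_integral_blockWindow (hwF (some ⟨f, hf⟩))
    have h2 : |(∫ v, cellIntegral N f v ∂ν) - L * ∫ v, f v ∂m| ≤ 2 * (‖f‖ * L) * η := by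
      rw [hLdef, ← integral_cellIntegral hμ N f]
      refine (abs_integral_cond_sub_le hAm hA0 (measurable_cellIntegral N f)
        (abs_cellIntegral_le N f)).trans ?_
      gcongr
    have h3 : |(∫ v, cellIntegral N f v ∂ν) / L - ∫ v, f v ∂m| < δ := by
      have e : (∫ v, cellIntegral N f v ∂ν) / L - ∫ v, f v ∂m =
          ((∫ v, cellIntegral N f v ∂ν) - L * ∫ v, f v ∂m) / L := by
        field_simp
      rw [e, abs_div, abs_of_pos hL, div_lt_iff₀ hL]
      refine h2.trans_lt ?_
      have := mul_le_mul_of_nonneg_right (hM f hf) hη0.le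
      nlinarith
    exact ((h1.sub_const _).abs).eventually_lt_const h3
  -- The extra index charges the unfinished last cell in full, which only increases the cost.
  have hcostT : ∀ᶠ T : ℝ in atTop,
      (∑ i ∈ Finset.range (⌊T / L⌋₊ + 1), F none (w i)) / T < r + ε := by
    refine (tendsto_sum_floor_div hL (hwF none) 1).eventually_lt_const ?_
    have e : ∫ v, F none v ∂ν = B + ∫ v, (fwAction V c a N v).toReal ∂ν := by
      change ∫ v, (B + (fwAction V c a N v).toReal) ∂ν = _
      rw [integral_add (integrable_const B) hci]
      simp
    rw [e, add_div]
    refine lt_of_le_of_lt (add_le_add hNB ?_) hηε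
    rw [div_le_iff₀ hL]
    refine hH.trans ?_
    rw [mul_comm]
    have : 0 ≤ r / (1 - η) := div_nonneg hr0 (by linarith)
    gcongr
    rw [hLdef]
    linarith
  filter_upwards [hmean, hcostT, eventually_gt_atTop 0] with T h1 h2 hT
  refine ⟨fun hT => hIU _ fun f hf => ?_, fun x hx => ?_⟩
  · rw [integral_averageLaw hT _ f.continuous.stronglyMeasurable]
    exact h1 f hf
  · have hTk : T ≤ ((⌊T / L⌋₊ + 1 : ℕ) : ℝ) * L := by
      have := (Nat.lt_floor_add_one (T / L)).le
      rw [div_le_iff₀ hL] at this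
      push_cast
      exact this
    have hstart : ∀ i, ‖startPoint N x w i‖ ≤ R := fun i => by
      cases i with
      | zero => exact (hR₀ x hx).trans hRK
      | succ i => exact (hw i).1.2
    refine (fwAction_mono hT.le hTk _).trans ((fwAction_concat_le N x w _).trans ?_)
    calc ∑ i ∈ Finset.range (⌊T / L⌋₊ + 1), (fwAction V c a 1
          (fun t => startPoint N x w i + t • (w i 0 - startPoint N x w i)) + fwAction V c a N (w i))
        ≤ ∑ i ∈ Finset.range (⌊T / L⌋₊ + 1), ENNReal.ofReal (F none (w i)) := by
          refine Finset.sum_le_sum fun i _ => ?_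
          rw [show F none (w i) = B + (fwAction V c a N (w i)).toReal from rfl,
            ENNReal.ofReal_add hB0 ENNReal.toReal_nonneg, ENNReal.ofReal_toReal (hw i).2.ne]
          gcongr
          exact hB _ _ (hstart i) (hw i).1.1
      _ = ENNReal.ofReal (∑ i ∈ Finset.range (⌊T / L⌋₊ + 1), F none (w i)) :=
          (ENNReal.ofReal_sum_of_nonneg fun i _ => add_nonneg hB0 ENNReal.toReal_nonneg).symm
      _ ≤ ENNReal.ofReal ((r + ε) * T) :=
          ENNReal.ofReal_le_ofReal ((div_le_iff₀ hT).1 h2.le)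
      _ = (ρ + ENNReal.ofReal ε) * ENNReal.ofReal T := by
          rw [ENNReal.ofReal_mul (by positivity), ENNReal.ofReal_add hr0 hε.le, hr,
            ENNReal.ofReal_toReal hρt]

/-- Countably many eventual properties hold together along a slowly growing index. -/
theorem exists_tendsto_atTop_eventually {p : ℕ → ℝ → Prop} (h : ∀ k, ∀ᶠ T in atTop, p k T) :
    ∃ κ : ℝ → ℕ, Tendsto κ atTop atTop ∧ ∀ᶠ T in atTop, p (κ T) T := by
  choose τ hτ using fun k => eventually_atTop.1 (h k)
  classical
  -- The largest `k ≤ ⌊T⌋` whose threshold has been passed; the bound `⌊T⌋` keeps the search finite,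
  -- and `k = 0` is a valid answer once `τ 0 ≤ T`.
  let κ : ℝ → ℕ := fun T => Nat.findGreatest (fun k => τ k ≤ T) ⌊T⌋₊
  refine ⟨κ, tendsto_atTop.2 fun k => ?_, ?_⟩
  · filter_upwards [eventually_ge_atTop (τ k), eventually_ge_atTop (k : ℝ)] with T h1 h2
    exact Nat.le_findGreatest (Nat.le_floor h2) h1
  · filter_upwards [eventually_ge_atTop (τ 0)] with T hT
    exact hτ _ T (Nat.findGreatest_spec (P := fun k => τ k ≤ T) (Nat.zero_le _) hT)

theorem contractedRate_empiricalProcess_le (x : 𝔼 n) {T : ℝ} (hT : 0 < T)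
    (X : C(Icc (0 : ℝ) T, 𝔼 n)) {Y : ℝ → 𝔼 n} (h0 : Y 0 = x)
    (hXY : EqOn (IccExtend hT.le X) Y (Icc 0 T)) :
    contractedRate V c a x T (empiricalProcess hT X) ≤ fwAction V c a T Y := by
  refine (iInf_le_of_le hT (iInf_le_of_le X (iInf_le_of_le rfl le_rfl))).trans_eq ?_
  have h1 : X ⟨0, left_mem_Icc.2 hT.le⟩ = x := by
    rw [← h0, ← hXY (left_mem_Icc.2 hT.le), IccExtend_of_mem _ _ (left_mem_Icc.2 hT.le)]
  rw [fwActionFrom, if_pos h1]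
  exact fwAction_congr hT.le hXY

/-- The limsup inequality: every invariant law has a recovery sequence. -/
theorem exists_recovery (hA : Admissible V c a) {K : Set (𝔼 n)} (hK : IsCompact K)
    (P : InvariantProb (𝔼 n)) {x : ℝ → 𝔼 n} (hx : ∀ T, x T ∈ K) :
    ∃ Q : ℝ → InvariantProb (𝔼 n), Tendsto Q atTop (𝓝 P) ∧
      limsup (fun T : ℝ => contractedRate V c a (x T) T (Q T) / ENNReal.ofReal T) atTop ≤
        rate V c a P := by
  by_cases hP : rate V c a P = ⊤
  · exact ⟨fun _ => P, tendsto_const_nhds, by rw [hP]; exact le_top⟩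
  obtain ⟨μ, hμP, hμ, hρ⟩ := exists_law_of_rate_ne_top hP
  obtain ⟨U, hU⟩ := (𝓝 μ).exists_antitone_basis
  choose N hN w hw using fun k : ℕ => exists_block_approx hA hK hμ hρ hP (hU.mem k)
    (ε := 1 / ((k : ℝ) + 1)) (by positivity) k
  -- The family is indexed by all real `T`, so the horizon `max T 1` is used: it is always positive
  -- and eventually equals `T`.
  have hmax : Tendsto (fun T : ℝ => max T 1) atTop atTop :=
    tendsto_atTop_mono (fun T => le_max_left _ _) tendsto_id
  have hpos : ∀ T : ℝ, 0 < max T 1 := fun T => lt_max_of_lt_right one_pos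
  obtain ⟨κ, hκ, hp⟩ := exists_tendsto_atTop_eventually fun k => hmax.eventually (hw k)
  let Y : ℝ → ℝ → 𝔼 n := fun T => concat (N (κ T)) (x T) (w (κ T))
  -- Continuity of the concatenation follows from its finite action, hence only for large `T`; a
  -- constant path is a harmless default for the others.
  have hX : ∀ T, ∃ X : C(Icc (0 : ℝ) (max T 1), 𝔼 n), ContinuousOn (Y T) (Icc 0 (max T 1)) →
      EqOn (IccExtend (hpos T).le X) (Y T) (Icc 0 (max T 1)) := fun T => by
    by_cases hc : ContinuousOn (Y T) (Icc 0 (max T 1))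
    · exact ⟨⟨_, hc.domRestrict⟩, fun _ t ht => IccExtend_of_mem _ _ ht⟩
    · exact ⟨ContinuousMap.const _ 0, fun h => absurd h hc⟩
  choose X hX using hX
  have hXY : ∀ᶠ T in atTop, EqOn (IccExtend (hpos T).le (X T)) (Y T) (Icc 0 (max T 1)) := by
    filter_upwards [hp] with T hT
    refine hX T ((isH1_of_fwAction_ne_top (V := V) (c := c) (a := a) (hpos T).le
      (ne_top_of_le_ne_top ?_ (hT.2 (x T) (hx T)))).continuousOn (hpos T).le)
    exact ENNReal.mul_ne_top (ENNReal.add_ne_top.2 ⟨hP, ENNReal.ofReal_ne_top⟩)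
      ENNReal.ofReal_ne_top
  have hcost : ∀ᶠ T in atTop, contractedRate V c a (x T) (max T 1)
      (empiricalProcess (hpos T) (X T)) ≤
        (rate V c a P + ENNReal.ofReal (1 / ((κ T : ℝ) + 1))) * ENNReal.ofReal (max T 1) := by
    filter_upwards [hp, hXY] with T hT hT'
    exact (contractedRate_empiricalProcess_le (x T) (hpos T) (X T) (concat_zero _ _ _) hT').trans
      (hT.2 (x T) (hx T))
  have hlim : Tendsto (fun T => (empiricalProcess (hpos T) (X T)).1) atTop (𝓝 P.1) := by
    rw [← hμP]
    refine tendsto_empiricalProcess hpos X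
      (fun T => measurable_blockWindow (N (κ T)) (w (κ T))) ?_ fun m ε hε => ?_
    · refine hU.tendsto_right_iff.2 fun k _ => ?_
      filter_upwards [hp, hκ.eventually_ge_atTop k] with T hT hk
      exact hU.antitone hk (hT.1 (hpos T))
    -- The bad set of `exists_bad_set` has relative measure at most `(2m + 1)/(N + 1) + (3m + 1)/T`,
    -- and `N ≥ κ T` tends to infinity.
    · have h1 : ∀ᶠ T in atTop, (2 * m + 1) / ((κ T : ℝ) + 1) ≤ ε / 2 :=
        ((tendsto_const_nhds (x := (2 * m + 1 : ℝ))).div_atTop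
          (tendsto_atTop_add_const_right atTop (1 : ℝ)
            (tendsto_natCast_atTop_atTop.comp hκ))).eventually_le_const (by positivity)
      have h2 : ∀ᶠ T : ℝ in atTop, (3 * m + 1) / (max T 1) ≤ ε / 2 :=
        ((tendsto_const_nhds (x := (3 * m + 1 : ℝ))).div_atTop hmax).eventually_le_const
          (by positivity)
      filter_upwards [h1, h2, hXY] with T e1 e2 e3
      obtain ⟨B, hB, hBv, hBa⟩ := exists_bad_set (N (κ T)) m (x T) (w (κ T)) (hpos T)
      refine ⟨B, hB, hBv.trans (ENNReal.ofReal_le_ofReal ?_), fun t ht s hs => ?_⟩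
      · have e4 : (2 * m + 1) / ((N (κ T) : ℝ) + 1) ≤ ε / 2 := by
          refine le_trans ?_ e1
          gcongr
          exact hN (κ T)
        have hT := hpos T
        rw [div_le_iff₀ hT] at e2
        have e5 := mul_le_mul_of_nonneg_right e4 hT.le
        have e6 : (max T 1 / ((N (κ T) : ℝ) + 1) + 1) * (2 * m + 1) + m =
            (2 * m + 1) / ((N (κ T) : ℝ) + 1) * max T 1 + (3 * m + 1) := by
          field_simp
          ring
        rw [e6]
        linarith
      · obtain ⟨h3, h4⟩ := hBa t ht s hs
        rw [h4, periodization_eq_extendPath (hpos T) (X T) h3, coe_extendPath,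
          e3 (Ico_subset_Icc_self h3)]
  refine ⟨fun T => empiricalProcess (hpos T) (X T), tendsto_subtype_rng.2 hlim, ?_⟩
  have hg : Tendsto (fun T : ℝ => rate V c a P + ENNReal.ofReal (1 / ((κ T : ℝ) + 1))) atTop
      (𝓝 (rate V c a P)) := by
    have h1 : Tendsto (fun T => 1 / ((κ T : ℝ) + 1)) atTop (𝓝 0) :=
      tendsto_one_div_add_atTop_nhds_zero_nat.comp hκ
    have h2 := (ENNReal.tendsto_ofReal h1).const_add (rate V c a P)
    rwa [ENNReal.ofReal_zero, add_zero] at h2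
  rw [← hg.limsup_eq]
  refine limsup_le_limsup ?_
  filter_upwards [hcost, eventually_ge_atTop 1] with T hT h1
  generalize empiricalProcess (hpos T) (X T) = Q at hT ⊢
  rw [max_eq_left h1] at hT
  exact ENNReal.div_le_of_le_mul hT

end Recovery

end EmpiricalProcess

end

theorem theorem2p2 {n : ℕ} (V : EuclideanSpace ℝ (Fin n) → ℝ)
    (c : EuclideanSpace ℝ (Fin n) → EuclideanSpace ℝ (Fin n))
    (a : EuclideanSpace ℝ (Fin n) → Matrix (Fin n) (Fin n) ℝ) (hVca : Admissible V c a)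
    (K : Set (EuclideanSpace ℝ (Fin n))) (hK : IsCompact K) :
    -- (i) pre-compactness
    (∀ (P : ℝ → InvariantProb (EuclideanSpace ℝ (Fin n))) (x : ℝ → EuclideanSpace ℝ (Fin n)),
      (∀ T, x T ∈ K) →
      liminf (fun T : ℝ => contractedRate V c a (x T) T (P T) / ENNReal.ofReal T) atTop < ⊤ →
      ∃ τ : ℕ → ℝ, Tendsto τ atTop atTop ∧ IsCompact (closure (range fun k => P (τ k)))) ∧
    -- (ii) liminf inequality
    (∀ (P : InvariantProb (EuclideanSpace ℝ (Fin n))) (x : ℝ → EuclideanSpace ℝ (Fin n))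
      (Q : ℝ → InvariantProb (EuclideanSpace ℝ (Fin n))),
      (∀ T, x T ∈ K) → Tendsto Q atTop (𝓝 P) →
      rate V c a P ≤
        liminf (fun T : ℝ => contractedRate V c a (x T) T (Q T) / ENNReal.ofReal T) atTop) ∧
    -- (iii) recovery sequences
    (∀ (P : InvariantProb (EuclideanSpace ℝ (Fin n))) (x : ℝ → EuclideanSpace ℝ (Fin n)),
      (∀ T, x T ∈ K) →
      ∃ Q : ℝ → InvariantProb (EuclideanSpace ℝ (Fin n)), Tendsto Q atTop (𝓝 P) ∧
        limsup (fun T : ℝ => contractedRate V c a (x T) T (Q T) / ENNReal.ofReal T) atTop ≤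
          rate V c a P) := by
  exact ⟨fun _ _ hx h => precompact_of_liminf_lt_top hVca hK hx h,
    fun _ _ _ hx hQ => rate_le_liminf hVca hK hx hQ,
    fun P _ hx => exists_recovery hVca hK P hx⟩
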